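/- Let $d\in\mathbb N$, $T>0$, let $D\subset\mathbb R^d$ be open, and put $Q=(0,T)\times D$. Let $\mathcal H'$ be a Banach space of (a.e. classes of) locally integrable functions on $Q$, continuously embedded in $L^1_{\mathrm{loc}}(Q)$, and let $\mathcal H\subset\mathcal H'$ be a commutative unital Banach algebra under pointwise multiplication, continuously embedded in $\mathcal H'$, such that pointwise multiplication maps $\mathcal H\times\mathcal H'$ continuously into $\mathcal H'$. (The spaces are complexified, i.e. they consist of complex-valued functions.) Write $H=\mathcal H^{d\times d}$, $H'=\mathcal H'^{d\times d}$, and let $H_{sym}$ be the set of symmetric matrices in $H$ with real-valued entries. Let $u:Q\to\mathbb R^d$ be a velocity field with weak gradient $(\nabla u)_{ij}=\partial_j u_i\in\mathcal H'$, and put $\varepsilon=\frac12(\nabla u+\nabla u^T)$, $\Omega=\frac12(\nabla u-\nabla u^T)$. Let $\lambda>0$ and $\Psi\in H_{sym}$. Let $P$ be analytic on an open set $U\subset\mathbb C$ that contains the spectrum of $\exp\Psi$ in $H$, with $P(\exp\Psi):=\frac1{2\pi i}\int_{\Gamma_P}P(z)(z-\exp\Psi)^{-1}dz$, where $\Gamma_P$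 is a closed piecewise $C^1$ path in $U$ that avoids this spectrum, has winding number $1$ about each of its points and winding number $0$ about each point outside $U$ (for example, $P(\sigma)=\sigma-1$ for Oldroyd-B and $P(\sigma)=\sigma-1+\alpha(\sigma-1)^2$ for Giesekus). Let $\Gamma$ be any closed piecewise $C^1$ path in the strip $\{|\operatorname{Im}z|<\pi\}$ that avoids the spectrum of $\Psi$ in $H$ and has winding number $1$ about each of its points, this spectrum being contained in the strip. Let $f(x)=x+\frac{2x}{e^x-1}=\frac{x}{\tanh(x/2)}$, $f(0)=2$. Suppose that the entries of $\Psi$ have locally integrable first-order weak derivatives on $Q$, that $\partial_t\Psi+(u\cdot\nabla)\Psi\in H'$, and that $\Psi$ satisfies the log-conformation equation $$\partial_t\Psi+(u\cdot\nabla)\Psi+[\Psi,\Omega]-\frac1{(2\pi i)^2}\int_\Gamma\int_\Gamma f(z-z')\,(z-\Psi)^{-1}\,\varepsilon\,(z'-\Psi)^{-1}\,dz\,dz'=-\frac1\lambda P(e^\Psi)e^{-\Psi}.$$ Then $\sigma=\exp\Psi$ belongs to $H_{sym}$, its entries have locally integrable first-order weak derivatives on $Q$, $\partial_t\sigma+(u\cdot\nabla)\sigma\in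 H'$, and $\sigma$ solves the constitutive equation $$\partial_t\sigma+(u\cdot\nabla)\sigma+[\sigma,\Omega]-\varepsilon\sigma-\sigma\varepsilon=-\frac1\lambda P(\sigma).$$ -/

import Mathlib

open MeasureTheory Set
open scoped ContDiff

noncomputable section

namespace LogConformation

/-! ### Space-time and weak derivatives -/

/-- Space-time `ℝ × ℝᵈ`, with points `(t, x)`. -/
abbrev SpaceTime (d : ℕ) : Type := ℝ × EuclideanSpace ℝ (Fin d)

/-- The space-time cylinder `(0, T) × D` over a spatial domain `D`. -/
def cylinder {d : ℕ} (T : ℝ) (D : Set (EuclideanSpace ℝ (Fin d))) : Set (SpaceTime d) :=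
  Ioo 0 T ×ˢ D

/-- The direction of the time axis. -/
def timeDir (d : ℕ) : SpaceTime d := (1, 0)

/-- The direction of the `i`-th spatial axis. -/
def spaceDir {d : ℕ} (i : Fin d) : SpaceTime d := (0, EuclideanSpace.single i 1)

/-- `g` is the weak (distributional) derivative of `f` in the direction `v` on the open set `Q`:
both are locally integrable on `Q`, and `∫ (∂ᵥ φ) f = - ∫ φ g` for all test functions `φ`. -/
structure HasWeakDeriv {d : ℕ} (Q : Set (SpaceTime d)) (f : SpaceTime d → ℂ) (v : SpaceTime d)
    (g : SpaceTime d → ℂ) : Prop where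
  locallyIntegrable : LocallyIntegrableOn f Q
  locallyIntegrable_deriv : LocallyIntegrableOn g Q
  integral_eq : ∀ φ : SpaceTime d → ℝ, ContDiff ℝ ∞ φ → HasCompactSupport φ → tsupport φ ⊆ Q →
    ∫ x in Q, (fderiv ℝ φ x v : ℂ) * f x = - ∫ x in Q, (φ x : ℂ) * g x

/-! ### The pair of function spaces -/

/-- `B` is a Banach space of (classes of) locally integrable functions on `Q`, continuously
embedded in `L¹_loc(Q)`, and `A ⊆ B` is a commutative Banach algebra, continuously embedded in `B`,
whose multiplication is the pointwise one; multiplication by elements of `A` maps `B` to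
itself (its joint continuity is the instance `ContinuousSMul A B`).  Scalars are complex: `A` and
`B` are the complexifications of the underlying spaces of real-valued functions. -/
structure FunctionSpaces {d : ℕ} (Q : Set (SpaceTime d)) (A B : Type*)
    [NormedCommRing A] [NormedAlgebra ℂ A] [NormedAddCommGroup B] [NormedSpace ℂ B]
    [Module A B] where
  /-- the function represented by an element of `A` -/
  funA : A →ₗ[ℂ] (SpaceTime d →ₘ[volume.restrict Q] ℂ)
  /-- the function represented by an element of `B` -/
  funB : B →ₗ[ℂ] (SpaceTime d →ₘ[volume.restrict Q] ℂ)
  /-- the inclusion of `A` into `B` -/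
  incl : A →L[ℂ] B
  funA_one : funA 1 = 1
  funA_mul : ∀ a b : A, funA (a * b) = funA a * funA b
  funB_injective : Function.Injective funB
  incl_injective : Function.Injective incl
  funB_incl : ∀ a : A, funB (incl a) = funA a
  funB_smul : ∀ (a : A) (b : B), funB (a • b) = funA a * funB b
  locally_bounded : ∀ K : Set (SpaceTime d), IsCompact K → K ⊆ Q →
    ∃ C : ℝ, 0 ≤ C ∧ ∀ b : B, ∫⁻ x in K, ‖funB b x‖ₑ ≤ ENNReal.ofReal (C * ‖b‖)

/-- Symmetric `d × d` matrices of real-valued functions from the algebra `A`. -/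
def FunctionSpaces.HSym {d : ℕ} {Q : Set (SpaceTime d)} {A B : Type*}
    [NormedCommRing A] [NormedAlgebra ℂ A] [NormedAddCommGroup B] [NormedSpace ℂ B]
    [Module A B] (S : FunctionSpaces Q A B) : Set (Matrix (Fin d) (Fin d) A) :=
  {M | M.transpose = M ∧ ∀ k l, ∀ᵐ x ∂(volume.restrict Q), (S.funA (M k l) x).im = 0}

/-- `(∂ₜ + u · ∇) M = N` on `Q`, entry by entry, with weak derivatives `∂ₜ M`, `∂ᵢ M` of the matrix
`M` over `A` and a matrix `N` over `B`. -/
def FunctionSpaces.HasMaterialDeriv {d : ℕ} {Q : Set (SpaceTime d)} {A B : Type*}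
    [NormedCommRing A] [NormedAlgebra ℂ A] [NormedAddCommGroup B] [NormedSpace ℂ B]
    [Module A B] (S : FunctionSpaces Q A B) (u : SpaceTime d → EuclideanSpace ℝ (Fin d))
    (M : Matrix (Fin d) (Fin d) A) (N : Matrix (Fin d) (Fin d) B) : Prop :=
  ∀ k l, ∃ (ft : SpaceTime d → ℂ) (fx : Fin d → SpaceTime d → ℂ),
    HasWeakDeriv Q (S.funA (M k l)) (timeDir d) ft ∧
    (∀ i, HasWeakDeriv Q (S.funA (M k l)) (spaceDir i) (fx i)) ∧
    ∀ᵐ x ∂(volume.restrict Q), ft x + ∑ i, (u x i : ℂ) * fx i x = S.funB (N k l) x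

/-- `G` is the velocity gradient, `G i j = ∂ⱼ uᵢ` weakly on `Q`, with all entries in `B`. -/
def FunctionSpaces.HasGradient {d : ℕ} {Q : Set (SpaceTime d)} {A B : Type*}
    [NormedCommRing A] [NormedAlgebra ℂ A] [NormedAddCommGroup B] [NormedSpace ℂ B]
    [Module A B] (S : FunctionSpaces Q A B) (u : SpaceTime d → EuclideanSpace ℝ (Fin d))
    (G : Matrix (Fin d) (Fin d) B) : Prop :=
  ∀ i j, HasWeakDeriv Q (fun x => (u x i : ℂ)) (spaceDir j) (S.funB (G i j))

/-- The strain tensor `ε(u) = (∇u + ∇uᵀ) / 2`. -/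
def strain {d : ℕ} {B : Type*} [AddCommGroup B] [Module ℂ B] (G : Matrix (Fin d) (Fin d) B) :
    Matrix (Fin d) (Fin d) B :=
  (1 / 2 : ℂ) • (G + G.transpose)

/-- The vorticity tensor `Ω(u) = (∇u - ∇uᵀ) / 2`. -/
def vorticity {d : ℕ} {B : Type*} [AddCommGroup B] [Module ℂ B] (G : Matrix (Fin d) (Fin d) B) :
    Matrix (Fin d) (Fin d) B :=
  (1 / 2 : ℂ) • (G - G.transpose)

/-! ### Products of matrices over `A` with matrices over `B` -/

/-- The matrix product `M N` for `M` over `A` and `N` over `B`. -/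
def mulL {d : ℕ} {A B : Type*} [CommRing A] [AddCommGroup B] [Module A B]
    (M : Matrix (Fin d) (Fin d) A) (N : Matrix (Fin d) (Fin d) B) : Matrix (Fin d) (Fin d) B :=
  Matrix.of fun k l => ∑ i, M k i • N i l

/-- The matrix product `N M` for `N` over `B` and `M` over `A`. -/
def mulR {d : ℕ} {A B : Type*} [CommRing A] [AddCommGroup B] [Module A B]
    (N : Matrix (Fin d) (Fin d) B) (M : Matrix (Fin d) (Fin d) A) : Matrix (Fin d) (Fin d) B :=
  Matrix.of fun k l => ∑ i, M i l • N k i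

/-- The commutator `[M, N] = M N - N M` for `M` over `A` and `N` over `B`. -/
def comm {d : ℕ} {A B : Type*} [CommRing A] [AddCommGroup B] [Module A B]
    (M : Matrix (Fin d) (Fin d) A) (N : Matrix (Fin d) (Fin d) B) : Matrix (Fin d) (Fin d) B :=
  mulL M N - mulR N M

/-! ### Contours -/

/-- A closed, piecewise continuously differentiable path `γ : [0, 1] → ℂ`. -/
structure IsClosedPath (γ : ℝ → ℂ) : Prop where
  continuousOn : ContinuousOn γ (Icc 0 1)
  closed : γ 0 = γ 1
  piecewise : ∃ s : Finset ℝ, ∀ p q : ℝ, 0 ≤ p → p < q → q ≤ 1 → (∀ r ∈ s, r ∉ Ioo p q) →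
    ContDiffOn ℝ 1 γ (Icc p q)

/-- The contour integral `∫_γ F(z) dz` along a path parametrized by `[0, 1]`. -/
def contourIntegral {E : Type*} [NormedAddCommGroup E] [NormedSpace ℂ E] (γ : ℝ → ℂ) (F : ℂ → E) :
    E :=
  ∫ t in (0 : ℝ)..1, deriv γ t • F (γ t)

/-- The winding number of `γ` about `w`. -/
def windingNumber (γ : ℝ → ℂ) (w : ℂ) : ℂ :=
  (2 * Real.pi * Complex.I)⁻¹ * contourIntegral γ (fun z => (z - w)⁻¹)

/-- `γ` is a closed path in `U` that surrounds the set `K ⊆ U` exactly once, within `U`: it avoids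
`K`, winds once around each point of `K` and does not wind around any point outside `U`. -/
structure EncirclesOnce (γ : ℝ → ℂ) (K U : Set ℂ) : Prop where
  isClosedPath : IsClosedPath γ
  mem : ∀ t ∈ Icc (0 : ℝ) 1, γ t ∈ U
  notMem : ∀ t ∈ Icc (0 : ℝ) 1, γ t ∉ K
  subset : K ⊆ U
  winding_eq_one : ∀ w ∈ K, windingNumber γ w = 1
  winding_eq_zero : ∀ w ∉ U, windingNumber γ w = 0

/-- The strip `|Im z| < π`. -/
def strip : Set ℂ := {z | |z.im| < Real.pi}

/-! ### Dunford integrals; `resolvent M z` is `(z - M)⁻¹` -/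

/-- The Dunford integral `g(M) = (2πi)⁻¹ ∫_γ g(z) (z - M)⁻¹ dz`, entry by entry. -/
def dunford {d : ℕ} {A : Type*} [NormedCommRing A] [NormedAlgebra ℂ A] (γ : ℝ → ℂ) (g : ℂ → ℂ)
    (M : Matrix (Fin d) (Fin d) A) : Matrix (Fin d) (Fin d) A :=
  Matrix.of fun k l =>
    (2 * Real.pi * Complex.I : ℂ)⁻¹ • contourIntegral γ (fun z => g z • resolvent M z k l)

/-- The function `f(x) = x + 2x / (eˣ - 1) = x / tanh(x / 2)`, with its limit `2` at `x = 0`. -/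
def strainSymbol (x : ℂ) : ℂ :=
  if x = 0 then 2 else x / Complex.tanh (x / 2)

/-- The double Dunford-type integral
`(2πi)⁻² ∫_γ ∫_γ f(z - z') (z - M)⁻¹ N (z' - M)⁻¹ dz dz'`, entry by entry. -/
def doubleDunford {d : ℕ} {A B : Type*} [NormedCommRing A] [NormedAlgebra ℂ A]
    [NormedAddCommGroup B] [NormedSpace ℂ B] [Module A B] (γ : ℝ → ℂ) (f : ℂ → ℂ)
    (M : Matrix (Fin d) (Fin d) A) (N : Matrix (Fin d) (Fin d) B) : Matrix (Fin d) (Fin d) B :=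
  Matrix.of fun k l =>
    ((2 * Real.pi * Complex.I : ℂ) ^ 2)⁻¹ •
      contourIntegral γ (fun z' => contourIntegral γ (fun z =>
        f (z - z') • mulR (mulL (resolvent M z) N) (resolvent M z') k l))

/-! ### The two constitutive equations -/

/-- `σ` solves the constitutive equation for the conformation tensor,
`∂ₜ σ + (u · ∇) σ + [σ, Ω(u)] - ε(u) σ - σ ε(u) = - P(σ) / lam`, where `G = ∇u` and `P(σ)` is the
Dunford integral along the contour `γP`. -/
def FunctionSpaces.SolvesConformation {d : ℕ} {Q : Set (SpaceTime d)} {A B : Type*}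
    [NormedCommRing A] [NormedAlgebra ℂ A] [NormedAddCommGroup B] [NormedSpace ℂ B]
    [Module A B] (S : FunctionSpaces Q A B) (u : SpaceTime d → EuclideanSpace ℝ (Fin d))
    (G : Matrix (Fin d) (Fin d) B) (lam : ℝ) (P : ℂ → ℂ) (γP : ℝ → ℂ)
    (σ : Matrix (Fin d) (Fin d) A) : Prop :=
  ∃ N : Matrix (Fin d) (Fin d) B, S.HasMaterialDeriv u σ N ∧
    N + comm σ (vorticity G) - mulR (strain G) σ - mulL σ (strain G)
      = -((1 / lam : ℂ) • (dunford γP P σ).map S.incl)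

/-- `Ψ` solves the log-conformation equation
`∂ₜ Ψ + (u · ∇) Ψ + [Ψ, Ω(u)] - (2πi)⁻² ∫_γ ∫_γ f(z - z') (z - Ψ)⁻¹ ε(u) (z' - Ψ)⁻¹ dz dz'
= - P(exp Ψ) exp(-Ψ) / lam`, where `G = ∇u` and `P(exp Ψ)` is the Dunford integral along `γP`. -/
def FunctionSpaces.SolvesLogConformation {d : ℕ} {Q : Set (SpaceTime d)} {A B : Type*}
    [NormedCommRing A] [NormedAlgebra ℂ A] [NormedAddCommGroup B] [NormedSpace ℂ B]
    [Module A B] (S : FunctionSpaces Q A B) (u : SpaceTime d → EuclideanSpace ℝ (Fin d))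
    (G : Matrix (Fin d) (Fin d) B) (lam : ℝ) (P : ℂ → ℂ) (γP : ℝ → ℂ) (γ : ℝ → ℂ)
    (Ψ : Matrix (Fin d) (Fin d) A) : Prop :=
  ∃ N : Matrix (Fin d) (Fin d) B, S.HasMaterialDeriv u Ψ N ∧
    N + comm Ψ (vorticity G) - doubleDunford γ strainSymbol Ψ (strain G)
      = -((1 / lam : ℂ) •
          (dunford γP P (NormedSpace.exp Ψ) * NormedSpace.exp (-Ψ)).map S.incl)

end LogConformation

end

noncomputable section

namespace LogConformation

section

open Filter Topology

/-! ### Contour integrals along piecewise C¹ closed paths -/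

section Contour

variable {E : Type*} [NormedAddCommGroup E] [NormedSpace ℂ E] {γ : ℝ → ℂ}

/-! Left and right multiplication by `Ψ`, written `L` and `R`, are commuting bounded operators on
matrices over `B`. The plan is to apply the divided difference `dexp L R`, formally `(e^L - e^R) /
(L - R)`, to the whole log-conformation equation; each term then turns into the corresponding term
of the equation for `exp Ψ`.

The commutator is `(L - R) Ω`, so it becomes `(e^L - e^R) Ω`, the commutator with `exp Ψ`
(`dexp_comm`). The double integral is `f(L - R) ε`, and the scalar identity `(e^x - e^y) / (x - y) *
f(x - y) = e^x + e^y` makes it `e^L ε + e^R ε` (`dexp_doubleDunford`). The right-hand side commutes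
with `Ψ`; there `L` and `R` agree and `dexp L R` is multiplication by `exp Ψ`, which cancels `exp
(-Ψ)` (`dexp_map_of_commute`). These combine in `conformation_equation`. Finally `dexp L R` applied
to the material derivative of `Ψ` is that of `exp Ψ` (`HasMaterialDeriv.exp`).

The scalar identity is transferred to operators without a general two-variable functional calculus.
Multiplying the double integral by `L` or `R` multiplies its kernel by `z` or `z'`, because the
remainder in the resolvent identity is the integral of a holomorphic function over a closed path in
a convex strip. This gives polynomials, then the power series `dexp`; the kernel `e^z + e^z'`
separates into single integrals. The only normalization required is `∫ (z - Ψ)⁻¹ dz = 2πi`, obtained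
from the winding numbers by Liouville's theorem (`contourIntegral_resolvent`).

The derivative formula for `exp Ψ` comes from differentiating its power series term by term. The
Banach algebra norm dominates the essential supremum (`norm_funA_le`), so entries of matrices over
`A` are bounded; bounded weakly differentiable functions obey the product rule (`HasWeakDeriv.mul`),
and dominated convergence handles the series. Convergence in `B` is matched with pointwise
convergence in `evalB_dexp`. -/

theorem IsClosedPath.exists_hasDerivAt (hγ : IsClosedPath γ) :
    ∃ s : Finset ℝ, ∀ t ∈ Ioo (0 : ℝ) 1, t ∉ s → HasDerivAt γ (deriv γ t) t := by
  obtain ⟨s, hs⟩ := hγ.piecewise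
  refine ⟨s, fun t ht hts => ?_⟩
  have hopen : IsOpen (Ioo (0 : ℝ) 1 \ (s : Set ℝ)) := isOpen_Ioo.sdiff s.finite_toSet.isClosed
  obtain ⟨ε, hε, hball⟩ := Metric.isOpen_iff.1 hopen t ⟨ht, hts⟩
  have hmem : ∀ x ∈ Icc (t - ε / 2) (t + ε / 2), x ∈ Ioo (0 : ℝ) 1 \ (s : Set ℝ) := by
    intro x hx
    apply hball
    rw [Metric.mem_ball, Real.dist_eq, abs_lt]
    constructor <;> linarith [hx.1, hx.2]
  have h1 := (hmem (t - ε / 2) ⟨le_rfl, by linarith⟩).1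
  have h2 := (hmem (t + ε / 2) ⟨by linarith, le_rfl⟩).1
  have hC := hs (t - ε / 2) (t + ε / 2) h1.1.le (by linarith) h2.2.le
    fun r hr hr' => (hmem r (Ioo_subset_Icc_self hr')).2 hr
  exact ((hC.differentiableOn one_ne_zero).differentiableAt
    (Icc_mem_nhds (by linarith) (by linarith))).hasDerivAt

theorem intervalIntegrable_deriv_of_contDiffOn {p q : ℝ} (hpq : p < q)
    (h : ContDiffOn ℝ 1 γ (Icc p q)) : IntervalIntegrable (deriv γ) volume p q := by
  have hc := (h.continuousOn_derivWithin (uniqueDiffOn_Icc hpq) le_rfl)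
  have hi : IntervalIntegrable (derivWithin γ (Icc p q)) volume p q :=
    ContinuousOn.intervalIntegrable_of_Icc hpq.le hc
  refine hi.congr_ae ?_
  rw [uIoc_of_le hpq.le, ← restrict_Ioo_eq_restrict_Ioc]
  filter_upwards [ae_restrict_mem measurableSet_Ioo] with x hx
  exact derivWithin_of_mem_nhds (Icc_mem_nhds hx.1 hx.2)

theorem IsClosedPath.intervalIntegrable_deriv (hγ : IsClosedPath γ) :
    IntervalIntegrable (deriv γ) volume 0 1 := by
  obtain ⟨s, hs⟩ := hγ.piecewise
  -- Induction on the number of break points inside the interval: cut at one of them, and each half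
  -- contains fewer.
  have key : ∀ n : ℕ, ∀ p q : ℝ, 0 ≤ p → p < q → q ≤ 1 →
      ∀ T : Finset ℝ, (∀ r ∈ s, r ∈ Ioo p q → r ∈ T) → T.card ≤ n →
        IntervalIntegrable (deriv γ) volume p q := by
    intro n
    induction n with
    | zero =>
      intro p q hp hpq hq T hT hc
      refine intervalIntegrable_deriv_of_contDiffOn hpq (hs p q hp hpq hq fun r hr hr' => ?_)
      have := Finset.card_eq_zero.1 (Nat.le_zero.1 hc)
      exact Finset.notMem_empty r (this ▸ hT r hr hr')
    | succ n ih =>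
      intro p q hp hpq hq T hT hc
      by_cases hex : ∃ r ∈ s, r ∈ Ioo p q
      · obtain ⟨r, hr, hr'⟩ := hex
        have hlt : (T.erase r).card ≤ n := by
          rw [Finset.card_erase_of_mem (hT r hr hr')]
          omega
        exact (ih p r hp hr'.1 (hr'.2.le.trans hq) (T.erase r) (fun x hx hx' =>
            Finset.mem_erase.2 ⟨hx'.2.ne, hT x hx ⟨hx'.1, hx'.2.trans hr'.2⟩⟩) hlt).trans
          (ih r q (hp.trans hr'.1.le) hr'.2 hq (T.erase r) (fun x hx hx' =>
            Finset.mem_erase.2 ⟨hx'.1.ne', hT x hx ⟨hr'.1.trans hx'.1, hx'.2⟩⟩) hlt)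
      · push Not at hex
        exact intervalIntegrable_deriv_of_contDiffOn hpq (hs p q hp hpq hq hex)
  exact key _ 0 1 le_rfl one_pos le_rfl s (fun r hr _ => hr) le_rfl

theorem IsClosedPath.intervalIntegrable_smul (hγ : IsClosedPath γ) {F : ℂ → E}
    (hF : ContinuousOn (fun t => F (γ t)) (Icc 0 1)) :
    IntervalIntegrable (fun t => deriv γ t • F (γ t)) volume 0 1 :=
  hγ.intervalIntegrable_deriv.smul_continuousOn (by rwa [uIcc_of_le zero_le_one])

theorem contourIntegral_congr {F G : ℂ → E} (h : ∀ t ∈ Icc (0 : ℝ) 1, F (γ t) = G (γ t)) :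
    contourIntegral γ F = contourIntegral γ G := by
  refine intervalIntegral.integral_congr fun t ht => ?_
  rw [uIcc_of_le zero_le_one] at ht
  simp only [h t ht]

theorem IsClosedPath.contourIntegral_add (hγ : IsClosedPath γ) {F G : ℂ → E}
    (hF : ContinuousOn (fun t => F (γ t)) (Icc 0 1))
    (hG : ContinuousOn (fun t => G (γ t)) (Icc 0 1)) :
    contourIntegral γ (fun z => F z + G z) = contourIntegral γ F + contourIntegral γ G := by
  simp only [contourIntegral, smul_add]
  exact intervalIntegral.integral_add (hγ.intervalIntegrable_smul hF)
    (hγ.intervalIntegrable_smul hG)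

theorem IsClosedPath.contourIntegral_sub (hγ : IsClosedPath γ) {F G : ℂ → E}
    (hF : ContinuousOn (fun t => F (γ t)) (Icc 0 1))
    (hG : ContinuousOn (fun t => G (γ t)) (Icc 0 1)) :
    contourIntegral γ (fun z => F z - G z) = contourIntegral γ F - contourIntegral γ G := by
  simp only [contourIntegral, smul_sub]
  exact intervalIntegral.integral_sub (hγ.intervalIntegrable_smul hF)
    (hγ.intervalIntegrable_smul hG)

theorem contourIntegral_smul (c : ℂ) (F : ℂ → E) :
    contourIntegral γ (fun z => c • F z) = c • contourIntegral γ F := by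
  simp only [contourIntegral, smul_comm _ c]
  exact intervalIntegral.integral_smul c _

theorem IsClosedPath.contourIntegral_clm [CompleteSpace E] {E' : Type*} [NormedAddCommGroup E']
    [NormedSpace ℂ E'] [CompleteSpace E'] (hγ : IsClosedPath γ) (T : E →L[ℂ] E') {F : ℂ → E}
    (hF : ContinuousOn (fun t => F (γ t)) (Icc 0 1)) :
    contourIntegral γ (fun z => T (F z)) = T (contourIntegral γ F) := by
  simp only [contourIntegral, ← map_smul]
  exact T.intervalIntegral_comp_comm (hγ.intervalIntegrable_smul hF)

theorem IsClosedPath.norm_contourIntegral_le (hγ : IsClosedPath γ) {F : ℂ → E} {M : ℝ}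
    (hF : ∀ t ∈ Icc (0 : ℝ) 1, ‖F (γ t)‖ ≤ M) :
    ‖contourIntegral γ F‖ ≤ (∫ t in (0 : ℝ)..1, ‖deriv γ t‖) * M := by
  rw [← intervalIntegral.integral_mul_const]
  refine intervalIntegral.norm_integral_le_of_norm_le zero_le_one ?_
    (hγ.intervalIntegrable_deriv.norm.mul_const M)
  refine Eventually.of_forall fun t ht => ?_
  rw [norm_smul]
  gcongr
  exact hF t (Ioc_subset_Icc_self ht)

theorem IsClosedPath.hasSum_contourIntegral [CompleteSpace E] (hγ : IsClosedPath γ)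
    {F : ℕ → ℂ → E} {G : ℂ → E} {b : ℕ → ℝ}
    (hF : ∀ n, ContinuousOn (fun t => F n (γ t)) (Icc 0 1))
    (hb : ∀ n, ∀ t ∈ Icc (0 : ℝ) 1, ‖F n (γ t)‖ ≤ b n) (hbs : Summable b)
    (hFG : ∀ t ∈ Icc (0 : ℝ) 1, HasSum (fun n => F n (γ t)) (G (γ t))) :
    HasSum (fun n => contourIntegral γ (F n)) (contourIntegral γ G) := by
  have hI : uIoc (0 : ℝ) 1 ⊆ Icc 0 1 := by
    rw [uIoc_of_le zero_le_one]; exact Ioc_subset_Icc_self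
  refine intervalIntegral.hasSum_integral_of_dominated_convergence
    (fun n t => ‖deriv γ t‖ * b n) (fun n => ?_) (fun n => ?_) ?_ ?_ ?_
  · exact ((hγ.intervalIntegrable_smul (hF n)).def').aestronglyMeasurable
  · refine Eventually.of_forall fun t ht => ?_
    rw [norm_smul]
    gcongr
    exact hb n t (hI ht)
  · exact Eventually.of_forall fun t _ => hbs.mul_left _
  · simp only [tsum_mul_left]
    exact hγ.intervalIntegrable_deriv.norm.mul_const _
  · exact Eventually.of_forall fun t ht => (hFG t (hI ht)).const_smul _

/-- The fundamental theorem of calculus tolerates the finitely many corners of the path, and the two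
boundary values of the primitive cancel because the path is closed. -/
theorem IsClosedPath.contourIntegral_eq_zero_of_hasDerivAt [CompleteSpace E]
    (hγ : IsClosedPath γ) {F g : ℂ → E}
    (hF : ContinuousOn (fun t => F (γ t)) (Icc 0 1))
    (hg : ∀ t ∈ Icc (0 : ℝ) 1, HasDerivAt g (F (γ t)) (γ t)) : contourIntegral γ F = 0 := by
  obtain ⟨s, hs⟩ := hγ.exists_hasDerivAt
  have hcont : ContinuousOn (fun t => g (γ t)) (Icc 0 1) := fun t ht =>
    (hg t ht).continuousAt.comp_continuousWithinAt (hγ.continuousOn t ht)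
  have := integral_eq_of_hasDerivAt_off_countable_of_le (fun t => g (γ t))
    (fun t => deriv γ t • F (γ t)) zero_le_one s.countable_toSet hcont
    (fun t ht => ?_) (hγ.intervalIntegrable_smul hF)
  · rw [contourIntegral, this, hγ.closed, sub_self]
  · exact (hg t (Ioo_subset_Icc_self ht.1)).scomp t (hs t ht.1 ht.2)

theorem IsClosedPath.contourIntegral_eq_zero_of_convex [CompleteSpace E]
    (hγ : IsClosedPath γ) {V : Set ℂ} (hV : Convex ℝ V) (hVo : IsOpen V)
    (hmem : ∀ t ∈ Icc (0 : ℝ) 1, γ t ∈ V) {F : ℂ → E} (hF : DifferentiableOn ℂ F V) :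
    contourIntegral γ F = 0 := by
  obtain ⟨g, hg⟩ := hV.exists_forall_hasDerivWithinAt hF
  exact hγ.contourIntegral_eq_zero_of_hasDerivAt
    (hF.continuousOn.comp hγ.continuousOn hmem)
    fun t ht => (hg _ (hmem t ht)).hasDerivAt (hVo.mem_nhds (hmem t ht))

theorem IsClosedPath.contourIntegral_swap [CompleteSpace E] (hγ : IsClosedPath γ)
    {H : ℂ → ℂ → E}
    (hH : ContinuousOn (fun p : ℝ × ℝ => H (γ p.1) (γ p.2)) (Icc 0 1 ×ˢ Icc 0 1)) :
    contourIntegral γ (fun z' => contourIntegral γ fun z => H z z') =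
      contourIntegral γ (fun z => contourIntegral γ fun z' => H z z') := by
  simp only [contourIntegral, intervalIntegral.integral_of_le zero_le_one, ← integral_smul]
  rw [integral_integral_swap]
  · exact integral_congr_ae (.of_forall fun s => integral_congr_ae (.of_forall fun t =>
      smul_comm _ _ _))
  · have hd : Integrable (deriv γ) (volume.restrict (Ioc 0 1)) := by
      have := hγ.intervalIntegrable_deriv
      rwa [intervalIntegrable_iff_integrableOn_Ioc_of_le zero_le_one] at this
    have hd2 := hd.mul_prod hd
    obtain ⟨C, hC⟩ := (isCompact_Icc.prod isCompact_Icc).exists_bound_of_continuousOn hH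
    have hm : AEStronglyMeasurable (fun p : ℝ × ℝ => H (γ p.2) (γ p.1))
        ((volume.restrict (Ioc (0 : ℝ) 1)).prod (volume.restrict (Ioc (0 : ℝ) 1))) := by
      rw [Measure.prod_restrict]
      have h1 : ContinuousOn (fun p : ℝ × ℝ => H (γ p.2) (γ p.1)) (Icc 0 1 ×ˢ Icc 0 1) :=
        hH.comp (f := Prod.swap) continuous_swap.continuousOn
          fun p hp => ⟨hp.2, hp.1⟩
      exact (h1.mono (prod_mono Ioc_subset_Icc_self Ioc_subset_Icc_self)).aestronglyMeasurable
        (measurableSet_Ioc.prod measurableSet_Ioc)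
    have hb : ∀ᵐ p ∂((volume.restrict (Ioc (0 : ℝ) 1)).prod (volume.restrict (Ioc (0 : ℝ) 1))),
        ‖H (γ p.2) (γ p.1)‖ ≤ C := by
      rw [Measure.prod_restrict]
      filter_upwards [ae_restrict_mem (measurableSet_Ioc.prod measurableSet_Ioc)] with p hp
      exact hC (p.2, p.1) ⟨Ioc_subset_Icc_self hp.2, Ioc_subset_Icc_self hp.1⟩
    have := hd2.smul_bdd C hm hb
    refine this.congr (Eventually.of_forall fun p => ?_)
    simp [Function.uncurry, mul_smul]

theorem IsClosedPath.isCompact_image (hγ : IsClosedPath γ) : IsCompact (γ '' Icc 0 1) :=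
  isCompact_Icc.image_of_continuousOn hγ.continuousOn

/-- Differentiation under the integral sign: the compact path stays at a positive distance from a
small ball about `w`, which bounds the differentiated kernel uniformly. -/
theorem IsClosedPath.hasDerivAt_cauchyTransform [CompleteSpace E] (hγ : IsClosedPath γ)
    {G : ℂ → E} (hG : ContinuousOn (fun t => G (γ t)) (Icc 0 1)) {w : ℂ}
    (hw : w ∉ γ '' Icc 0 1) :
    HasDerivAt (fun w => contourIntegral γ fun z => (z - w)⁻¹ • G z)
      (contourIntegral γ fun z => ((z - w) ^ 2)⁻¹ • G z) w := by
  have hI : uIoc (0 : ℝ) 1 ⊆ Icc 0 1 := by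
    rw [uIoc_of_le zero_le_one]; exact Ioc_subset_Icc_self
  obtain ⟨δ, hδ, hball⟩ := Metric.isOpen_iff.1 hγ.isCompact_image.isClosed.isOpen_compl w hw
  have hfar : ∀ x ∈ Metric.ball w (δ / 2), ∀ t ∈ Icc (0 : ℝ) 1, δ / 2 ≤ ‖γ t - x‖ := by
    intro x hx t ht
    by_contra! hlt
    refine hball (a := γ t) ?_ (mem_image_of_mem γ ht)
    rw [Metric.mem_ball] at hx ⊢
    rw [← dist_eq_norm] at hlt
    linarith [dist_triangle (γ t) x w]
  have hne : ∀ x ∈ Metric.ball w (δ / 2), ∀ t ∈ Icc (0 : ℝ) 1, γ t - x ≠ 0 := by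
    intro x hx t ht h0
    have := hfar x hx t ht
    rw [h0, norm_zero] at this
    linarith
  obtain ⟨C, hC⟩ := isCompact_Icc.exists_bound_of_continuousOn hG
  have hcont : ∀ x ∈ Metric.ball w (δ / 2), ContinuousOn (fun t => (γ t - x)⁻¹ • G (γ t))
      (Icc 0 1) := fun x hx =>
    ((hγ.continuousOn.sub continuousOn_const).inv₀ (hne x hx)).smul hG
  have hw' : w ∈ Metric.ball w (δ / 2) := Metric.mem_ball_self (by linarith)
  have hcont2 : ContinuousOn (fun t => ((γ t - w) ^ 2)⁻¹ • G (γ t)) (Icc 0 1) :=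
    (((hγ.continuousOn.sub continuousOn_const).pow 2).inv₀
      (fun t ht => pow_ne_zero 2 (hne w hw' t ht))).smul hG
  have := intervalIntegral.hasDerivAt_integral_of_dominated_loc_of_deriv_le
    (μ := volume) (a := 0) (b := 1)
    (F := fun x t => deriv γ t • (γ t - x)⁻¹ • G (γ t))
    (F' := fun x t => deriv γ t • ((γ t - x) ^ 2)⁻¹ • G (γ t))
    (bound := fun t => ‖deriv γ t‖ * (((δ / 2) ^ 2)⁻¹ * C)) (x₀ := w)
    (Metric.ball_mem_nhds w (half_pos hδ)) ?_ ?_ ?_ ?_ ?_ ?_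
  · exact this.2
  · filter_upwards [Metric.ball_mem_nhds w (half_pos hδ)] with x hx
    exact (hγ.intervalIntegrable_smul (F := fun z => (z - x)⁻¹ • G z)
      (hcont x hx)).def'.aestronglyMeasurable
  · exact hγ.intervalIntegrable_smul (F := fun z => (z - w)⁻¹ • G z) (hcont w hw')
  · exact (hγ.intervalIntegrable_smul (F := fun z => ((z - w) ^ 2)⁻¹ • G z)
      hcont2).def'.aestronglyMeasurable
  · refine Eventually.of_forall fun t ht x hx => ?_
    rw [norm_smul, norm_smul, norm_inv, norm_pow]
    have h1 := hfar x hx t (hI ht)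
    have h2 := hC t (hI ht)
    have hδ2 : 0 < δ / 2 := by linarith
    gcongr
  · exact hγ.intervalIntegrable_deriv.norm.mul_const _
  · refine Eventually.of_forall fun t ht x hx => ?_
    have h0 := hne x hx t (hI ht)
    have h1 : HasDerivAt (fun x => γ t - x) (-1) x := (hasDerivAt_id x).const_sub (γ t)
    have h2 := h1.fun_inv h0
    have h3 : HasDerivAt (fun x => (γ t - x)⁻¹) ((γ t - x) ^ 2)⁻¹ x := by
      rw [neg_neg, one_div] at h2; exact h2
    exact (h3.smul_const (G (γ t))).const_smul (deriv γ t)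

/-- The differentiated kernel `(z - w)⁻²` has the primitive `-(z - w)⁻¹`, so its integral over a
closed path is zero. This yields local constancy, without integrality of winding numbers. -/
theorem IsClosedPath.hasDerivAt_windingNumber (hγ : IsClosedPath γ) {w : ℂ}
    (hw : w ∉ γ '' Icc 0 1) : HasDerivAt (windingNumber γ) 0 w := by
  have h := hγ.hasDerivAt_cauchyTransform (G := fun _ => (1 : ℂ)) continuousOn_const hw
  have hne : ∀ t ∈ Icc (0 : ℝ) 1, γ t - w ≠ 0 := fun t ht h0 =>
    hw ⟨t, ht, sub_eq_zero.1 h0⟩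
  have h0 : contourIntegral γ (fun z => ((z - w) ^ 2)⁻¹ • (1 : ℂ)) = 0 := by
    refine hγ.contourIntegral_eq_zero_of_hasDerivAt (g := fun z => -(z - w)⁻¹) ?_ ?_
    · exact (((hγ.continuousOn.sub continuousOn_const).pow 2).inv₀
        (fun t ht => pow_ne_zero 2 (hne t ht))).smul continuousOn_const
    · intro t ht
      have h1 : HasDerivAt (fun x => x - w) 1 (γ t) := (hasDerivAt_id _).sub_const w
      convert (h1.fun_inv (hne t ht)).fun_neg using 1
      rw [smul_eq_mul, mul_one, neg_div, neg_neg, one_div]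
  rw [h0] at h
  have h2 := h.const_mul (2 * Real.pi * Complex.I)⁻¹
  simp only [smul_eq_mul, mul_one, mul_zero] at h2
  exact h2

theorem IsClosedPath.eventually_windingNumber_eq (hγ : IsClosedPath γ) {w : ℂ}
    (hw : w ∉ γ '' Icc 0 1) : ∀ᶠ w' in 𝓝 w, windingNumber γ w' = windingNumber γ w := by
  obtain ⟨δ, hδ, hball⟩ := Metric.isOpen_iff.1 hγ.isCompact_image.isClosed.isOpen_compl w hw
  filter_upwards [Metric.ball_mem_nhds w hδ] with w' hw'
  refine Metric.isOpen_ball.is_const_of_deriv_eq_zero (convex_ball w δ).isPreconnected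
    (fun x hx => ((hγ.hasDerivAt_windingNumber
      (hball hx)).differentiableAt).differentiableWithinAt)
    (fun x hx => (hγ.hasDerivAt_windingNumber (hball hx)).deriv) hw' (Metric.mem_ball_self hδ)

end Contour

/-! ### The resolvent and its integral around the spectrum -/

section Resolvent

variable {R : Type*} [NormedRing R] [NormedAlgebra ℂ R] {γ : ℝ → ℂ}

theorem mul_resolvent {a : R} {z : ℂ} (hz : z ∉ spectrum ℂ a) :
    a * resolvent a z = z • resolvent a z - 1 := by
  have h : (algebraMap ℂ R z - a) * resolvent a z = 1 :=
    Ring.mul_inverse_cancel _ (not_not.1 hz)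
  rw [sub_mul, ← Algebra.smul_def] at h
  rw [← h]; abel

theorem resolvent_mul {a : R} {z : ℂ} (hz : z ∉ spectrum ℂ a) :
    resolvent a z * a = z • resolvent a z - 1 := by
  have h : resolvent a z * (algebraMap ℂ R z - a) = 1 :=
    Ring.inverse_mul_cancel _ (not_not.1 hz)
  rw [mul_sub, ← Algebra.commutes, ← Algebra.smul_def] at h
  rw [← h]; abel

theorem resolvent_mul_resolvent {a : R} {z w : ℂ} (hz : z ∉ spectrum ℂ a)
    (hw : w ∉ spectrum ℂ a) :
    (z - w) • (resolvent a z * resolvent a w) = resolvent a w - resolvent a z := by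
  have h : resolvent a z * (a * resolvent a w) = resolvent a z * a * resolvent a w :=
    (mul_assoc _ _ _).symm
  rw [mul_resolvent hw, resolvent_mul hz, mul_sub, sub_mul, mul_smul_comm, smul_mul_assoc,
    mul_one, one_mul] at h
  rw [sub_smul, ← sub_eq_zero]
  rw [← sub_eq_zero] at h
  rw [← neg_eq_zero, ← h]; abel

variable [CompleteSpace R]

theorem continuousOn_resolvent (a : R) : ContinuousOn (resolvent a) (spectrum ℂ a)ᶜ :=
  fun z hz => (spectrum.hasDerivAt_resolvent_const_left
    (not_not.1 hz : z ∈ resolventSet ℂ a)).continuousAt.continuousWithinAt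

theorem IsClosedPath.continuousOn_resolvent (hγ : IsClosedPath γ) {a : R}
    (hn : ∀ t ∈ Icc (0 : ℝ) 1, γ t ∉ spectrum ℂ a) :
    ContinuousOn (fun t => resolvent a (γ t)) (Icc 0 1) :=
  (LogConformation.continuousOn_resolvent a).comp hγ.continuousOn hn

/-- A Dixon-type argument. Let `C w` be the Cauchy transform of the resolvent along the path and `J`
its plain integral. Where the winding number is `1`, the resolvent identity gives `C w = (2πi - J) *
resolvent a w` off the spectrum and the path. Hence `C` extends the right-hand side holomorphically
across the spectrum; the result is entire and vanishes at infinity, so it is zero, and cancelling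
the invertible resolvent gives `J = 2πi`. -/
theorem IsClosedPath.contourIntegral_resolvent (hγ : IsClosedPath γ) {a : R}
    (hn : ∀ t ∈ Icc (0 : ℝ) 1, γ t ∉ spectrum ℂ a)
    (hone : ∀ w ∈ spectrum ℂ a, windingNumber γ w = 1) :
    contourIntegral γ (resolvent a) = (2 * Real.pi * Complex.I : ℂ) • (1 : R) := by
  classical
  set c : ℂ := 2 * Real.pi * Complex.I with hc
  have hc0 : c ≠ 0 := Complex.two_pi_I_ne_zero
  set J : R := contourIntegral γ (resolvent a) with hJ
  have hR := hγ.continuousOn_resolvent hn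
  set C : ℂ → R := fun w => contourIntegral γ fun z => (z - w)⁻¹ • resolvent a z with hC
  have key : ∀ w ∉ γ '' Icc 0 1, w ∉ spectrum ℂ a → windingNumber γ w = 1 →
      C w = (c • 1 - J) * resolvent a w := by
    intro w hw hws hw1
    have hne : ∀ t ∈ Icc (0 : ℝ) 1, γ t - w ≠ 0 := fun t ht h0 =>
      hw ⟨t, ht, sub_eq_zero.1 h0⟩
    have hinv : ContinuousOn (fun t => (γ t - w)⁻¹) (Icc 0 1) :=
      (hγ.continuousOn.sub continuousOn_const).inv₀ hne
    have h1 : C w = contourIntegral γ (fun z => (z - w)⁻¹ • resolvent a w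
        - resolvent a z * resolvent a w) := by
      refine contourIntegral_congr fun t ht => ?_
      have h := resolvent_mul_resolvent (hn t ht) hws
      have h' : resolvent a (γ t) = resolvent a w - ((γ t) - w) • (resolvent a (γ t) * resolvent a w) := by
        rw [h]; abel
      calc ((γ t) - w)⁻¹ • resolvent a (γ t)
          = ((γ t) - w)⁻¹ • (resolvent a w - ((γ t) - w) • (resolvent a (γ t) * resolvent a w)) := by
            rw [← h']
        _ = _ := by rw [smul_sub, smul_smul, inv_mul_cancel₀ (hne t ht), one_smul]
    have hwi : contourIntegral γ (fun z => (z - w)⁻¹) = c := by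
      rw [windingNumber, inv_mul_eq_iff_eq_mul₀ hc0, mul_one] at hw1
      exact hw1
    have h2 : contourIntegral γ (fun z => (z - w)⁻¹ • resolvent a w) = c • resolvent a w := by
      have := hγ.contourIntegral_clm
        ((ContinuousLinearMap.id ℂ ℂ).smulRight (resolvent a w)) (F := fun z => (z - w)⁻¹) hinv
      simpa [hwi] using this
    have h3 : contourIntegral γ (fun z => resolvent a z * resolvent a w) =
        J * resolvent a w :=
      hγ.contourIntegral_clm ((ContinuousLinearMap.mul ℂ R).flip (resolvent a w)) hR
    rw [h1, hγ.contourIntegral_sub (hinv.smul continuousOn_const) (hR.mul continuousOn_const),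
      h2, h3, sub_mul, smul_mul_assoc, one_mul]
  -- The glued entire function: the two formulas agree near the spectrum because the winding number
  -- is locally constant.
  set h : ℂ → R := fun w =>
    if w ∈ spectrum ℂ a then C w else (c • 1 - J) * resolvent a w with hh
  have hopen : IsOpen (spectrum ℂ a)ᶜ := (spectrum.isClosed a).isOpen_compl
  have hdiff : Differentiable ℂ h := by
    intro w
    by_cases hw : w ∈ spectrum ℂ a
    · have hwγ : w ∉ γ '' Icc 0 1 := by
        rintro ⟨t, ht, rfl⟩
        exact hn t ht hw
      refine (hγ.hasDerivAt_cauchyTransform hR hwγ).differentiableAt.congr_of_eventuallyEq ?_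
      filter_upwards [hγ.eventually_windingNumber_eq hwγ,
        hγ.isCompact_image.isClosed.isOpen_compl.mem_nhds hwγ] with w' h1 h2
      simp only [hh]
      split_ifs with h3
      · rfl
      · exact (key w' h2 h3 (h1.trans (hone w hw))).symm
    · have hd : DifferentiableAt ℂ (fun w => (c • 1 - J) * resolvent a w) w :=
        ((spectrum.hasDerivAt_resolvent_const_left
          (not_not.1 hw : w ∈ resolventSet ℂ a)).differentiableAt).const_mul _
      refine hd.congr_of_eventuallyEq ?_
      filter_upwards [hopen.mem_nhds hw] with w' hw'
      simp only [hh, if_neg hw']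
  have hout : ∀ᶠ w in Bornology.cobounded ℂ, w ∉ spectrum ℂ a :=
    (spectrum.isCompact a).isBounded
  have hlim : Tendsto h (cocompact ℂ) (𝓝 0) := by
    rw [← Metric.cobounded_eq_cocompact]
    have h1 := (spectrum.resolvent_tendsto_cobounded (𝕜 := ℂ) a).const_mul (c • 1 - J)
    rw [mul_zero] at h1
    refine h1.congr' ?_
    filter_upwards [hout] with w hw
    simp only [hh, if_neg hw]
  have hzero : ∀ w, h w = 0 := fun w => hdiff.apply_eq_of_tendsto_cocompact w hlim
  obtain ⟨w, hw⟩ := hout.exists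
  have h1 := hzero w
  simp only [hh, if_neg hw] at h1
  have h2 : (c • 1 - J) * resolvent a w * (algebraMap ℂ R w - a) = 0 := by rw [h1, zero_mul]
  rw [mul_assoc, resolvent, Ring.inverse_mul_cancel _ (not_not.1 hw),
    mul_one, sub_eq_zero] at h2
  exact h2.symm

end Resolvent

end

section

open Filter Topology
open scoped Nat

/-! ### The scalar symbol `x / tanh (x / 2)` on the strip -/

section StrainSymbol

theorem strainSymbol_of_ne_zero {x : ℂ} (hx : x ≠ 0) :
    strainSymbol x = x * Complex.cosh (x / 2) / Complex.sinh (x / 2) := by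
  rw [strainSymbol, if_neg hx, Complex.tanh_eq_sinh_div_cosh, div_div_eq_mul_div]

/-- The zeros of `sinh (x / 2)` are the multiples of `2πi`. This is where the half-width `π` of the
strip enters: differences of its points meet no zero except `0`. -/
theorem sinh_half_ne_zero {x : ℂ} (hx : x ≠ 0) (hx' : |x.im| < 2 * Real.pi) :
    Complex.sinh (x / 2) ≠ 0 := by
  intro h
  have h1 : Complex.sin (x / 2 * Complex.I) = 0 := by
    rw [Complex.sin_mul_I, h, zero_mul]
  obtain ⟨k, hk⟩ := Complex.sin_eq_zero_iff.1 h1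
  have hx2 : x = -(2 * k * Real.pi * Complex.I) := by
    have h3 := congrArg (fun y => -(2 * y * Complex.I)) hk
    calc x = -(2 * (x / 2 * Complex.I) * Complex.I) := by
          ring_nf; rw [Complex.I_sq]; ring
      _ = _ := by rw [h3]; ring
  have him : x.im = -(2 * k * Real.pi) := by
    rw [hx2]
    simp
  rw [him, abs_neg, abs_mul, abs_mul, abs_of_pos Real.pi_pos, abs_two] at hx'
  have hk1 : |(k : ℝ)| < 1 := by
    by_contra! hge
    nlinarith [Real.pi_pos]
  have hk0 : k = 0 := by
    rw [← Int.cast_abs] at hk1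
    exact Int.abs_lt_one_iff.1 (by exact_mod_cast hk1)
  apply hx
  rw [hx2, hk0]
  simp

/-- The singularity at `0` is removed by replacing `sinh (x / 2) / x` with the slope function
`dslope`, which is entire and equals `1 / 2` at `0`. -/
theorem differentiableOn_strainSymbol :
    DifferentiableOn ℂ strainSymbol {x : ℂ | |x.im| < 2 * Real.pi} := by
  have hd : Differentiable ℂ (fun x : ℂ => Complex.sinh (x / 2)) :=
    Complex.differentiable_sinh.comp (differentiable_id.div_const 2)
  have hs : Differentiable ℂ (dslope (fun x : ℂ => Complex.sinh (x / 2)) 0) := by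
    rw [← differentiableOn_univ] at hd ⊢
    exact (Complex.differentiableOn_dslope univ_mem).2 hd
  have h0 : dslope (fun x : ℂ => Complex.sinh (x / 2)) 0 0 = 1 / 2 := by
    rw [dslope_same]
    have h1 : HasDerivAt (fun x : ℂ => Complex.sinh (x / 2)) (Complex.cosh (0 / 2) * (1 / 2)) 0 :=
      (Complex.hasDerivAt_sinh _).comp 0 ((hasDerivAt_id (0 : ℂ)).div_const 2)
    rw [h1.deriv]
    simp
  have hne : ∀ x : ℂ, x ≠ 0 → dslope (fun x : ℂ => Complex.sinh (x / 2)) 0 x =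
      Complex.sinh (x / 2) / x := by
    intro x hx
    rw [dslope_of_ne _ hx, slope_def_field]
    simp
  have heq : ∀ x : ℂ, strainSymbol x =
      Complex.cosh (x / 2) / dslope (fun x : ℂ => Complex.sinh (x / 2)) 0 x := by
    intro x
    by_cases hx : x = 0
    · rw [hx, h0, strainSymbol, if_pos rfl]
      simp
    · rw [strainSymbol_of_ne_zero hx, hne x hx, div_div_eq_mul_div, mul_comm]
  intro x hx
  have hc : Differentiable ℂ (fun x : ℂ => Complex.cosh (x / 2)) :=
    Complex.differentiable_cosh.comp (differentiable_id.div_const 2)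
  rw [show strainSymbol = fun x => Complex.cosh (x / 2) /
    dslope (fun x : ℂ => Complex.sinh (x / 2)) 0 x from funext heq]
  refine ((hc x).div (hs x) ?_).differentiableWithinAt
  by_cases hx0 : x = 0
  · rw [hx0, h0]; norm_num
  · rw [hne x hx0]
    exact div_ne_zero (sinh_half_ne_zero hx0 hx) hx0

/-- Factoring out `e^((x+y)/2)` turns `e^x - e^y` and `e^x + e^y` into `2 sinh` and `2 cosh` of `(x
- y) / 2`; the symbol is `x - y` times the quotient of cosh by sinh. The number `k` stands for the
divided difference of exp. -/
theorem mul_strainSymbol {x y : ℂ} (h : |(x - y).im| < 2 * Real.pi) {k : ℂ}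
    (hk : (x - y) * k = Complex.exp x - Complex.exp y) (hxy : x = y → k = Complex.exp x) :
    k * strainSymbol (x - y) = Complex.exp x + Complex.exp y := by
  by_cases hx : x - y = 0
  · have hx' := sub_eq_zero.1 hx
    rw [hx, strainSymbol, if_pos rfl, hxy hx', ← hx']
    ring
  · have hs := sinh_half_ne_zero hx h
    rw [strainSymbol_of_ne_zero hx, mul_div_assoc', div_eq_iff hs, ← mul_assoc, mul_comm k, hk]
    have e1 : Complex.exp x = Complex.exp ((x + y) / 2) * Complex.exp ((x - y) / 2) := by
      rw [← Complex.exp_add]; congr 1; ring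
    have e2 : Complex.exp y = Complex.exp ((x + y) / 2) * Complex.exp (-((x - y) / 2)) := by
      rw [← Complex.exp_add]; congr 1; ring
    rw [e1, e2, Complex.cosh, Complex.sinh]
    ring

theorem convex_strip : Convex ℝ strip := by
  have : strip = Complex.imLm ⁻¹' Ioo (-Real.pi) Real.pi := by
    ext z; simp [strip, abs_lt]
  rw [this]
  exact (convex_Ioo _ _).linear_preimage _

theorem isOpen_strip : IsOpen strip :=
  isOpen_lt (Complex.continuous_im.abs) continuous_const

theorem abs_im_sub_lt {z w : ℂ} (hz : z ∈ strip) (hw : w ∈ strip) :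
    |(z - w).im| < 2 * Real.pi := by
  rw [strip, mem_ofPred_eq, abs_lt] at hz hw
  rw [Complex.sub_im, abs_lt]
  constructor <;> linarith [hz.1, hz.2, hw.1, hw.2]

end StrainSymbol

/-! ### The divided difference of the exponential as a power series -/

section Dexp

variable {R : Type*} [NormedRing R]

/-- The factor `max 1 ‖1‖` accounts for the zeroth power: the unit is not assumed to have norm one.
-/
theorem norm_pow_le_max {a : R} {α : ℝ} (ha : ‖a‖ ≤ α) (n : ℕ) :
    ‖a ^ n‖ ≤ max 1 ‖(1 : R)‖ * α ^ n := by
  have hα : 0 ≤ α := (norm_nonneg a).trans ha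
  rcases Nat.eq_zero_or_pos n with rfl | hn
  · simp
  · calc ‖a ^ n‖ ≤ ‖a‖ ^ n := norm_pow_le' a hn
      _ ≤ 1 * α ^ n := by rw [one_mul]; gcongr
      _ ≤ _ := by gcongr; exact le_max_left _ _

variable [NormedAlgebra ℂ R]

/-- The `n`-th term `(n!)⁻¹ ∑ lⁱ rⁿ⁻¹⁻ⁱ` of the power series of `(eˡ - eʳ) / (l - r)`. -/
def dexpTerm (l r : R) (n : ℕ) : R :=
  (n ! : ℂ)⁻¹ • ∑ i ∈ Finset.range n, l ^ i * r ^ (n - 1 - i)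

/-- The divided difference `(eˡ - eʳ) / (l - r)` of the exponential function. -/
def dexp (l r : R) : R := ∑' n, dexpTerm l r n

theorem summable_dexp_bound (α : ℝ) : Summable fun n : ℕ => (n ! : ℝ)⁻¹ * (n * α ^ (n - 1)) := by
  -- The term at `0` vanishes through the factor `n`; after the shift, `(n + 1) / (n + 1)!`
  -- collapses to `1 / n!`.
  rw [← summable_nat_add_iff 1]
  refine (Real.summable_pow_div_factorial α).congr fun n => ?_
  have h1 : ((n ! : ℕ) : ℝ) ≠ 0 := by positivity
  have h2 : (n : ℝ) + 1 ≠ 0 := by positivity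
  rw [Nat.factorial_succ, Nat.add_sub_cancel]
  push_cast
  field_simp

theorem norm_dexpTerm_le {l r : R} {α : ℝ} (hl : ‖l‖ ≤ α) (hr : ‖r‖ ≤ α) (n : ℕ) :
    ‖dexpTerm l r n‖ ≤ max 1 ‖(1 : R)‖ ^ 2 * ((n ! : ℝ)⁻¹ * (n * α ^ (n - 1))) := by
  have hα : 0 ≤ α := (norm_nonneg l).trans hl
  rw [dexpTerm, norm_smul, norm_inv, Complex.norm_natCast]
  have h1 : ‖∑ i ∈ Finset.range n, l ^ i * r ^ (n - 1 - i)‖ ≤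
      ∑ i ∈ Finset.range n, max 1 ‖(1 : R)‖ ^ 2 * α ^ (n - 1) := by
    refine norm_sum_le_of_le _ fun i hi => ?_
    have hi' := Finset.mem_range.1 hi
    calc ‖l ^ i * r ^ (n - 1 - i)‖ ≤ ‖l ^ i‖ * ‖r ^ (n - 1 - i)‖ := norm_mul_le _ _
      _ ≤ (max 1 ‖(1 : R)‖ * α ^ i) * (max 1 ‖(1 : R)‖ * α ^ (n - 1 - i)) := by
        gcongr
        · exact norm_pow_le_max hl i
        · exact norm_pow_le_max hr _
      _ = max 1 ‖(1 : R)‖ ^ 2 * α ^ (i + (n - 1 - i)) := by rw [pow_add]; ring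
      _ = _ := by rw [show i + (n - 1 - i) = n - 1 by omega]
  rw [Finset.sum_const, Finset.card_range, nsmul_eq_mul] at h1
  calc _ ≤ (n ! : ℝ)⁻¹ * (n * (max 1 ‖(1 : R)‖ ^ 2 * α ^ (n - 1))) := by gcongr
    _ = _ := by ring

variable [CompleteSpace R]

theorem summable_dexpTerm (l r : R) : Summable (dexpTerm l r) :=
  Summable.of_norm_bounded ((summable_dexp_bound (max ‖l‖ ‖r‖)).mul_left _)
    fun n => norm_dexpTerm_le (le_max_left _ _) (le_max_right _ _) n

theorem hasSum_dexp (l r : R) : HasSum (dexpTerm l r) (dexp l r) :=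
  (summable_dexpTerm l r).hasSum

theorem hasSum_exp (a : R) : HasSum (fun n : ℕ => (n ! : ℂ)⁻¹ • a ^ n) (NormedSpace.exp a) :=
  NormedSpace.exp_series_hasSum_exp' (𝕂 := ℂ) a

/-- Termwise, this is the telescoping factorization of `l ^ n - r ^ n`, which needs only that `l`
and `r` commute. -/
theorem sub_mul_dexp {l r : R} (h : Commute l r) :
    (l - r) * dexp l r = NormedSpace.exp l - NormedSpace.exp r := by
  refine ((hasSum_dexp l r).mul_left (l - r)).unique ?_
  refine ((hasSum_exp l).sub (hasSum_exp r)).congr_fun fun n => ?_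
  rw [dexpTerm, mul_smul_comm, h.mul_geom_sum₂, smul_sub]

theorem hasSum_dexpTerm_self (a : R) : HasSum (dexpTerm a a) (NormedSpace.exp a) := by
  have h : ∀ n, dexpTerm a a (n + 1) = (n ! : ℂ)⁻¹ • a ^ n := by
    intro n
    have h1 : ∀ i ∈ Finset.range (n + 1), a ^ i * a ^ (n + 1 - 1 - i) = a ^ n := fun i hi => by
      rw [← pow_add, Nat.add_sub_cancel, Nat.add_sub_cancel' (Nat.lt_succ_iff.1
        (Finset.mem_range.1 hi))]
    rw [dexpTerm, Finset.sum_congr rfl h1, Finset.sum_const, Finset.card_range,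
      ← Nat.cast_smul_eq_nsmul ℂ, smul_smul, Nat.factorial_succ]
    congr 1
    have h2 : ((n ! : ℕ) : ℂ) ≠ 0 := by exact_mod_cast n.factorial_ne_zero
    have h3 : ((n + 1 : ℕ) : ℂ) ≠ 0 := by exact_mod_cast n.succ_ne_zero
    push_cast at h3 ⊢
    field_simp
  rw [← hasSum_nat_add_iff' 1]
  simp only [h]
  simpa [dexpTerm] using hasSum_exp a

theorem dexp_self (a : R) : dexp a a = NormedSpace.exp a :=
  (hasSum_dexp a a).unique (hasSum_dexpTerm_self a)

theorem dexp_mul_strainSymbol {x y : ℂ} (hx : x ∈ strip) (hy : y ∈ strip) :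
    dexp x y * strainSymbol (x - y) = Complex.exp x + Complex.exp y := by
  refine mul_strainSymbol (abs_im_sub_lt hx hy) ?_ ?_
  · rw [sub_mul_dexp (Commute.all x y), Complex.exp_eq_exp_ℂ]
  · rintro rfl
    rw [dexp_self, Complex.exp_eq_exp_ℂ]

end Dexp

/-! ### Double contour integrals as a two-variable functional calculus -/

section DoubleIntegral

variable {R : Type*} [NormedRing R] [NormedAlgebra ℂ R] {γ : ℝ → ℂ}

theorem IsClosedPath.continuousOn_contourIntegral {E : Type*} [NormedAddCommGroup E]
    [NormedSpace ℂ E] (hγ : IsClosedPath γ) {H : ℂ → ℂ → E}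
    (hH : ContinuousOn (fun p : ℝ × ℝ => H (γ p.1) (γ p.2)) (Icc 0 1 ×ˢ Icc 0 1)) :
    ContinuousOn (fun t => contourIntegral γ fun z => H z (γ t)) (Icc 0 1) := by
  obtain ⟨C, hC⟩ := (isCompact_Icc.prod isCompact_Icc).exists_bound_of_continuousOn hH
  simp only [contourIntegral, intervalIntegral.integral_of_le zero_le_one]
  have hint := hγ.intervalIntegrable_deriv
  rw [intervalIntegrable_iff_integrableOn_Ioc_of_le zero_le_one] at hint
  refine continuousOn_of_dominated (bound := fun s => ‖deriv γ s‖ * C) ?_ ?_ ?_ ?_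
  · intro t ht
    have := hγ.intervalIntegrable_smul (F := fun z => H z (γ t))
      (hH.comp (f := fun s => (s, t)) (by fun_prop) fun s hs => ⟨hs, ht⟩)
    rw [intervalIntegrable_iff_integrableOn_Ioc_of_le zero_le_one] at this
    exact this.aestronglyMeasurable
  · intro t ht
    filter_upwards [ae_restrict_mem measurableSet_Ioc] with s hs
    rw [norm_smul]
    gcongr
    exact hC (s, t) ⟨Ioc_subset_Icc_self hs, ht⟩
  · exact hint.norm.mul_const C
  · filter_upwards [ae_restrict_mem measurableSet_Ioc] with s hs
    exact continuousOn_const.smul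
      (hH.comp (f := fun t => (s, t)) (by fun_prop) fun t ht => ⟨Ioc_subset_Icc_self hs, ht⟩)

theorem continuousOn_prod_mul {R : Type*} [NormedRing R] {γ : ℝ → ℂ} {L M : ℂ → R}
    (hL : ContinuousOn (fun t => L (γ t)) (Icc 0 1))
    (hM : ContinuousOn (fun t => M (γ t)) (Icc 0 1)) :
    ContinuousOn (fun p : ℝ × ℝ => L (γ p.1) * M (γ p.2)) (Icc 0 1 ×ˢ Icc 0 1) :=
  (hL.comp (f := fun p : ℝ × ℝ => p.1) continuous_fst.continuousOn fun _ hp => hp.1).mul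
    (hM.comp (f := fun p : ℝ × ℝ => p.2) continuous_snd.continuousOn fun _ hp => hp.2)

/-- The double contour integral `∫_γ ∫_γ F(z, z') L(z) M(z') dz dz'`. -/
def doubleIntegral (γ : ℝ → ℂ) (L M : ℂ → R) (F : ℂ → ℂ → ℂ) : R :=
  contourIntegral γ fun z' => contourIntegral γ fun z => F z z' • (L z * M z')

variable {L M : ℂ → R} {F G : ℂ → ℂ → ℂ}

theorem doubleIntegral_congr
    (h : ∀ s ∈ Icc (0 : ℝ) 1, ∀ t ∈ Icc (0 : ℝ) 1, F (γ s) (γ t) = G (γ s) (γ t)) :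
    doubleIntegral γ L M F = doubleIntegral γ L M G :=
  contourIntegral_congr fun t ht => contourIntegral_congr fun s hs => by
    simp only [h s hs t ht]

theorem doubleIntegral_smul (c : ℂ) :
    doubleIntegral γ L M (fun z z' => c * F z z') = c • doubleIntegral γ L M F := by
  simp only [doubleIntegral, mul_smul, contourIntegral_smul]

/-- A kernel that is continuous along the path and separately holomorphic on the strip. -/
structure IsKernel (γ : ℝ → ℂ) (F : ℂ → ℂ → ℂ) : Prop where
  continuousOn : ContinuousOn (fun p : ℝ × ℝ => F (γ p.1) (γ p.2)) (Icc 0 1 ×ˢ Icc 0 1)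
  left : ∀ t ∈ Icc (0 : ℝ) 1, DifferentiableOn ℂ (fun z => F z (γ t)) strip
  right : ∀ s ∈ Icc (0 : ℝ) 1, DifferentiableOn ℂ (fun z' => F (γ s) z') strip

theorem IsClosedPath.continuousOn_fst (hγ : IsClosedPath γ) :
    ContinuousOn (fun p : ℝ × ℝ => γ p.1) (Icc 0 1 ×ˢ Icc 0 1) :=
  hγ.continuousOn.comp continuous_fst.continuousOn fun _ hp => hp.1

theorem IsClosedPath.continuousOn_snd (hγ : IsClosedPath γ) :
    ContinuousOn (fun p : ℝ × ℝ => γ p.2) (Icc 0 1 ×ˢ Icc 0 1) :=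
  hγ.continuousOn.comp continuous_snd.continuousOn fun _ hp => hp.2

theorem IsKernel.fst_mul (hF : IsKernel γ F) (hγ : IsClosedPath γ) :
    IsKernel γ (fun z z' => z * F z z') :=
  ⟨hγ.continuousOn_fst.mul hF.continuousOn, fun t ht => differentiableOn_id.mul (hF.left t ht),
    fun s hs => (hF.right s hs).const_mul _⟩

theorem IsKernel.snd_mul (hF : IsKernel γ F) (hγ : IsClosedPath γ) :
    IsKernel γ (fun z z' => z' * F z z') :=
  ⟨hγ.continuousOn_snd.mul hF.continuousOn, fun t ht => (hF.left t ht).const_mul _,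
    fun s hs => differentiableOn_id.mul (hF.right s hs)⟩

theorem isKernel_strainSymbol (hγ : IsClosedPath γ) (hs : ∀ t ∈ Icc (0 : ℝ) 1, γ t ∈ strip) :
    IsKernel γ (fun z z' => strainSymbol (z - z')) := by
  refine ⟨?_, fun t ht => ?_, fun s hs' => ?_⟩
  · exact differentiableOn_strainSymbol.continuousOn.comp
      (hγ.continuousOn_fst.sub hγ.continuousOn_snd)
      fun p hp => abs_im_sub_lt (hs _ hp.1) (hs _ hp.2)
  · exact differentiableOn_strainSymbol.comp (differentiableOn_id.sub_const _)
      fun z hz => abs_im_sub_lt hz (hs t ht)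
  · exact differentiableOn_strainSymbol.comp (differentiableOn_id.const_sub _)
      fun z hz => abs_im_sub_lt (hs s hs') hz

theorem continuousOn_section {F : ℂ → ℂ → ℂ}
    (hF : ContinuousOn (fun p : ℝ × ℝ => F (γ p.1) (γ p.2)) (Icc 0 1 ×ˢ Icc 0 1)) {t : ℝ}
    (ht : t ∈ Icc (0 : ℝ) 1) : ContinuousOn (fun s => F (γ s) (γ t)) (Icc 0 1) :=
  hF.comp (f := fun s => (s, t)) (by fun_prop) fun _ hs => ⟨hs, ht⟩

theorem doubleIntegral_add (hγ : IsClosedPath γ)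
    (hL : ContinuousOn (fun t => L (γ t)) (Icc 0 1))
    (hM : ContinuousOn (fun t => M (γ t)) (Icc 0 1))
    (hF : ContinuousOn (fun p : ℝ × ℝ => F (γ p.1) (γ p.2)) (Icc 0 1 ×ˢ Icc 0 1))
    (hG : ContinuousOn (fun p : ℝ × ℝ => G (γ p.1) (γ p.2)) (Icc 0 1 ×ˢ Icc 0 1)) :
    doubleIntegral γ L M (fun z z' => F z z' + G z z') =
      doubleIntegral γ L M F + doubleIntegral γ L M G := by
  have hLM := continuousOn_prod_mul hL hM
  rw [doubleIntegral, doubleIntegral, doubleIntegral, ← hγ.contourIntegral_add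
    (hγ.continuousOn_contourIntegral (H := fun z z' => F z z' • (L z * M z')) (hF.smul hLM))
    (hγ.continuousOn_contourIntegral (H := fun z z' => G z z' • (L z * M z')) (hG.smul hLM))]
  refine contourIntegral_congr fun t ht => ?_
  simp only [add_smul]
  have hc : ContinuousOn (fun s => L (γ s) * M (γ t)) (Icc 0 1) := hL.mul continuousOn_const
  exact hγ.contourIntegral_add ((continuousOn_section hF ht).smul hc)
    ((continuousOn_section hG ht).smul hc)

theorem doubleIntegral_sum {ι : Type*} (hγ : IsClosedPath γ)
    (hL : ContinuousOn (fun t => L (γ t)) (Icc 0 1))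
    (hM : ContinuousOn (fun t => M (γ t)) (Icc 0 1)) (s : Finset ι) {F : ι → ℂ → ℂ → ℂ}
    (hF : ∀ i, ContinuousOn (fun p : ℝ × ℝ => F i (γ p.1) (γ p.2)) (Icc 0 1 ×ˢ Icc 0 1)) :
    doubleIntegral γ L M (fun z z' => ∑ i ∈ s, F i z z') =
      ∑ i ∈ s, doubleIntegral γ L M (F i) := by
  classical
  induction s using Finset.induction_on with
  | empty => simp [doubleIntegral, contourIntegral]
  | insert a s ha ih =>
    simp only [Finset.sum_insert ha]
    rw [doubleIntegral_add hγ hL hM (hF a) (continuousOn_finsetSum _ fun i _ => hF i), ih]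

variable [CompleteSpace R]

theorem hasSum_doubleIntegral (hγ : IsClosedPath γ)
    (hL : ContinuousOn (fun t => L (γ t)) (Icc 0 1))
    (hM : ContinuousOn (fun t => M (γ t)) (Icc 0 1)) {F : ℕ → ℂ → ℂ → ℂ} {b : ℕ → ℝ}
    (hF : ∀ n, ContinuousOn (fun p : ℝ × ℝ => F n (γ p.1) (γ p.2)) (Icc 0 1 ×ˢ Icc 0 1))
    (hb : ∀ n, ∀ s ∈ Icc (0 : ℝ) 1, ∀ t ∈ Icc (0 : ℝ) 1, ‖F n (γ s) (γ t)‖ ≤ b n)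
    (hbs : Summable b)
    (hFG : ∀ s ∈ Icc (0 : ℝ) 1, ∀ t ∈ Icc (0 : ℝ) 1,
      HasSum (fun n => F n (γ s) (γ t)) (G (γ s) (γ t))) :
    HasSum (fun n => doubleIntegral γ L M (F n)) (doubleIntegral γ L M G) := by
  have hLM := continuousOn_prod_mul hL hM
  obtain ⟨C, hC⟩ := (isCompact_Icc.prod isCompact_Icc).exists_bound_of_continuousOn hLM
  have hbound : ∀ n, ∀ s ∈ Icc (0 : ℝ) 1, ∀ t ∈ Icc (0 : ℝ) 1,
      ‖F n (γ s) (γ t) • (L (γ s) * M (γ t))‖ ≤ b n * C := by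
    intro n s hs t ht
    rw [norm_smul]
    exact mul_le_mul (hb n s hs t ht) (hC (s, t) ⟨hs, ht⟩) (norm_nonneg _)
      ((norm_nonneg _).trans (hb n s hs t ht))
  refine hγ.hasSum_contourIntegral
    (b := fun n => (∫ t in (0 : ℝ)..1, ‖deriv γ t‖) * (b n * C)) (fun n => ?_) (fun n t ht => ?_)
    ((hbs.mul_right C).mul_left _) fun t ht => ?_
  · exact hγ.continuousOn_contourIntegral (H := fun z z' => F n z z' • (L z * M z'))
      ((hF n).smul hLM)
  · exact hγ.norm_contourIntegral_le fun s hs => hbound n s hs t ht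
  · refine hγ.hasSum_contourIntegral (b := fun n => b n * C) (fun n => ?_)
      (fun n s hs => hbound n s hs t ht) (hbs.mul_right C)
      fun s hs => (hFG s hs t ht).smul_const _
    exact (continuousOn_section (hF n) ht).smul (hL.mul continuousOn_const)

theorem clm_doubleIntegral (hγ : IsClosedPath γ)
    (hL : ContinuousOn (fun t => L (γ t)) (Icc 0 1))
    (hM : ContinuousOn (fun t => M (γ t)) (Icc 0 1))
    (hF : ContinuousOn (fun p : ℝ × ℝ => F (γ p.1) (γ p.2)) (Icc 0 1 ×ˢ Icc 0 1))
    {E : Type*} [NormedAddCommGroup E] [NormedSpace ℂ E] [CompleteSpace E] (T : R →L[ℂ] E) :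
    T (doubleIntegral γ L M F) =
      contourIntegral γ fun z' => contourIntegral γ fun z => F z z' • T (L z * M z') := by
  have hLM := continuousOn_prod_mul hL hM
  rw [doubleIntegral, ← hγ.contourIntegral_clm T
    (hγ.continuousOn_contourIntegral (H := fun z z' => F z z' • (L z * M z')) (hF.smul hLM))]
  refine contourIntegral_congr fun t ht => ?_
  rw [← hγ.contourIntegral_clm T
    ((continuousOn_section hF ht).smul (hL.mul continuousOn_const))]
  simp only [map_smul]

theorem IsClosedPath.contourIntegral_smul_const {E : Type*} [NormedAddCommGroup E]
    [NormedSpace ℂ E] [CompleteSpace E] (hγ : IsClosedPath γ) {g : ℂ → ℂ}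
    (hg : ContinuousOn (fun t => g (γ t)) (Icc 0 1)) (x : E) :
    contourIntegral γ (fun z => g z • x) = contourIntegral γ g • x :=
  hγ.contourIntegral_clm ((ContinuousLinearMap.id ℂ ℂ).smulRight x) hg

/-- Replacing `l * L z` by `z • L z - 1` produces the desired kernel and a remainder in which `z`
occurs only in `F`. That remainder vanishes by Cauchy's theorem on the convex strip. -/
theorem mul_doubleIntegral_left (hγ : IsClosedPath γ)
    (hs : ∀ t ∈ Icc (0 : ℝ) 1, γ t ∈ strip)
    (hL : ContinuousOn (fun t => L (γ t)) (Icc 0 1))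
    (hM : ContinuousOn (fun t => M (γ t)) (Icc 0 1)) (hF : IsKernel γ F) {l : R}
    (hl : ∀ t ∈ Icc (0 : ℝ) 1, l * L (γ t) = γ t • L (γ t) - 1) :
    l * doubleIntegral γ L M F = doubleIntegral γ L M (fun z z' => z * F z z') := by
  have h := clm_doubleIntegral hγ hL hM hF.continuousOn (ContinuousLinearMap.mul ℂ R l)
  simp only [ContinuousLinearMap.mul_apply'] at h
  rw [h]
  refine contourIntegral_congr fun t ht => ?_
  have hc := continuousOn_section hF.continuousOn ht
  have hz : contourIntegral γ (fun z => F z (γ t) • M (γ t)) = 0 := by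
    rw [hγ.contourIntegral_smul_const hc,
      hγ.contourIntegral_eq_zero_of_convex convex_strip isOpen_strip hs (hF.left t ht), zero_smul]
  calc contourIntegral γ (fun z => F z (γ t) • (l * (L z * M (γ t))))
      = contourIntegral γ (fun z => (z * F z (γ t)) • (L z * M (γ t)) - F z (γ t) • M (γ t)) := by
        refine contourIntegral_congr fun s hs' => ?_
        rw [← mul_assoc, hl s hs', sub_mul, one_mul, smul_mul_assoc, smul_sub, smul_smul,
          mul_comm (F _ _)]
    _ = _ := by
        rw [hγ.contourIntegral_sub ((hγ.continuousOn.mul hc).smul (hL.mul continuousOn_const))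
          (hc.smul continuousOn_const), hz, sub_zero]

/-- The same cancellation in the outer variable. Commutation moves `r` past `L z` to reach `M z'`,
and Fubini makes the `z'`-integral the inner one so that Cauchy's theorem applies to the remainder.
-/
theorem mul_doubleIntegral_right (hγ : IsClosedPath γ)
    (hs : ∀ t ∈ Icc (0 : ℝ) 1, γ t ∈ strip)
    (hL : ContinuousOn (fun t => L (γ t)) (Icc 0 1))
    (hM : ContinuousOn (fun t => M (γ t)) (Icc 0 1)) (hF : IsKernel γ F) {r : R}
    (hr : ∀ t ∈ Icc (0 : ℝ) 1, r * M (γ t) = γ t • M (γ t) - 1)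
    (hrL : ∀ t ∈ Icc (0 : ℝ) 1, Commute r (L (γ t))) :
    r * doubleIntegral γ L M F = doubleIntegral γ L M (fun z z' => z' * F z z') := by
  have h := clm_doubleIntegral hγ hL hM hF.continuousOn (ContinuousLinearMap.mul ℂ R r)
  simp only [ContinuousLinearMap.mul_apply'] at h
  have hLM := continuousOn_prod_mul hL hM
  have hFL : ContinuousOn (fun p : ℝ × ℝ => F (γ p.1) (γ p.2) • L (γ p.1))
      (Icc 0 1 ×ˢ Icc 0 1) :=
    hF.continuousOn.smul (hL.comp (f := fun p : ℝ × ℝ => p.1) continuous_fst.continuousOn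
      fun _ hp => hp.1)
  have hz : contourIntegral γ (fun z' => contourIntegral γ fun z => F z z' • L z) = 0 := by
    rw [hγ.contourIntegral_swap (H := fun z z' => F z z' • L z) hFL,
      contourIntegral_congr (G := fun _ => (0 : R)) fun s hs' => ?_]
    · simp [contourIntegral]
    · rw [hγ.contourIntegral_smul_const (g := fun z' => F (γ s) z')
          (hF.continuousOn.comp (f := fun t => (s, t)) (by fun_prop) fun _ ht => ⟨hs', ht⟩),
        hγ.contourIntegral_eq_zero_of_convex convex_strip isOpen_strip hs (hF.right s hs'),
        zero_smul]
  have hF' := (hF.snd_mul hγ).continuousOn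
  rw [h, doubleIntegral, ← sub_zero (contourIntegral γ fun z' =>
    contourIntegral γ fun z => (z' * F z z') • (L z * M z')), ← hz, ← hγ.contourIntegral_sub
    (hγ.continuousOn_contourIntegral (H := fun z z' => (z' * F z z') • (L z * M z'))
      (hF'.smul hLM))
    (hγ.continuousOn_contourIntegral (H := fun z z' => F z z' • L z) hFL)]
  refine contourIntegral_congr fun t ht => ?_
  have hc := continuousOn_section hF.continuousOn ht
  rw [← hγ.contourIntegral_sub (F := fun z => (γ t * F z (γ t)) • (L z * M (γ t)))
    (G := fun z => F z (γ t) • L z)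
    ((continuousOn_section (F := fun z z' => z' * F z z') hF' ht).smul
      (hL.mul continuousOn_const)) (hc.smul hL)]
  refine contourIntegral_congr fun s hs' => ?_
  rw [← mul_assoc, (hrL s hs').eq, mul_assoc, hr t ht, mul_sub, mul_one, mul_smul_comm, smul_sub,
    smul_smul, mul_comm (F _ _)]

/-- The kernel property is carried through the induction because each further multiplication needs
Cauchy's theorem for the kernel already reached. -/
theorem pow_mul_pow_mul_doubleIntegral (hγ : IsClosedPath γ)
    (hs : ∀ t ∈ Icc (0 : ℝ) 1, γ t ∈ strip)
    (hL : ContinuousOn (fun t => L (γ t)) (Icc 0 1))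
    (hM : ContinuousOn (fun t => M (γ t)) (Icc 0 1)) (hF : IsKernel γ F) {l r : R}
    (hl : ∀ t ∈ Icc (0 : ℝ) 1, l * L (γ t) = γ t • L (γ t) - 1)
    (hr : ∀ t ∈ Icc (0 : ℝ) 1, r * M (γ t) = γ t • M (γ t) - 1)
    (hrL : ∀ t ∈ Icc (0 : ℝ) 1, Commute r (L (γ t))) (i j : ℕ) :
    IsKernel γ (fun z z' => z ^ i * z' ^ j * F z z') ∧ l ^ i * r ^ j * doubleIntegral γ L M F =
      doubleIntegral γ L M (fun z z' => z ^ i * z' ^ j * F z z') := by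
  induction i with
  | zero =>
    induction j with
    | zero => simpa using hF
    | succ j ih =>
      obtain ⟨ih1, ih2⟩ := ih
      have h1 := ih1.snd_mul hγ
      have h2 := mul_doubleIntegral_right hγ hs hL hM ih1 hr hrL
      have h3 : (fun z z' : ℂ => z' * (z ^ 0 * z' ^ j * F z z')) =
          fun z z' => z ^ 0 * z' ^ (j + 1) * F z z' := by
        funext z z'; ring
      rw [h3] at h1 h2
      refine ⟨h1, ?_⟩
      rw [← h2, ← ih2, pow_succ' r, pow_zero, one_mul, one_mul, mul_assoc]
  | succ i ih =>
    obtain ⟨ih1, ih2⟩ := ih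
    have h1 := ih1.fst_mul hγ
    have h2 := mul_doubleIntegral_left hγ hs hL hM ih1 hl
    have h3 : (fun z z' : ℂ => z * (z ^ i * z' ^ j * F z z')) =
        fun z z' => z ^ (i + 1) * z' ^ j * F z z' := by
      funext z z'; ring
    rw [h3] at h1 h2
    refine ⟨h1, ?_⟩
    rw [← h2, ← ih2, pow_succ' l, mul_assoc, mul_assoc, mul_assoc]

/-- The one-variable version of the calculus: Cauchy's theorem removes the remainders `∫ z ^ n dz`,
so all moments of `L` follow from the zeroth one, and the exponential series is integrated term by
term. -/
theorem contourIntegral_exp_smul (hγ : IsClosedPath γ)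
    (hs : ∀ t ∈ Icc (0 : ℝ) 1, γ t ∈ strip)
    (hL : ContinuousOn (fun t => L (γ t)) (Icc 0 1)) {l : R} {c : ℂ}
    (hl : ∀ t ∈ Icc (0 : ℝ) 1, l * L (γ t) = γ t • L (γ t) - 1)
    (hc : contourIntegral γ L = c • 1) :
    contourIntegral γ (fun z => Complex.exp z • L z) = c • NormedSpace.exp l := by
  have hpow : ∀ n : ℕ, contourIntegral γ (fun z => z ^ n • L z) = c • l ^ n := by
    intro n
    induction n with
    | zero => simpa using hc
    | succ n ih =>
      have hn : ContinuousOn (fun t => γ t ^ n) (Icc 0 1) := hγ.continuousOn.pow n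
      have h1 := hγ.contourIntegral_clm (ContinuousLinearMap.mul ℂ R l)
        (F := fun z => z ^ n • L z) (hn.smul hL)
      simp only [ContinuousLinearMap.mul_apply'] at h1
      rw [ih] at h1
      have h2 : contourIntegral γ (fun z : ℂ => z ^ n • (1 : R)) = 0 := by
        rw [hγ.contourIntegral_smul_const (g := fun z => z ^ n) hn, hγ.contourIntegral_eq_zero_of_convex convex_strip
          isOpen_strip hs (differentiableOn_id.pow n), zero_smul]
      calc contourIntegral γ (fun z => z ^ (n + 1) • L z)
          = contourIntegral γ (fun z => l * z ^ n • L z + z ^ n • (1 : R)) := by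
            refine contourIntegral_congr fun t ht => ?_
            rw [mul_smul_comm, hl t ht, smul_sub, smul_smul, ← pow_succ]
            abel
        _ = c • l ^ (n + 1) := by
            rw [hγ.contourIntegral_add (F := fun z => l * z ^ n • L z)
              (G := fun z => z ^ n • (1 : R)) (continuousOn_const.mul (hn.smul hL))
              (hn.smul continuousOn_const), h2, add_zero, h1, mul_smul_comm, ← pow_succ']
  obtain ⟨α, hα⟩ := isCompact_Icc.exists_bound_of_continuousOn hγ.continuousOn
  obtain ⟨C, hC⟩ := isCompact_Icc.exists_bound_of_continuousOn hL
  have hα0 : 0 ≤ α := (norm_nonneg _).trans (hα 0 ⟨le_rfl, zero_le_one⟩)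
  have h := hγ.hasSum_contourIntegral (F := fun n z => ((n ! : ℂ)⁻¹ * z ^ n) • L z)
    (G := fun z => Complex.exp z • L z) (b := fun n => α ^ n / n ! * C)
    (fun n => (continuousOn_const.mul (hγ.continuousOn.pow n)).smul hL) (fun n t ht => ?_)
    ((Real.summable_pow_div_factorial α).mul_right C) fun t ht => ?_
  · refine h.unique ?_
    have h2 := (hasSum_exp l).const_smul c
    refine h2.congr_fun fun n => ?_
    simp only [mul_smul, contourIntegral_smul, hpow]
    rw [smul_comm]
  · rw [norm_smul, norm_mul, norm_inv, norm_pow, Complex.norm_natCast, div_eq_inv_mul]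
    gcongr
    · exact hα t ht
    · exact hC t ht
  · have h3 := hasSum_exp (γ t)
    rw [← Complex.exp_eq_exp_ℂ] at h3
    exact h3.smul_const (L (γ t))

/-- Expanding `dexp l r` and moving each monomial into the kernel replaces the operator product by a
scalar product on the path, where `dexp_mul_strainSymbol` applies. The kernel becomes `e^z + e^z'`;
each summand splits into an exponential integral times an integral equal to `c`, hence the factor `c
^ 2`. -/
theorem dexp_mul_doubleIntegral_strainSymbol (hγ : IsClosedPath γ)
    (hs : ∀ t ∈ Icc (0 : ℝ) 1, γ t ∈ strip)
    (hL : ContinuousOn (fun t => L (γ t)) (Icc 0 1))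
    (hM : ContinuousOn (fun t => M (γ t)) (Icc 0 1)) {l r : R} {c : ℂ}
    (hl : ∀ t ∈ Icc (0 : ℝ) 1, l * L (γ t) = γ t • L (γ t) - 1)
    (hr : ∀ t ∈ Icc (0 : ℝ) 1, r * M (γ t) = γ t • M (γ t) - 1)
    (hrL : ∀ t ∈ Icc (0 : ℝ) 1, Commute r (L (γ t)))
    (hcL : contourIntegral γ L = c • 1) (hcM : contourIntegral γ M = c • 1) :
    dexp l r * doubleIntegral γ L M (fun z z' => strainSymbol (z - z')) =
      c ^ 2 • (NormedSpace.exp l + NormedSpace.exp r) := by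
  have hF := isKernel_strainSymbol hγ hs
  have hpow := pow_mul_pow_mul_doubleIntegral hγ hs hL hM hF hl hr hrL
  have hterm : ∀ n, dexpTerm l r n * doubleIntegral γ L M (fun z z' => strainSymbol (z - z')) =
      doubleIntegral γ L M (fun z z' => dexpTerm z z' n * strainSymbol (z - z')) := by
    intro n
    simp only [dexpTerm, smul_mul_assoc, Finset.sum_mul, smul_eq_mul, mul_assoc,
      doubleIntegral_smul]
    rw [doubleIntegral_sum hγ hL hM]
    · congr 1
      refine Finset.sum_congr rfl fun i _ => ?_
      rw [← mul_assoc, (hpow i _).2]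
      simp only [mul_assoc]
    · intro i
      have := (hpow i (n - 1 - i)).1.continuousOn
      simp only [mul_assoc] at this
      exact this
  obtain ⟨α, hα⟩ := isCompact_Icc.exists_bound_of_continuousOn hγ.continuousOn
  obtain ⟨C, hC⟩ := (isCompact_Icc.prod isCompact_Icc).exists_bound_of_continuousOn hF.continuousOn
  have hcont : ∀ n, ContinuousOn (fun p : ℝ × ℝ => dexpTerm (γ p.1) (γ p.2) n)
      (Icc 0 1 ×ˢ Icc 0 1) := fun n => by
    have h1 := hγ.continuousOn_fst
    have h2 := hγ.continuousOn_snd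
    have h3 : ContinuousOn (fun p : ℝ × ℝ => ∑ i ∈ Finset.range n,
        γ p.1 ^ i * γ p.2 ^ (n - 1 - i)) (Icc 0 1 ×ˢ Icc 0 1) :=
      continuousOn_finsetSum _ fun i _ => (h1.pow i).mul (h2.pow _)
    exact h3.const_smul (n ! : ℂ)⁻¹
  have hsum := hasSum_doubleIntegral hγ hL hM
    (F := fun n z z' => dexpTerm z z' n * strainSymbol (z - z'))
    (G := fun z z' => dexp z z' * strainSymbol (z - z'))
    (fun n => (hcont n).mul hF.continuousOn)
    (fun n s hs' t ht => by
      rw [norm_mul]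
      exact mul_le_mul (norm_dexpTerm_le (hα s hs') (hα t ht) n) (hC (s, t) ⟨hs', ht⟩)
        (norm_nonneg _) ((norm_nonneg _).trans (norm_dexpTerm_le (hα s hs') (hα t ht) n)))
    (((summable_dexp_bound α).mul_left _).mul_right C)
    fun s _ t _ => (hasSum_dexp (γ s) (γ t)).mul_right _
  have hsum2 := (hasSum_dexp l r).mul_right
    (doubleIntegral γ L M (fun z z' => strainSymbol (z - z')))
  simp only [hterm] at hsum2
  -- Two sums of the same series: one computed in the operator algebra, the other under the integral
  -- sign.
  rw [hsum2.unique hsum, doubleIntegral_congr (G := fun z z' => Complex.exp z + Complex.exp z')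
    fun s hs' t ht => dexp_mul_strainSymbol (hs s hs') (hs t ht)]
  have hexp : ContinuousOn (fun t => Complex.exp (γ t)) (Icc 0 1) :=
    Complex.continuous_exp.comp_continuousOn hγ.continuousOn
  have he1 := contourIntegral_exp_smul hγ hs hL hl hcL
  have he2 := contourIntegral_exp_smul hγ hs hM hr hcM
  have hinner : ∀ t ∈ Icc (0 : ℝ) 1, contourIntegral γ (fun z =>
      (Complex.exp z + Complex.exp (γ t)) • (L z * M (γ t))) =
      c • (NormedSpace.exp l * M (γ t)) + c • (Complex.exp (γ t) • M (γ t)) := by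
    intro t ht
    have h1 : contourIntegral γ (fun z => (Complex.exp z • L z) * M (γ t)) =
        contourIntegral γ (fun z => Complex.exp z • L z) * M (γ t) :=
      hγ.contourIntegral_clm ((ContinuousLinearMap.mul ℂ R).flip (M (γ t))) (hexp.smul hL)
    have h2 : contourIntegral γ (fun z => L z * (Complex.exp (γ t) • M (γ t))) =
        contourIntegral γ L * (Complex.exp (γ t) • M (γ t)) :=
      hγ.contourIntegral_clm ((ContinuousLinearMap.mul ℂ R).flip _) hL
    rw [he1] at h1
    rw [hcL] at h2
    simp only [add_smul]
    simp only [← mul_smul_comm (Complex.exp (γ t))]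
    simp only [← smul_mul_assoc (Complex.exp _) (L _)]
    rw [hγ.contourIntegral_add ((hexp.smul hL).mul continuousOn_const)
      (hL.mul continuousOn_const), h1, h2, smul_mul_assoc, smul_mul_assoc, one_mul]
  have h3 : contourIntegral γ (fun z' => NormedSpace.exp l * M z') =
      NormedSpace.exp l * contourIntegral γ M :=
    hγ.contourIntegral_clm (ContinuousLinearMap.mul ℂ R _) hM
  rw [doubleIntegral, contourIntegral_congr (G := fun z' => c • (NormedSpace.exp l * M z') +
    c • (Complex.exp z' • M z')) hinner, hγ.contourIntegral_add
    (F := fun z' => c • (NormedSpace.exp l * M z')) (G := fun z' => c • (Complex.exp z' • M z'))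
    ((continuousOn_const.mul hM).const_smul c) ((hexp.smul hM).const_smul c),
    contourIntegral_smul, contourIntegral_smul, h3, he2, hcM, mul_smul_comm, mul_one, ← smul_add,
    ← smul_add, smul_smul, sq]

end DoubleIntegral

end

/-! ### Normed spaces of matrices and bounded bilinear maps -/

section

open Filter Topology
open scoped Nat Matrix.Norms.Operator

/-- The uniform structure on matrices that comes from the operator norm. -/
local instance normUniformity {d : ℕ} {E : Type*} [NormedAddCommGroup E] :
    UniformSpace (Matrix (Fin d) (Fin d) E) :=
  (Matrix.linftyOpNormedAddCommGroup
    : NormedAddCommGroup (Matrix (Fin d) (Fin d) E)).toPseudoMetricSpace.toUniformSpace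

/-- The topology on matrices that comes from the operator norm. -/
local instance normTopology {d : ℕ} {E : Type*} [NormedAddCommGroup E] :
    TopologicalSpace (Matrix (Fin d) (Fin d) E) :=
  normUniformity.toTopologicalSpace

theorem completeSpace_matrix {d : ℕ} {E : Type*} [NormedAddCommGroup E] [h : CompleteSpace E] :
    CompleteSpace (Matrix (Fin d) (Fin d) E) :=
  (inferInstance : CompleteSpace (Fin d → Fin d → E))

attribute [local instance] completeSpace_matrix

theorem continuous_entry {d : ℕ} {E : Type*} [NormedAddCommGroup E] (k l : Fin d) :
    Continuous fun M : Matrix (Fin d) (Fin d) E => M k l :=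
  continuous_apply_apply (ρ := fun _ _ => E) k l

theorem continuous_matrix_of_entry {d : ℕ} {E X : Type*} [NormedAddCommGroup E]
    [TopologicalSpace X] {f : X → Matrix (Fin d) (Fin d) E}
    (h : ∀ k l, Continuous fun x => f x k l) : Continuous f :=
  continuous_pi (A := fun _ => Fin d → E) fun k => continuous_pi fun l => h k l

theorem bound_of_bound_on_closedBall {E F : Type*} [NormedAddCommGroup E] [NormedSpace ℂ E]
    [NormedAddCommGroup F] [NormedSpace ℂ F] {r : ℝ} (hr : 0 < r) (c : ℝ) (f : E →ₗ[ℂ] F)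
    (h : ∀ x ∈ Metric.closedBall (0 : E) r, ‖f x‖ ≤ c) (x : E) : ‖f x‖ ≤ c / r * ‖x‖ := by
  rcases eq_or_ne x 0 with rfl | hx
  · simp
  · have hx' : 0 < ‖x‖ := norm_pos_iff.2 hx
    have h1 := h (((r / ‖x‖ : ℝ) : ℂ) • x) (by
      rw [mem_closedBall_zero_iff, norm_smul, Complex.norm_real, Real.norm_of_nonneg (by positivity),
        div_mul_cancel₀ _ hx'.ne'])
    rw [map_smul, norm_smul, Complex.norm_real, Real.norm_of_nonneg (by positivity),
      div_mul_eq_mul_div, div_le_iff₀ hx'] at h1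
    rw [div_mul_eq_mul_div, le_div_iff₀ hr, mul_comm]
    exact h1

/-- Continuity at the origin bounds the map by `1` on a product of small balls; rescaling one
argument and then the other gives a global bound. It converts joint continuity of the module action
into operator norms. -/
theorem exists_bound_of_continuous_bilinear {E F G : Type*} [NormedAddCommGroup E]
    [NormedSpace ℂ E] [NormedAddCommGroup F] [NormedSpace ℂ F] [NormedAddCommGroup G]
    [NormedSpace ℂ G] (f : E →ₗ[ℂ] F →ₗ[ℂ] G) (hf : Continuous fun p : E × F => f p.1 p.2) :
    ∃ C : ℝ, ∀ x y, ‖f x y‖ ≤ C * ‖x‖ * ‖y‖ := by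
  have h0 : ∀ᶠ p in 𝓝 (0 : E × F), ‖f p.1 p.2‖ < 1 := by
    refine hf.norm.continuousAt.eventually_lt continuousAt_const ?_
    simp
  obtain ⟨δ, hδ, hball⟩ := Metric.eventually_nhds_iff_ball.1 h0
  have hsmall : ∀ x ∈ Metric.closedBall (0 : E) (δ / 2), ∀ y ∈ Metric.closedBall (0 : F) (δ / 2),
      ‖f x y‖ ≤ 1 := by
    intro x hx y hy
    refine (hball (x, y) ?_).le
    rw [mem_closedBall_zero_iff] at hx hy
    rw [mem_ball_zero_iff, Prod.norm_mk, max_lt_iff]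
    constructor <;> linarith
  have hδ2 : 0 < δ / 2 := half_pos hδ
  refine ⟨1 / (δ / 2) / (δ / 2), fun x y => ?_⟩
  have h1 : ∀ x ∈ Metric.closedBall (0 : E) (δ / 2), ‖f.flip y x‖ ≤ 1 / (δ / 2) * ‖y‖ :=
    fun x hx => by
      rw [LinearMap.flip_apply]
      exact bound_of_bound_on_closedBall hδ2 1 (f x) (hsmall x hx) y
  have h2 := bound_of_bound_on_closedBall hδ2 _ (f.flip y) h1 x
  calc ‖f x y‖ ≤ 1 / (δ / 2) * ‖y‖ / (δ / 2) * ‖x‖ := h2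
    _ = _ := by ring

theorem exp_mul_exp_neg {R : Type*} [NormedRing R] [NormedAlgebra ℂ R] [CompleteSpace R] (a : R) :
    NormedSpace.exp a * NormedSpace.exp (-a) = 1 := by
  let : NormedAlgebra ℚ R := NormedAlgebra.restrictScalars ℚ ℂ R
  rw [← NormedSpace.exp_add_of_commute ((Commute.refl a).neg_right), add_neg_cancel,
    NormedSpace.exp_zero]

section Entry

variable {d : ℕ} {B : Type*} [NormedAddCommGroup B] [NormedSpace ℂ B]

/-- The entry of a matrix at a fixed position, as a continuous linear map. -/
def entryCLM (k l : Fin d) : Matrix (Fin d) (Fin d) B →L[ℂ] B where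
  toFun M := M k l
  map_add' _ _ := rfl
  map_smul' _ _ := rfl
  cont := continuous_entry k l

@[simp]
theorem entryCLM_apply (k l : Fin d) (M : Matrix (Fin d) (Fin d) B) :
    entryCLM k l M = M k l := rfl

end Entry

/-! ### Left and right multiplication operators and the algebraic part of the theorem -/

section Operators

variable {d : ℕ} {A B : Type*} [NormedCommRing A] [NormedAlgebra ℂ A]
  [NormedAddCommGroup B] [NormedSpace ℂ B] [Module A B] [IsScalarTower ℂ A B]

variable (A B d) in
/-- Left multiplication as a bilinear map. -/
def mulLₗ : Matrix (Fin d) (Fin d) A →ₗ[ℂ] Matrix (Fin d) (Fin d) B →ₗ[ℂ]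
    Matrix (Fin d) (Fin d) B :=
  haveI : SMulCommClass ℂ A B := IsScalarTower.to_smulCommClass
  LinearMap.mk₂ ℂ mulL
    (fun M M' N => by ext k l; simp [mulL, add_smul, Finset.sum_add_distrib])
    (fun c M N => by ext k l; simp [mulL, Finset.smul_sum])
    (fun M N N' => by ext k l; simp [mulL, Finset.sum_add_distrib])
    (fun c M N => by ext k l; simp [mulL, Finset.smul_sum, smul_comm c])

variable (A B d) in
/-- Right multiplication as a bilinear map. -/
def mulRₗ : Matrix (Fin d) (Fin d) A →ₗ[ℂ] Matrix (Fin d) (Fin d) B →ₗ[ℂ]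
    Matrix (Fin d) (Fin d) B :=
  haveI : SMulCommClass ℂ A B := IsScalarTower.to_smulCommClass
  LinearMap.mk₂ ℂ (fun M N => mulR N M)
    (fun M M' N => by ext k l; simp [mulR, add_smul, Finset.sum_add_distrib])
    (fun c M N => by ext k l; simp [mulR, Finset.smul_sum])
    (fun M N N' => by ext k l; simp [mulR, Finset.sum_add_distrib])
    (fun c M N => by ext k l; simp [mulR, Finset.smul_sum, smul_comm c])

variable [ContinuousSMul A B]

theorem exists_bound_mulL : ∃ C : ℝ, ∀ (M : Matrix (Fin d) (Fin d) A)
    (N : Matrix (Fin d) (Fin d) B), ‖mulLₗ d A B M N‖ ≤ C * ‖M‖ * ‖N‖ := by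
  refine exists_bound_of_continuous_bilinear _ ?_
  refine continuous_matrix_of_entry fun k l => ?_
  have h : Continuous fun p : Matrix (Fin d) (Fin d) A × Matrix (Fin d) (Fin d) B =>
      ∑ i, p.1 k i • p.2 i l := continuous_finsetSum _ fun i _ =>
    ((continuous_entry k i).comp continuous_fst).smul ((continuous_entry i l).comp continuous_snd)
  exact h

theorem exists_bound_mulR : ∃ C : ℝ, ∀ (M : Matrix (Fin d) (Fin d) A)
    (N : Matrix (Fin d) (Fin d) B), ‖mulRₗ d A B M N‖ ≤ C * ‖M‖ * ‖N‖ := by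
  refine exists_bound_of_continuous_bilinear _ ?_
  refine continuous_matrix_of_entry fun k l => ?_
  have h : Continuous fun p : Matrix (Fin d) (Fin d) A × Matrix (Fin d) (Fin d) B =>
      ∑ i, p.1 i l • p.2 k i := continuous_finsetSum _ fun i _ =>
    ((continuous_entry i l).comp continuous_fst).smul ((continuous_entry k i).comp continuous_snd)
  exact h

variable (B) in
/-- Left multiplication by a matrix over `A`, as an operator on matrices over `B`. -/
def opL : Matrix (Fin d) (Fin d) A →L[ℂ]
    Matrix (Fin d) (Fin d) B →L[ℂ] Matrix (Fin d) (Fin d) B :=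
  (mulLₗ d A B).mkContinuous₂ exists_bound_mulL.choose exists_bound_mulL.choose_spec

variable (B) in
/-- Right multiplication by a matrix over `A`, as an operator on matrices over `B`. -/
def opR : Matrix (Fin d) (Fin d) A →L[ℂ]
    Matrix (Fin d) (Fin d) B →L[ℂ] Matrix (Fin d) (Fin d) B :=
  (mulRₗ d A B).mkContinuous₂ exists_bound_mulR.choose exists_bound_mulR.choose_spec

theorem opL_apply (M : Matrix (Fin d) (Fin d) A) (N : Matrix (Fin d) (Fin d) B) :
    opL B M N = mulL M N := rfl

theorem opR_apply (M : Matrix (Fin d) (Fin d) A) (N : Matrix (Fin d) (Fin d) B) :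
    opR B M N = mulR N M := rfl

omit [NormedAlgebra ℂ A] [NormedSpace ℂ B] [IsScalarTower ℂ A B] [ContinuousSMul A B] in
theorem mulL_mulR (M M' : Matrix (Fin d) (Fin d) A) (N : Matrix (Fin d) (Fin d) B) :
    mulL M (mulR N M') = mulR (mulL M N) M' := by
  ext k l
  simp only [mulL, mulR, Matrix.of_apply, Finset.smul_sum, smul_smul]
  rw [Finset.sum_comm]
  simp only [mul_comm]

theorem opL_mul (M M' : Matrix (Fin d) (Fin d) A) : opL B (M * M') = opL B M * opL B M' := by
  ext N k l
  simp only [mul_apply_eq_comp, opL_apply]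
  simp only [mulL, Matrix.of_apply, Matrix.mul_apply, Finset.smul_sum, Finset.sum_smul, smul_smul]
  rw [Finset.sum_comm]

theorem opR_mul (M M' : Matrix (Fin d) (Fin d) A) : opR B (M * M') = opR B M' * opR B M := by
  ext N k l
  simp only [mul_apply_eq_comp, opR_apply]
  simp only [mulR, Matrix.of_apply, Matrix.mul_apply, Finset.smul_sum, Finset.sum_smul, smul_smul]
  rw [Finset.sum_comm]
  simp only [mul_comm]

theorem opL_one : opL B (1 : Matrix (Fin d) (Fin d) A) = 1 := by
  ext N k l
  simp [opL_apply, mulL, Matrix.one_apply]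

theorem opR_one : opR B (1 : Matrix (Fin d) (Fin d) A) = 1 := by
  ext N k l
  simp [opR_apply, mulR, Matrix.one_apply]

theorem opL_pow (M : Matrix (Fin d) (Fin d) A) (n : ℕ) : opL B (M ^ n) = opL B M ^ n := by
  induction n with
  | zero => simp [opL_one]
  | succ n ih => rw [pow_succ, pow_succ, opL_mul, ih]

theorem opR_pow (M : Matrix (Fin d) (Fin d) A) (n : ℕ) : opR B (M ^ n) = opR B M ^ n := by
  induction n with
  | zero => simp [opR_one]
  | succ n ih => rw [pow_succ, pow_succ', opR_mul, ih]

theorem commute_opL_opR (M M' : Matrix (Fin d) (Fin d) A) : Commute (opL B M) (opR B M') := by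
  ext N : 1
  exact mulL_mulR M M' N

variable [CompleteSpace A] [CompleteSpace B]

theorem opL_exp (M : Matrix (Fin d) (Fin d) A) :
    opL B (NormedSpace.exp M) = NormedSpace.exp (opL B M) := by
  refine ((hasSum_exp M).mapL (opL B)).unique ?_
  simpa only [map_smul, opL_pow] using hasSum_exp (opL B M)

theorem opR_exp (M : Matrix (Fin d) (Fin d) A) :
    opR B (NormedSpace.exp M) = NormedSpace.exp (opR B M) := by
  refine ((hasSum_exp M).mapL (opR B)).unique ?_
  simpa only [map_smul, opR_pow] using hasSum_exp (opR B M)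

/-- Evaluation at `N` followed by extraction of an entry is continuous and linear, so it passes
through an operator-valued double integral. The entrywise definition thus becomes one to which the
calculus of commuting operators applies. -/
theorem doubleDunford_eq {γ : ℝ → ℂ} (hγ : IsClosedPath γ)
    (hs : ∀ t ∈ Icc (0 : ℝ) 1, γ t ∈ strip) {M : Matrix (Fin d) (Fin d) A}
    (hn : ∀ t ∈ Icc (0 : ℝ) 1, γ t ∉ spectrum ℂ M) (N : Matrix (Fin d) (Fin d) B) :
    doubleDunford γ strainSymbol M N = ((2 * Real.pi * Complex.I : ℂ) ^ 2)⁻¹ •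
      doubleIntegral γ (fun z => opL B (resolvent M z)) (fun z => opR B (resolvent M z))
        (fun z z' => strainSymbol (z - z')) N := by
  have hR := hγ.continuousOn_resolvent hn
  ext k l
  rw [doubleDunford, Matrix.of_apply, Matrix.smul_apply]
  congr 1
  have h := clm_doubleIntegral (L := fun z => opL B (resolvent M z))
    (M := fun z => opR B (resolvent M z)) (F := fun z z' => strainSymbol (z - z')) hγ ((opL B).continuous.comp_continuousOn hR)
    ((opR B).continuous.comp_continuousOn hR) (isKernel_strainSymbol hγ hs).continuousOn
    ((entryCLM k l).comp (ContinuousLinearMap.apply ℂ (Matrix (Fin d) (Fin d) B) N))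
  refine Eq.trans ?_ h.symm
  simp only [ContinuousLinearMap.comp_apply, ContinuousLinearMap.apply_apply, entryCLM_apply,
    mul_apply_eq_comp, opL_apply, opR_apply, mulL_mulR]

theorem dexp_doubleDunford {γ : ℝ → ℂ} {M : Matrix (Fin d) (Fin d) A}
    (hγ : EncirclesOnce γ (spectrum ℂ M) strip) (N : Matrix (Fin d) (Fin d) B) :
    dexp (opL B M) (opR B M) (doubleDunford γ strainSymbol M N) =
      mulL (NormedSpace.exp M) N + mulR N (NormedSpace.exp M) := by
  have hp := hγ.isClosedPath
  have hR := hp.continuousOn_resolvent hγ.notMem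
  have hJ := hp.contourIntegral_resolvent hγ.notMem hγ.winding_eq_one
  have key := dexp_mul_doubleIntegral_strainSymbol hp hγ.mem
    (L := fun z => opL B (resolvent M z)) (M := fun z => opR B (resolvent M z))
    (l := opL B M) (r := opR B M) (c := 2 * Real.pi * Complex.I)
    ((opL B).continuous.comp_continuousOn hR) ((opR B).continuous.comp_continuousOn hR)
    (fun t ht => by
      rw [← opL_mul, mul_resolvent (hγ.notMem t ht), map_sub, map_smul, opL_one])
    (fun t ht => by
      rw [← opR_mul, resolvent_mul (hγ.notMem t ht), map_sub, map_smul, opR_one])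
    (fun t _ => (commute_opL_opR _ _).symm)
    (by rw [hp.contourIntegral_clm (opL B) hR, hJ, map_smul, opL_one])
    (by rw [hp.contourIntegral_clm (opR B) hR, hJ, map_smul, opR_one])
  rw [doubleDunford_eq hp hγ.mem hγ.notMem, map_smul, ← mul_apply_eq_comp, key,
    smul_apply, smul_smul, inv_mul_cancel₀
    (pow_ne_zero 2 Complex.two_pi_I_ne_zero), one_smul, ← opL_exp, ← opR_exp]
  rfl

/-- The commutator with `M` is `opL B M - opR B M`, which `dexp` divides out of `exp (opL B M) - exp
(opR B M)`. The factors have to be interchanged first, which is checked on each term of the series.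
-/
theorem dexp_comm (M : Matrix (Fin d) (Fin d) A) (N : Matrix (Fin d) (Fin d) B) :
    dexp (opL B M) (opR B M) (comm M N) = comm (NormedSpace.exp M) N := by
  have h := sub_mul_dexp (commute_opL_opR (B := B) M M)
  have hc : Commute (opL B M - opR B M) (dexp (opL B M) (opR B M)) := by
    have h1 : ∀ n, Commute (opL B M - opR B M) (dexpTerm (opL B M) (opR B M) n) := by
      intro n
      have hl : Commute (opL B M - opR B M) (opL B M) :=
        (Commute.refl _).sub_left (commute_opL_opR M M).symm
      have hr : Commute (opL B M - opR B M) (opR B M) :=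
        (commute_opL_opR M M).sub_left (Commute.refl _)
      exact (Commute.sum_right _ _ _ fun i _ =>
        (hl.pow_right _).mul_right (hr.pow_right _)).smul_right _
    exact Commute.tsum_right _ h1
  rw [hc.eq, ← opL_exp, ← opR_exp] at h
  exact congrArg (fun T => T N) h

/-- On a matrix that commutes with `M`, left and right multiplication by `M` have the same effect,
so `dexp` reduces to its diagonal value, the exponential. -/
theorem dexp_map_of_commute {M X : Matrix (Fin d) (Fin d) A} (hX : Commute M X)
    (incl : A →L[ℂ] B) (hincl : ∀ a b : A, incl (a * b) = a • incl b) :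
    dexp (opL B M) (opR B M) (X.map incl) = (NormedSpace.exp M * X).map incl := by
  have hL : ∀ Y Z : Matrix (Fin d) (Fin d) A, opL B Y (Z.map incl) = (Y * Z).map incl := by
    intro Y Z
    ext k l
    simp [opL_apply, mulL, Matrix.mul_apply, hincl]
  have hRr : ∀ Y Z : Matrix (Fin d) (Fin d) A, opR B Y (Z.map incl) = (Z * Y).map incl := by
    intro Y Z
    ext k l
    simp only [opR_apply, mulR, Matrix.mul_apply, Matrix.map_apply, Matrix.of_apply, map_sum]
    exact Finset.sum_congr rfl fun i _ => by rw [mul_comm, hincl]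
  have hterm : ∀ n, dexpTerm (opL B M) (opR B M) n (X.map incl) =
      (dexpTerm M M n * X).map incl := by
    intro n
    have : ∀ i ∈ Finset.range n, (opL B M ^ i * opR B M ^ (n - 1 - i)) (X.map incl) =
        (M ^ i * M ^ (n - 1 - i) * X).map incl := by
      intro i _
      rw [mul_apply_eq_comp, ← opL_pow, ← opR_pow, hRr, hL, mul_assoc,
        (hX.pow_left (n - 1 - i)).eq]
    rw [dexpTerm, dexpTerm, smul_apply, sum_apply,
      Finset.sum_congr rfl this, smul_mul_assoc, Finset.sum_mul]
    ext k l
    simp [Matrix.sum_apply]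
  have h1 := (hasSum_dexp (opL B M) (opR B M)).mapL
    (ContinuousLinearMap.apply ℂ (Matrix (Fin d) (Fin d) B) (X.map incl))
  have h2 := ((hasSum_dexp M M).mul_right X).map (incl.toLinearMap.mapMatrix.toAddMonoidHom)
    (continuous_id.matrix_map incl.continuous)
  rw [dexp_self] at h2
  refine h1.unique (h2.congr_fun fun n => ?_)
  exact hterm n

/-- Whatever commutes with `M` commutes with its resolvents, and multiplication by `X` on either
side passes through the integral. -/
theorem commute_dunford {γ : ℝ → ℂ} (hγ : IsClosedPath γ) {M X : Matrix (Fin d) (Fin d) A}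
    (hn : ∀ t ∈ Icc (0 : ℝ) 1, γ t ∉ spectrum ℂ M) {g : ℂ → ℂ}
    (hg : ContinuousOn (fun t => g (γ t)) (Icc 0 1)) (hX : Commute X M) :
    Commute X (dunford γ g M) := by
  have hR := hg.smul (hγ.continuousOn_resolvent hn)
  have h1 : dunford γ g M = (2 * Real.pi * Complex.I : ℂ)⁻¹ •
      contourIntegral γ (fun z => g z • resolvent M z) := by
    ext k l
    rw [dunford, Matrix.of_apply, Matrix.smul_apply]
    congr 1
    exact hγ.contourIntegral_clm (F := fun z => g z • resolvent M z) (entryCLM k l) hR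
  rw [h1]
  refine Commute.smul_right ?_ _
  have h2 := hγ.contourIntegral_clm (F := fun z => g z • resolvent M z)
    (ContinuousLinearMap.mul ℂ _ X) hR
  have h3 := hγ.contourIntegral_clm (F := fun z => g z • resolvent M z)
    ((ContinuousLinearMap.mul ℂ _).flip X) hR
  simp only [ContinuousLinearMap.mul_apply', ContinuousLinearMap.flip_apply] at h2 h3
  rw [Commute, SemiconjBy, ← h2, ← h3]
  refine contourIntegral_congr fun t ht => ?_
  have hc : Commute X (resolvent M (γ t)) := by
    have h4 : Commute X (algebraMap ℂ _ (γ t)) := (Algebra.commutes (γ t) X).symm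
    have h5 : Commute X (algebraMap ℂ _ (γ t) - M) := h4.sub_right hX
    rw [spectrum.resolvent_eq (not_not.1 (hn t ht))]
    exact Commute.units_inv_right h5
  exact (hc.smul_right _).eq

theorem conformation_equation {γ γP : ℝ → ℂ} {P : ℂ → ℂ} {U : Set ℂ}
    {M : Matrix (Fin d) (Fin d) A} (hγ : EncirclesOnce γ (spectrum ℂ M) strip)
    (hγP : EncirclesOnce γP (spectrum ℂ (NormedSpace.exp M)) U) (hP : ContinuousOn P U)
    (incl : A →L[ℂ] B) (hincl : ∀ a b : A, incl (a * b) = a • incl b)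
    {G N : Matrix (Fin d) (Fin d) B} {c : ℂ}
    (h : N + comm M (vorticity G) - doubleDunford γ strainSymbol M (strain G) =
      -(c • (dunford γP P (NormedSpace.exp M) * NormedSpace.exp (-M)).map incl)) :
    dexp (opL B M) (opR B M) N + comm (NormedSpace.exp M) (vorticity G)
        - mulR (strain G) (NormedSpace.exp M) - mulL (NormedSpace.exp M) (strain G) =
      -(c • (dunford γP P (NormedSpace.exp M)).map incl) := by
  have hMe : Commute M (NormedSpace.exp M) := (Commute.refl M).exp_right
  have hMe' : Commute M (NormedSpace.exp (-M)) := ((Commute.refl M).neg_right).exp_right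
  have hPc : ContinuousOn (fun t => P (γP t)) (Icc 0 1) :=
    hP.comp hγP.isClosedPath.continuousOn hγP.mem
  have hD := commute_dunford hγP.isClosedPath hγP.notMem hPc hMe
  have hD' := commute_dunford hγP.isClosedPath hγP.notMem hPc
    (Commute.refl (NormedSpace.exp M))
  -- The decisive move: the whole equation is hit with `dexp`. On the right, `exp M` is then moved
  -- past the Dunford integral to meet `exp (-M)`.
  have h1 := congrArg (fun X => dexp (opL B M) (opR B M) X) h
  rw [map_sub, map_add, dexp_comm, dexp_doubleDunford hγ, map_neg, map_smul,
    dexp_map_of_commute (hD.mul_right hMe') incl hincl, ← mul_assoc, hD'.eq, mul_assoc,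
    exp_mul_exp_neg, mul_one] at h1
  rw [← h1]
  abel

end Operators

end

section

open Filter Topology

/-! ### Mollification under the integral sign -/

section Mollify

variable {E : Type*} [NormedAddCommGroup E] [NormedSpace ℝ E] [FiniteDimensional ℝ E]
  [MeasurableSpace E] {μ : Measure E}

theorem normed_sub_comm (ρ : ContDiffBump (0 : E)) (x y : E) :
    ρ.normed μ (x - y) = ρ.normed μ (y - x) := by
  rw [← neg_sub, ρ.normed_neg]

variable [BorelSpace E]

theorem integrable_kernel_mul [SFinite μ] {k : E → ℝ} (hk : Continuous k) {M : ℝ} (hM : ∀ z, ‖k z‖ ≤ M)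
    {p q : E → ℂ} (hp : Integrable p μ) (hq : Integrable q μ) :
    Integrable (fun z : E × E => (k (z.1 - z.2) : ℂ) * (p z.1 * q z.2)) (μ.prod μ) := by
  refine (hp.mul_prod hq).bdd_mul (c := M) ?_ ?_
  · exact (Complex.continuous_ofReal.comp
      (hk.comp (continuous_fst.sub continuous_snd))).aestronglyMeasurable
  · exact Eventually.of_forall fun z => by simpa using hM (z.1 - z.2)

variable [μ.IsAddHaarMeasure]

theorem exists_bound_normed (ρ : ContDiffBump (0 : E)) : ∃ M, ∀ z, ‖ρ.normed μ z‖ ≤ M :=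
  ρ.continuous_normed.bounded_above_of_compact_support ρ.hasCompactSupport_normed

/-- The inner integral is `p x` times a mollification of `q`. The mollifications converge almost
everywhere by Lebesgue differentiation, for which the ratio of the two radii must stay bounded, and
they inherit the bound `C`; dominated convergence finishes. -/
theorem tendsto_integral_mollify (ρ : ℕ → ContDiffBump (0 : E))
    (h0 : Tendsto (fun n => (ρ n).rOut) atTop (𝓝 0))
    (h2 : ∀ n, (ρ n).rOut ≤ 2 * (ρ n).rIn) {p q : E → ℂ} {C : ℝ}
    (hp : Integrable p μ) (hq : Integrable q μ) (hC : ∀ᵐ x ∂μ, ‖q x‖ ≤ C) :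
    Tendsto (fun n => ∫ x, ∫ y, ((ρ n).normed μ (x - y) : ℂ) * (p x * q y) ∂μ ∂μ) atTop
      (𝓝 (∫ x, p x * q x ∂μ)) := by
  have hint : ∀ n, Integrable (fun z : E × E =>
      ((ρ n).normed μ (z.1 - z.2) : ℂ) * (p z.1 * q z.2)) (μ.prod μ) := by
    intro n
    obtain ⟨M, hM⟩ := exists_bound_normed (μ := μ) (ρ n)
    exact integrable_kernel_mul (ρ n).continuous_normed hM hp hq
  have hpull : ∀ n x, ∫ y, ((ρ n).normed μ (x - y) : ℂ) * (p x * q y) ∂μ =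
      p x * ∫ y, (ρ n).normed μ (x - y) • q y ∂μ := by
    intro n x
    rw [← integral_const_mul]
    refine integral_congr_ae (Eventually.of_forall fun y => ?_)
    simp only [Complex.real_smul]
    ring
  refine tendsto_integral_of_dominated_convergence (fun x => ‖p x‖ * C) (fun n => ?_)
    (hp.norm.mul_const C) (fun n => ?_) ?_
  · exact (hint n).integral_prod_left.aestronglyMeasurable
  · refine Eventually.of_forall fun x => ?_
    rw [hpull, norm_mul]
    gcongr
    have hone : ∫ y, (ρ n).normed μ (x - y) * C ∂μ = C := by
      rw [integral_mul_const, integral_sub_left_eq_self (fun z => (ρ n).normed μ z) μ x,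
        (ρ n).integral_normed, one_mul]
    have hi : Integrable (fun y => (ρ n).normed μ (x - y)) μ :=
      ((ρ n).integrable_normed).comp_sub_left x
    rw [← hone]
    refine norm_integral_le_of_norm_le (hi.mul_const C) ?_
    filter_upwards [hC] with y hy
    rw [norm_smul, Real.norm_of_nonneg ((ρ n).nonneg_normed _)]
    exact mul_le_mul_of_nonneg_left hy ((ρ n).nonneg_normed _)
  · filter_upwards [ContDiffBump.ae_convolution_tendsto_right_of_locallyIntegrable (μ := μ)
      (K := 2) h0 (Eventually.of_forall h2) hq.locallyIntegrable] with x hx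
    simp only [convolution_lsmul_swap] at hx
    simp only [hpull]
    exact hx.const_mul (p x)

end Mollify

/-! ### Calculus of weak derivatives: product rule and limits -/

section WeakDeriv

variable {d : ℕ} {Q : Set (SpaceTime d)} {v : SpaceTime d}

instance isAddHaarMeasure_volume : (volume : Measure (SpaceTime d)).IsAddHaarMeasure :=
  Measure.prod.instIsAddHaarMeasure _ _

theorem integrable_indicator_of_isCompact (hQ : IsOpen Q) {h : SpaceTime d → ℂ}
    (hh : LocallyIntegrableOn h Q) {K : Set (SpaceTime d)} (hK : IsCompact K) (hKQ : K ⊆ Q) :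
    Integrable (K.indicator h) := by
  rw [locallyIntegrableOn_iff hQ.isLocallyClosed] at hh
  exact (hh K hKQ hK).integrable_indicator hK.measurableSet

theorem integrable_ofReal_mul {a : SpaceTime d → ℝ} {h : SpaceTime d → ℂ} {m : ℝ}
    (ha : Continuous a) (hm : ∀ x, ‖a x‖ ≤ m) (hh : Integrable h) :
    Integrable (fun x => (a x : ℂ) * h x) :=
  hh.bdd_mul (c := m) (Complex.continuous_ofReal.comp ha).aestronglyMeasurable
    (Eventually.of_forall fun x => by simpa using hm x)

theorem locallyIntegrableOn_mul_of_bounded (hQ : IsOpen Q) {f g : SpaceTime d → ℂ} {C : ℝ}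
    (hf : LocallyIntegrableOn f Q) (hg : AEStronglyMeasurable g (volume.restrict Q))
    (hC : ∀ᵐ x ∂(volume.restrict Q), ‖g x‖ ≤ C) :
    LocallyIntegrableOn (fun x => f x * g x) Q := by
  rw [locallyIntegrableOn_iff hQ.isLocallyClosed] at hf ⊢
  intro K hK hKc
  have hle := Measure.restrict_mono_set volume hK
  exact (hf K hK hKc).mul_bdd (c := C) (hg.mono_measure hle) (ae_mono hle hC)

/-- Cutting off to a compact set that carries the test function makes the functions globally
integrable, as needed for Fubini on the doubled space. -/
theorem HasWeakDeriv.integral_indicator {f f' : SpaceTime d → ℂ} (hf : HasWeakDeriv Q f v f')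
    {K : Set (SpaceTime d)} (hK : IsCompact K) (hKQ : K ⊆ Q) {ψ : SpaceTime d → ℝ}
    (hψ : ContDiff ℝ ∞ ψ) (hψK : tsupport ψ ⊆ K) :
    ∫ x, (fderiv ℝ ψ x v : ℂ) * K.indicator f x = - ∫ x, (ψ x : ℂ) * K.indicator f' x := by
  have h := hf.integral_eq ψ hψ (hK.of_isClosed_subset (isClosed_tsupport ψ) hψK) (hψK.trans hKQ)
  have h1 : ∀ x ∉ K, fderiv ℝ ψ x = 0 := fun x hx =>
    fderiv_of_notMem_tsupport ℝ fun hx' => hx (hψK hx')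
  have h2 : ∀ x ∉ K, ψ x = 0 := fun x hx => image_eq_zero_of_notMem_tsupport fun hx' => hx (hψK hx')
  have e1 : ∀ x, (fderiv ℝ ψ x v : ℂ) * K.indicator f x = (fderiv ℝ ψ x v : ℂ) * f x := by
    intro x
    by_cases hx : x ∈ K
    · rw [indicator_of_mem hx]
    · simp [h1 x hx]
  have e2 : ∀ x, (ψ x : ℂ) * K.indicator f' x = (ψ x : ℂ) * f' x := by
    intro x
    by_cases hx : x ∈ K
    · rw [indicator_of_mem hx]
    · simp [h2 x hx]
  simp only [e1, e2]
  rwa [setIntegral_eq_integral_of_forall_compl_eq_zero fun x hx => ?_,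
    setIntegral_eq_integral_of_forall_compl_eq_zero fun x hx => ?_] at h
  · simp [h2 x fun hx' => hx (hKQ hx')]
  · simp [h1 x fun hx' => hx (hKQ hx')]

/-- Doubling of variables: `f` is tested in `x` against `φ x * k (x - y)` and `g` in `y` against `k
(x - y)`. Since `k (x - y)` has opposite derivatives in `x` and `y`, the terms containing `k'`
cancel, leaving a mollified product rule. -/
theorem integral_mul_mollified {f g f' g' : SpaceTime d → ℂ} (hf : HasWeakDeriv Q f v f')
    (hg : HasWeakDeriv Q g v g') (hQ : IsOpen Q) {φ : SpaceTime d → ℝ} (hφ : ContDiff ℝ ∞ φ)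
    {K K' : Set (SpaceTime d)} (hK : IsCompact K) (hK' : IsCompact K')
    (hKQ : K ⊆ Q) (hKQ' : K' ⊆ Q) (hφK : tsupport φ ⊆ K)
    (ρ : ContDiffBump (0 : SpaceTime d)) (hρ : Metric.cthickening ρ.rOut K ⊆ K') :
    ∫ x, ∫ y, (ρ.normed volume (x - y) : ℂ) *
        (((fderiv ℝ φ x v : ℂ) * K.indicator f x) * K'.indicator g y) =
      -(∫ x, ∫ y, (ρ.normed volume (x - y) : ℂ) *
        (((φ x : ℂ) * K.indicator f' x) * K'.indicator g y)) -
      ∫ y, ∫ x, (ρ.normed volume (y - x) : ℂ) *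
        (K'.indicator g' y * ((φ x : ℂ) * K.indicator f x)) := by
  set k : SpaceTime d → ℝ := ρ.normed volume with hk
  have hkd : ContDiff ℝ ∞ k := ρ.contDiff_normed
  set k' : SpaceTime d → ℝ := fun z => fderiv ℝ k z v with hk'
  have hkc : Continuous k := hkd.continuous
  have hkc' : Continuous k' := (hkd.continuous_fderiv (by simp)).clm_apply continuous_const
  obtain ⟨M, hM⟩ := exists_bound_normed (μ := volume) ρ
  obtain ⟨M', hM'⟩ : ∃ M', ∀ z, ‖k' z‖ ≤ M' :=
    hkc'.bounded_above_of_compact_support (ρ.hasCompactSupport_normed.fderiv_apply ℝ v)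
  have hφs : HasCompactSupport φ := hK.of_isClosed_subset (isClosed_tsupport φ) hφK
  obtain ⟨Mφ, hMφ⟩ := hφ.continuous.bounded_above_of_compact_support hφs
  have hφc' : Continuous fun x => fderiv ℝ φ x v :=
    (hφ.continuous_fderiv (by simp)).clm_apply continuous_const
  obtain ⟨Mφ', hMφ'⟩ := hφc'.bounded_above_of_compact_support (hφs.fderiv_apply ℝ v)
  have hF := integrable_indicator_of_isCompact hQ hf.locallyIntegrable hK hKQ
  have hF' := integrable_indicator_of_isCompact hQ hf.locallyIntegrable_deriv hK hKQ
  have hG := integrable_indicator_of_isCompact hQ hg.locallyIntegrable hK' hKQ'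
  have hG' := integrable_indicator_of_isCompact hQ hg.locallyIntegrable_deriv hK' hKQ'
  set F := K.indicator f with hFdef
  set F' := K.indicator f' with hFdef'
  set G := K'.indicator g with hGdef
  set G' := K'.indicator g' with hGdef'
  have hp1 := integrable_ofReal_mul hφc' hMφ' hF
  have hp2 := integrable_ofReal_mul hφ.continuous hMφ hF
  have hp3 := integrable_ofReal_mul hφ.continuous hMφ hF'
  have I1 := integrable_kernel_mul hkc hM hp1 hG
  have I2 := integrable_kernel_mul hkc' hM' hp2 hG
  have I3 := integrable_kernel_mul hkc hM hp3 hG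
  have I4 := integrable_kernel_mul hkc hM hp2 hG'
  have hleft : ∀ y, ∫ x, ((fderiv ℝ φ x v : ℂ) * (k (x - y) : ℂ) + (φ x : ℂ) * (k' (x - y) : ℂ))
      * F x = - ∫ x, ((φ x : ℂ) * (k (x - y) : ℂ)) * F' x := by
    intro y
    have hs : ContDiff ℝ ∞ fun x => k (x - y) := hkd.comp (contDiff_id.sub contDiff_const)
    have h := hf.integral_indicator hK hKQ (ψ := fun x => φ x * k (x - y)) (hφ.mul hs)
      ((tsupport_mul_subset_left (f := φ)).trans hφK)
    have hd : ∀ x, fderiv ℝ (fun x => φ x * k (x - y)) x v =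
        fderiv ℝ φ x v * k (x - y) + φ x * k' (x - y) := by
      intro x
      have e1 := (hφ.differentiable (by simp) x).hasFDerivAt
      have e2 : HasFDerivAt (fun x => k (x - y))
          ((fderiv ℝ k (x - y)).comp (ContinuousLinearMap.id ℝ _)) x :=
        ((hkd.differentiable (by simp) (x - y)).hasFDerivAt).comp (f := fun x => x - y) x
          ((hasFDerivAt_id x).sub_const y)
      rw [(e1.fun_mul e2).fderiv]
      simp [hk']
      ring
    simp only [hd] at h
    push_cast at h
    exact h
  have hright : ∀ x, ∫ y, ((φ x : ℂ) * (k' (x - y) : ℂ)) * G y =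
      ∫ y, ((φ x : ℂ) * (k (x - y) : ℂ)) * G' y := by
    -- For `x` in `K`, the bump `k (x - y)` is supported in `K'` and is an admissible test function;
    -- elsewhere `φ x` vanishes.
    intro x
    by_cases hx : x ∈ K
    · have hs : ContDiff ℝ ∞ fun y => k (x - y) := hkd.comp (contDiff_const.sub contDiff_id)
      have hsupp : tsupport (fun y => k (x - y)) ⊆ K' := by
        refine (closure_minimal ?_ Metric.isClosed_closedBall).trans
          ((Metric.closedBall_subset_cthickening hx ρ.rOut).trans hρ)
        intro y hy
        have : x - y ∈ Function.support k := hy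
        rw [hk, ρ.support_normed_eq, mem_ball_zero_iff] at this
        rw [Metric.mem_closedBall, dist_comm, dist_eq_norm]
        exact this.le
      have h := hg.integral_indicator hK' hKQ' hs hsupp
      have hd : ∀ y, fderiv ℝ (fun y => k (x - y)) y v = -k' (x - y) := by
        intro y
        have e2 : HasFDerivAt (fun y => k (x - y))
            ((fderiv ℝ k (x - y)).comp (-ContinuousLinearMap.id ℝ _)) y :=
          ((hkd.differentiable (by simp) (x - y)).hasFDerivAt).comp y
            ((hasFDerivAt_id y).const_sub x)
        rw [e2.fderiv]
        simp [hk']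
      simp only [hd] at h
      push_cast at h
      simp only [neg_mul, integral_neg, neg_inj] at h
      simp only [mul_assoc, integral_const_mul]
      rw [h]
    · have : φ x = 0 := image_eq_zero_of_notMem_tsupport fun hx' => hx (hφK hx')
      simp [this]
  have S1 : ∫ x, ∫ y, (k (x - y) : ℂ) * (((fderiv ℝ φ x v : ℂ) * F x) * G y) =
      ∫ y, ∫ x, (k (x - y) : ℂ) * (((fderiv ℝ φ x v : ℂ) * F x) * G y) :=
    integral_integral_swap I1
  have S2 : ∫ x, ∫ y, (k' (x - y) : ℂ) * (((φ x : ℂ) * F x) * G y) =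
      ∫ y, ∫ x, (k' (x - y) : ℂ) * (((φ x : ℂ) * F x) * G y) :=
    integral_integral_swap I2
  have S3 : ∫ x, ∫ y, (k (x - y) : ℂ) * (((φ x : ℂ) * F' x) * G y) =
      ∫ y, ∫ x, (k (x - y) : ℂ) * (((φ x : ℂ) * F' x) * G y) :=
    integral_integral_swap I3
  have S4 : ∫ x, ∫ y, (k (x - y) : ℂ) * (((φ x : ℂ) * F x) * G' y) =
      ∫ y, ∫ x, (k (x - y) : ℂ) * (((φ x : ℂ) * F x) * G' y) :=
    integral_integral_swap I4
  -- `A` integrates `hleft` against `G`, and `B` integrates `hright` against `F`; the common `k'`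
  -- integral is then eliminated.
  have A : (∫ y, ∫ x, (k (x - y) : ℂ) * (((fderiv ℝ φ x v : ℂ) * F x) * G y)) +
      (∫ y, ∫ x, (k' (x - y) : ℂ) * (((φ x : ℂ) * F x) * G y)) =
      - ∫ y, ∫ x, (k (x - y) : ℂ) * (((φ x : ℂ) * F' x) * G y) := by
    rw [← integral_add I1.integral_prod_right I2.integral_prod_right, ← integral_neg]
    refine integral_congr_ae ?_
    filter_upwards [I1.prod_left_ae, I2.prod_left_ae] with y h1 h2
    have h := congrArg (· * G y) (hleft y)
    simp only [neg_mul, ← integral_mul_const] at h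
    rw [← integral_add h1 h2]
    refine Eq.trans (integral_congr_ae (Eventually.of_forall fun x => ?_)) (h.trans (congrArg Neg.neg
      (integral_congr_ae (Eventually.of_forall fun x => ?_))))
    · simp only; ring
    · simp only; ring
  have B : ∫ x, ∫ y, (k' (x - y) : ℂ) * (((φ x : ℂ) * F x) * G y) =
      ∫ x, ∫ y, (k (x - y) : ℂ) * (((φ x : ℂ) * F x) * G' y) := by
    refine integral_congr_ae (Eventually.of_forall fun x => ?_)
    have h := congrArg (· * F x) (hright x)
    simp only [← integral_mul_const] at h
    refine Eq.trans (integral_congr_ae (Eventually.of_forall fun y => ?_)) (h.trans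
      (integral_congr_ae (Eventually.of_forall fun y => ?_)))
    · simp only; ring
    · simp only; ring
  have hsymm : ∫ y, ∫ x, (k (y - x) : ℂ) * (G' y * ((φ x : ℂ) * F x)) =
      ∫ y, ∫ x, (k (x - y) : ℂ) * (((φ x : ℂ) * F x) * G' y) := by
    simp only [hk, normed_sub_comm ρ, mul_comm (G' _)]
  rw [S1, S3, hsymm, ← S4, ← B, S2, ← A]
  ring

/-- The mollification radius is sent to zero in `integral_mul_mollified`. The derivatives are only
locally integrable, so in each term the mollifier must act on a bounded factor: on `g` in the first
two, on `φ f` in the third, where the roles of the variables are exchanged. -/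
theorem HasWeakDeriv.mul {f g f' g' : SpaceTime d → ℂ} (hf : HasWeakDeriv Q f v f')
    (hg : HasWeakDeriv Q g v g') (hQ : IsOpen Q) {C C' : ℝ}
    (hC : ∀ᵐ x ∂(volume.restrict Q), ‖f x‖ ≤ C) (hC' : ∀ᵐ x ∂(volume.restrict Q), ‖g x‖ ≤ C') :
    HasWeakDeriv Q (fun x => f x * g x) v (fun x => f' x * g x + f x * g' x) := by
  have hfm := hf.locallyIntegrable.aestronglyMeasurable
  have hgm := hg.locallyIntegrable.aestronglyMeasurable
  have L1 := locallyIntegrableOn_mul_of_bounded hQ hf.locallyIntegrable_deriv hgm hC'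
  have L2 : LocallyIntegrableOn (fun x => f x * g' x) Q := by
    simpa only [mul_comm] using
      locallyIntegrableOn_mul_of_bounded hQ hg.locallyIntegrable_deriv hfm hC
  refine ⟨locallyIntegrableOn_mul_of_bounded hQ hf.locallyIntegrable hgm hC', L1.add L2,
    fun φ hφ hφs hφQ => ?_⟩
  set K := tsupport φ with hKdef
  have hK : IsCompact K := hφs
  obtain ⟨δ, hδ, hδQ⟩ := hK.exists_cthickening_subset_open hQ hφQ
  set K' := Metric.cthickening δ K with hKdef'
  have hK' : IsCompact K' := hK.cthickening
  have hKK' : K ⊆ K' := Metric.self_subset_cthickening K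
  -- The outer radius tends to zero, never exceeds `δ`, and is exactly twice the inner one.
  let ρ : ℕ → ContDiffBump (0 : SpaceTime d) := fun n =>
    ⟨δ / 2 / (n + 1), δ / (n + 1), by positivity, by gcongr; linarith⟩
  have hρ0 : Tendsto (fun n => (ρ n).rOut) atTop (𝓝 0) := by
    have := (tendsto_one_div_add_atTop_nhds_zero_nat (𝕜 := ℝ)).const_mul δ
    simpa [ρ, div_eq_mul_inv] using this
  have hρ2 : ∀ n, (ρ n).rOut ≤ 2 * (ρ n).rIn := fun n => by
    simp only [ρ]
    apply le_of_eq
    field_simp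
  have hρK : ∀ n, Metric.cthickening (ρ n).rOut K ⊆ K' := fun n => by
    refine Metric.cthickening_mono ?_ K
    exact div_le_self hδ.le (by linarith [(n.cast_nonneg : (0 : ℝ) ≤ n)])
  have hmain := fun n => integral_mul_mollified hf hg hQ hφ hK hK' hφQ hδQ subset_rfl (ρ n) (hρK n)
  obtain ⟨Mφ, hMφ⟩ := hφ.continuous.bounded_above_of_compact_support hφs
  have hφc' : Continuous fun x => fderiv ℝ φ x v :=
    (hφ.continuous_fderiv (by simp)).clm_apply continuous_const
  obtain ⟨Mφ', hMφ'⟩ := hφc'.bounded_above_of_compact_support (hφs.fderiv_apply ℝ v)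
  have hF := integrable_indicator_of_isCompact hQ hf.locallyIntegrable hK hφQ
  have hF' := integrable_indicator_of_isCompact hQ hf.locallyIntegrable_deriv hK hφQ
  have hG := integrable_indicator_of_isCompact hQ hg.locallyIntegrable hK' hδQ
  have hG' := integrable_indicator_of_isCompact hQ hg.locallyIntegrable_deriv hK' hδQ
  -- The maximum with `0` covers points outside `S`, where the indicator vanishes and `m` might be
  -- negative.
  have hbd : ∀ {h : SpaceTime d → ℂ} {S : Set (SpaceTime d)} {m : ℝ}, S ⊆ Q →
      (∀ᵐ x ∂(volume.restrict Q), ‖h x‖ ≤ m) → ∀ᵐ x, ‖S.indicator h x‖ ≤ max m 0 := by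
    intro h S m hS hm
    filter_upwards [(ae_restrict_iff' hQ.measurableSet).1 hm] with x hx
    by_cases hxS : x ∈ S
    · rw [indicator_of_mem hxS]; exact (hx (hS hxS)).trans (le_max_left _ _)
    · rw [indicator_of_notMem hxS, norm_zero]; exact le_max_right _ _
  have hbG := hbd hδQ hC'
  have hbF : ∀ᵐ x, ‖(φ x : ℂ) * K.indicator f x‖ ≤ Mφ * max C 0 := by
    filter_upwards [hbd hφQ hC] with x hx
    rw [norm_mul]
    exact mul_le_mul (by simpa using hMφ x) hx (norm_nonneg _)
      ((norm_nonneg _).trans (hMφ x))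
  have T1 := tendsto_integral_mollify ρ hρ0 hρ2 (integrable_ofReal_mul hφc' hMφ' hF) hG hbG
  have T2 := tendsto_integral_mollify ρ hρ0 hρ2 (integrable_ofReal_mul hφ.continuous hMφ hF') hG hbG
  have T3 := tendsto_integral_mollify ρ hρ0 hρ2 hG' (integrable_ofReal_mul hφ.continuous hMφ hF) hbF
  have hlim := tendsto_nhds_unique (T1.congr hmain) (T2.neg.sub T3)
  have hzero : ∀ x ∉ K, φ x = 0 := fun x hx => image_eq_zero_of_notMem_tsupport hx
  have hzero' : ∀ x ∉ K, fderiv ℝ φ x = 0 := fun x hx => fderiv_of_notMem_tsupport ℝ hx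
  have i1 : Integrable fun x => ((φ x : ℂ) * K.indicator f' x) * K'.indicator g x :=
    (integrable_ofReal_mul hφ.continuous hMφ hF').mul_bdd (c := max C' 0) hG.aestronglyMeasurable hbG
  have i2 : Integrable fun x => K'.indicator g' x * ((φ x : ℂ) * K.indicator f x) :=
    hG'.mul_bdd (c := Mφ * max C 0) (integrable_ofReal_mul hφ.continuous hMφ hF).aestronglyMeasurable hbF
  rw [← neg_add', ← integral_add i1 i2] at hlim
  rw [setIntegral_eq_integral_of_forall_compl_eq_zero fun x hx => ?_,
    setIntegral_eq_integral_of_forall_compl_eq_zero fun x hx => ?_]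
  · refine Eq.trans (integral_congr_ae (Eventually.of_forall fun x => ?_)) (hlim.trans
      (congrArg Neg.neg (integral_congr_ae (Eventually.of_forall fun x => ?_))))
    · by_cases hx : x ∈ K
      · simp only [indicator_of_mem hx, indicator_of_mem (hKK' hx)]; ring
      · simp [hzero' x hx]
    · by_cases hx : x ∈ K
      · simp only [indicator_of_mem hx, indicator_of_mem (hKK' hx)]; ring
      · simp [hzero x hx]
  · simp [hzero x fun hx' => hx (hφQ hx')]
  · simp [hzero' x fun hx' => hx (hφQ hx')]

theorem HasWeakDeriv.congr_ae {f g f' g' : SpaceTime d → ℂ} (hf : HasWeakDeriv Q f v f')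
    (hfg : f =ᵐ[volume.restrict Q] g) (hfg' : f' =ᵐ[volume.restrict Q] g') (hQ : IsOpen Q) :
    HasWeakDeriv Q g v g' := by
  have hloc : ∀ {h k : SpaceTime d → ℂ}, LocallyIntegrableOn h Q →
      h =ᵐ[volume.restrict Q] k → LocallyIntegrableOn k Q := by
    intro h k hh hhk
    rw [locallyIntegrableOn_iff hQ.isLocallyClosed] at hh ⊢
    intro K hK hKc
    exact (hh K hK hKc).congr (ae_mono (Measure.restrict_mono_set volume hK) hhk)
  refine ⟨hloc hf.locallyIntegrable hfg, hloc hf.locallyIntegrable_deriv hfg',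
    fun φ h1 h2 h3 => ?_⟩
  have h := hf.integral_eq φ h1 h2 h3
  refine Eq.trans (integral_congr_ae ?_) (h.trans (congrArg Neg.neg (integral_congr_ae ?_)))
  · filter_upwards [hfg] with x hx; rw [hx]
  · filter_upwards [hfg'] with x hx; rw [hx]

theorem integrableOn_test_mul (hQ : IsOpen Q) {f : SpaceTime d → ℂ}
    (hf : LocallyIntegrableOn f Q) {a : SpaceTime d → ℝ} (ha : Continuous a)
    (has : HasCompactSupport a) (haQ : tsupport a ⊆ Q) :
    IntegrableOn (fun x => (a x : ℂ) * f x) Q := by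
  obtain ⟨M, hM⟩ := ha.bounded_above_of_compact_support has
  rw [locallyIntegrableOn_iff hQ.isLocallyClosed] at hf
  have h1 : IntegrableOn (fun x => (a x : ℂ) * f x) (tsupport a) :=
    (hf _ haQ has).bdd_mul (c := M) (Complex.continuous_ofReal.comp ha).aestronglyMeasurable
      (Eventually.of_forall fun x => by simpa using hM x)
  have h2 : Integrable fun x => (a x : ℂ) * f x := by
    rw [← integrableOn_iff_integrable_of_support_subset (s := tsupport a)]
    · exact h1
    · intro x hx
      by_contra hx'
      exact hx (by simp [image_eq_zero_of_notMem_tsupport hx'])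
  exact h2.integrableOn

theorem HasWeakDeriv.add {f g f' g' : SpaceTime d → ℂ} (hf : HasWeakDeriv Q f v f')
    (hg : HasWeakDeriv Q g v g') (hQ : IsOpen Q) :
    HasWeakDeriv Q (fun x => f x + g x) v (fun x => f' x + g' x) := by
  refine ⟨hf.locallyIntegrable.add hg.locallyIntegrable,
    hf.locallyIntegrable_deriv.add hg.locallyIntegrable_deriv, fun φ h1 h2 h3 => ?_⟩
  have hc : Continuous fun x => fderiv ℝ φ x v :=
    (h1.continuous_fderiv (by simp)).clm_apply continuous_const
  have hs := (tsupport_fderiv_apply_subset ℝ (f := φ) v).trans h3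
  simp only [mul_add]
  rw [integral_add (integrableOn_test_mul hQ hf.locallyIntegrable hc (h2.fderiv_apply ℝ v) hs)
    (integrableOn_test_mul hQ hg.locallyIntegrable hc (h2.fderiv_apply ℝ v) hs),
    integral_add (integrableOn_test_mul hQ hf.locallyIntegrable_deriv h1.continuous h2 h3)
    (integrableOn_test_mul hQ hg.locallyIntegrable_deriv h1.continuous h2 h3),
    hf.integral_eq φ h1 h2 h3, hg.integral_eq φ h1 h2 h3]
  ring

theorem HasWeakDeriv.const_mul {f f' : SpaceTime d → ℂ} (hf : HasWeakDeriv Q f v f') (c : ℂ) :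
    HasWeakDeriv Q (fun x => c * f x) v (fun x => c * f' x) := by
  have hloc : ∀ {g : SpaceTime d → ℂ}, LocallyIntegrableOn g Q →
      LocallyIntegrableOn (fun x => c * g x) Q := fun hg x hx => by
    obtain ⟨s, hs, hi⟩ := hg x hx
    exact ⟨s, hs, Integrable.const_mul hi c⟩
  refine ⟨hloc hf.locallyIntegrable, hloc hf.locallyIntegrable_deriv, fun φ h1 h2 h3 => ?_⟩
  simp only [mul_left_comm _ c]
  rw [integral_const_mul, integral_const_mul, hf.integral_eq φ h1 h2 h3, mul_neg]

theorem hasWeakDeriv_const (c : ℂ) :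
    HasWeakDeriv Q (fun _ => c) v (fun _ => 0) := by
  refine ⟨(locallyIntegrable_const c).locallyIntegrableOn Q,
    (locallyIntegrable_const 0).locallyIntegrableOn Q, fun φ h1 h2 h3 => ?_⟩
  have h0 : ∀ x, x ∉ tsupport φ → fderiv ℝ φ x = 0 := fun x hx => fderiv_of_notMem_tsupport ℝ hx
  have hc : Continuous fun x => fderiv ℝ φ x v :=
    (h1.continuous_fderiv (by simp)).clm_apply continuous_const
  rw [setIntegral_eq_integral_of_forall_compl_eq_zero fun x hx => by
    simp [h0 x fun hx' => hx (h3 hx')]]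
  have h := integral_mul_fderiv_eq_neg_fderiv_mul_of_integrable (μ := (volume : Measure (SpaceTime d)))
    (f := fun _ => (1 : ℝ)) (g := φ) (v := v) (by simp)
    (by simpa using hc.integrable_of_hasCompactSupport (h2.fderiv_apply ℝ v))
    (by simpa using h1.continuous.integrable_of_hasCompactSupport h2)
    (fun _ _ => differentiableAt_const _) (fun x _ => h1.differentiable (by simp) x)
  simp only [one_mul, fderiv_fun_const, Pi.zero_apply, zero_apply, zero_mul,
    integral_zero, neg_zero] at h
  rw [integral_mul_const, integral_complex_ofReal, h]
  simp

/-- Both sides of the defining identity converge by dominated convergence, since test functions have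
compact support in `Q`. -/
theorem HasWeakDeriv.of_tendsto (hQ : IsOpen Q) {f f' : SpaceTime d → ℂ}
    {fn fn' : ℕ → SpaceTime d → ℂ} {b b' : SpaceTime d → ℝ}
    (h : ∀ n, HasWeakDeriv Q (fn n) v (fn' n))
    (hb : LocallyIntegrableOn b Q) (hb' : LocallyIntegrableOn b' Q)
    (hfb : ∀ n, ∀ᵐ x ∂(volume.restrict Q), ‖fn n x‖ ≤ b x)
    (hfb' : ∀ n, ∀ᵐ x ∂(volume.restrict Q), ‖fn' n x‖ ≤ b' x)
    (hf : ∀ᵐ x ∂(volume.restrict Q), Tendsto (fun n => fn n x) atTop (𝓝 (f x)))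
    (hf' : ∀ᵐ x ∂(volume.restrict Q), Tendsto (fun n => fn' n x) atTop (𝓝 (f' x))) :
    HasWeakDeriv Q f v f' := by
  have hloc : ∀ {g : SpaceTime d → ℂ} {gn : ℕ → SpaceTime d → ℂ} {c : SpaceTime d → ℝ},
      (∀ n, LocallyIntegrableOn (gn n) Q) → LocallyIntegrableOn c Q →
      (∀ n, ∀ᵐ x ∂(volume.restrict Q), ‖gn n x‖ ≤ c x) →
      (∀ᵐ x ∂(volume.restrict Q), Tendsto (fun n => gn n x) atTop (𝓝 (g x))) →
      LocallyIntegrableOn g Q := by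
    intro g gn c h1 h2 h3 h4
    have hm : AEStronglyMeasurable g (volume.restrict Q) :=
      aestronglyMeasurable_of_tendsto_ae atTop (fun n => (h1 n).aestronglyMeasurable) h4
    have hle : ∀ᵐ x ∂(volume.restrict Q), ‖g x‖ ≤ ‖c x‖ := by
      filter_upwards [ae_all_iff.2 h3, h4] with x h5 h6
      exact (le_of_tendsto h6.norm (Eventually.of_forall h5)).trans (le_abs_self _)
    rw [locallyIntegrableOn_iff hQ.isLocallyClosed] at h2 ⊢
    intro K hK hKc
    have hr := Measure.restrict_mono_set volume hK
    exact Integrable.mono (h2 K hK hKc) (hm.mono_measure hr) (ae_mono hr hle)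
  refine ⟨hloc (fun n => (h n).locallyIntegrable) hb hfb hf,
    hloc (fun n => (h n).locallyIntegrable_deriv) hb' hfb' hf', fun φ h1 h2 h3 => ?_⟩
  have hlim : ∀ {g : SpaceTime d → ℂ} {gn : ℕ → SpaceTime d → ℂ} {c : SpaceTime d → ℝ}
      {a : SpaceTime d → ℝ},
      (∀ n, LocallyIntegrableOn (gn n) Q) → LocallyIntegrableOn c Q →
      (∀ n, ∀ᵐ x ∂(volume.restrict Q), ‖gn n x‖ ≤ c x) →
      (∀ᵐ x ∂(volume.restrict Q), Tendsto (fun n => gn n x) atTop (𝓝 (g x))) →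
      Continuous a → HasCompactSupport a → tsupport a ⊆ Q →
      Tendsto (fun n => ∫ x in Q, (a x : ℂ) * gn n x) atTop (𝓝 (∫ x in Q, (a x : ℂ) * g x)) := by
    intro g gn c a g1 g2 g3 g4 a1 a2 a3
    have hcc : LocallyIntegrableOn (fun x => (c x : ℂ)) Q := fun x hx => by
      obtain ⟨s, hs, hi⟩ := g2 x hx
      exact ⟨s, hs, Integrable.ofReal hi⟩
    refine tendsto_integral_of_dominated_convergence (fun x => ‖(a x : ℂ) * (c x : ℂ)‖)
      (fun n => (integrableOn_test_mul hQ (g1 n) a1 a2 a3).aestronglyMeasurable)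
      (integrableOn_test_mul hQ hcc a1 a2 a3).norm (fun n => ?_) ?_
    · filter_upwards [g3 n] with x hx
      rw [norm_mul, norm_mul]
      gcongr
      rw [Complex.norm_real]
      exact hx.trans (le_abs_self _)
    · filter_upwards [g4] with x hx
      exact hx.const_mul _
  have hc : Continuous fun x => fderiv ℝ φ x v :=
    (h1.continuous_fderiv (by simp)).clm_apply continuous_const
  have t1 := hlim (fun n => (h n).locallyIntegrable) hb hfb hf hc (h2.fderiv_apply ℝ v)
    ((tsupport_fderiv_apply_subset ℝ (f := φ) v).trans h3)
  have t2 := hlim (fun n => (h n).locallyIntegrable_deriv) hb' hfb' hf' h1.continuous h2 h3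
  refine tendsto_nhds_unique (t1.congr fun n => ?_) t2.neg
  exact (h n).integral_eq φ h1 h2 h3

end WeakDeriv

end

section

open Filter Topology
open scoped Nat Matrix.Norms.Operator

attribute [local instance] normUniformity normTopology completeSpace_matrix

/-! ### Pointwise properties of the function spaces -/

theorem ae_restrict_of_forall_isCompact {d : ℕ} {Q : Set (SpaceTime d)} (hQ : IsOpen Q)
    {p : SpaceTime d → Prop}
    (h : ∀ K : Set (SpaceTime d), IsCompact K → K ⊆ Q → ∀ᵐ x ∂(volume.restrict K), p x) :
    ∀ᵐ x ∂(volume.restrict Q), p x := by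
  rw [ae_restrict_iff' hQ.measurableSet, ae_iff]
  refine measure_null_of_locally_null _ fun x hx => ?_
  have hxQ : x ∈ Q := by
    by_contra hxQ
    exact hx fun h => absurd h hxQ
  obtain ⟨K, hK, hxK, hKQ⟩ := exists_compact_subset hQ hxQ
  have hnull := h K hK hKQ
  rw [ae_restrict_iff' hK.measurableSet, ae_iff] at hnull
  refine ⟨K ∩ {x | ¬(x ∈ Q → p x)}, inter_mem (mem_nhdsWithin_of_mem_nhds
    (mem_interior_iff_mem_nhds.1 hxK)) self_mem_nhdsWithin,
    measure_mono_null (fun y hy => ?_) hnull⟩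
  exact fun hp => hy.2 fun _ => hp hy.1

section Spaces

variable {d : ℕ} {Q : Set (SpaceTime d)} {A B : Type*}
  [NormedCommRing A] [NormedAlgebra ℂ A] [NormedAddCommGroup B] [NormedSpace ℂ B]
  [Module A B] (S : FunctionSpaces Q A B)

namespace FunctionSpaces

theorem funA_pow (a : A) (n : ℕ) : S.funA (a ^ n) = S.funA a ^ n := by
  induction n with
  | zero => rw [pow_zero, pow_zero, S.funA_one]
  | succ n ih => rw [pow_succ, pow_succ, S.funA_mul, ih]

theorem incl_mul (a b : A) : S.incl (a * b) = a • S.incl b := by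
  apply S.funB_injective
  rw [S.funB_incl, S.funA_mul, S.funB_smul, S.funB_incl]

/-- A power trick. On a compact set, the integral of `|a| ^ (n + 1)` is at most a constant times
`‖a‖ ^ (n + 1)`. For `r > ‖a‖`, Chebyshev's inequality bounds the measure of `{|a| ≥ r}` by a
constant times `(‖a‖ / r) ^ (n + 1)`, which tends to zero. -/
theorem norm_funA_le (hQ : IsOpen Q) (a : A) :
    ∀ᵐ x ∂(volume.restrict Q), ‖S.funA a x‖ ≤ ‖a‖ := by
  refine ae_restrict_of_forall_isCompact hQ fun K hK hKQ => ?_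
  obtain ⟨C, hC, hb⟩ := S.locally_bounded K hK hKQ
  have hr := Measure.restrict_mono_set (volume : Measure (SpaceTime d)) hKQ
  have hm : AEMeasurable (fun x => (‖S.funA a x‖ₑ)) (volume.restrict K) :=
    ((S.funA a).aestronglyMeasurable.mono_measure hr).enorm
  have hint : ∀ n : ℕ, ∫⁻ x in K, ‖S.funA a x‖ₑ ^ (n + 1) ≤
      ENNReal.ofReal (C * (‖S.incl‖ * ‖a‖ ^ (n + 1))) := by
    intro n
    have h1 := hb (S.incl (a ^ (n + 1)))
    rw [S.funB_incl, S.funA_pow] at h1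
    have h2 : ∫⁻ x in K, ‖S.funA a x‖ₑ ^ (n + 1) =
        ∫⁻ x in K, ‖(S.funA a ^ (n + 1) : SpaceTime d →ₘ[volume.restrict Q] ℂ) x‖ₑ := by
      refine lintegral_congr_ae (ae_mono hr ?_)
      filter_upwards [AEEqFun.coeFn_pow (S.funA a) (n + 1)] with x hx
      rw [hx, Pi.pow_apply, enorm_pow]
    rw [h2]
    refine h1.trans (ENNReal.ofReal_le_ofReal ?_)
    gcongr
    refine (S.incl.le_opNorm _).trans ?_
    gcongr
    exact norm_pow_le' a n.succ_pos
  have hlt : ∀ m : ℕ, ∀ᵐ x ∂(volume.restrict K), ‖S.funA a x‖ < ‖a‖ + 1 / (m + 1) := by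
    intro m
    set r : ℝ := ‖a‖ + 1 / (m + 1) with hrdef
    have hra : ‖a‖ < r := by
      have : (0 : ℝ) < 1 / (m + 1) := by positivity
      linarith
    have hr0 : 0 < r := (norm_nonneg a).trans_lt hra
    rw [ae_iff]
    simp only [not_lt]
    have hle : ∀ n : ℕ, (volume.restrict K) {x | r ≤ ‖S.funA a x‖} ≤
        ENNReal.ofReal (C * ‖S.incl‖ * (‖a‖ / r) ^ (n + 1)) := by
      intro n
      have h1 := (mul_meas_ge_le_lintegral₀ (hm.pow_const (n + 1))
        (ENNReal.ofReal r ^ (n + 1))).trans (hint n)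
      have h2 : (volume.restrict K) {x | r ≤ ‖S.funA a x‖} ≤ (volume.restrict K)
          {x | ENNReal.ofReal r ^ (n + 1) ≤ ‖S.funA a x‖ₑ ^ (n + 1)} := by
        refine measure_mono fun x hx => ?_
        have : ENNReal.ofReal r ≤ ‖S.funA a x‖ₑ := by
          rw [← ofReal_norm]
          exact ENNReal.ofReal_le_ofReal hx
        exact pow_le_pow_left' this _
      have hpos : ENNReal.ofReal r ^ (n + 1) ≠ 0 := by
        simpa using hr0
      have hfin : ENNReal.ofReal r ^ (n + 1) ≠ ⊤ := by simp
      calc (volume.restrict K) {x | r ≤ ‖S.funA a x‖} ≤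
          ENNReal.ofReal (C * (‖S.incl‖ * ‖a‖ ^ (n + 1))) / ENNReal.ofReal r ^ (n + 1) := by
            rw [ENNReal.le_div_iff_mul_le (Or.inl hpos) (Or.inl hfin), mul_comm]
            exact (mul_le_mul_right h2 _).trans h1
        _ = _ := by
            rw [← ENNReal.ofReal_pow hr0.le, ← ENNReal.ofReal_div_of_pos (by positivity)]
            congr 1
            rw [div_pow]
            ring
    have hlim : Tendsto (fun n : ℕ => ENNReal.ofReal (C * ‖S.incl‖ * (‖a‖ / r) ^ (n + 1))) atTop
        (𝓝 0) := by
      rw [← ENNReal.ofReal_zero]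
      refine ENNReal.tendsto_ofReal ?_
      have h1 : Tendsto (fun n : ℕ => (‖a‖ / r) ^ (n + 1)) atTop (𝓝 0) :=
        (tendsto_pow_atTop_nhds_zero_of_lt_one (by positivity) ((div_lt_one hr0).2 hra)).comp
          (tendsto_add_atTop_nat 1)
      simpa using h1.const_mul (C * ‖S.incl‖)
    exact le_antisymm (ge_of_tendsto' hlim hle) zero_le
  filter_upwards [ae_all_iff.2 hlt] with x hx
  have hlim : Tendsto (fun m : ℕ => ‖a‖ + 1 / ((m : ℝ) + 1)) atTop (𝓝 (‖a‖ + 0)) :=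
    tendsto_const_nhds.add tendsto_one_div_add_atTop_nhds_zero_nat
  rw [add_zero] at hlim
  exact ge_of_tendsto' hlim fun m => (hx m).le

/-- The norm of `A` controls the essential supremum, so the full sequence converges almost
everywhere; no subsequence is needed. -/
theorem tendsto_funA (hQ : IsOpen Q) {a : ℕ → A} {b : A} (h : Tendsto a atTop (𝓝 b)) :
    ∀ᵐ x ∂(volume.restrict Q), Tendsto (fun n => S.funA (a n) x) atTop (𝓝 (S.funA b x)) := by
  have h1 : ∀ᵐ x ∂(volume.restrict Q), ∀ n, ‖S.funA (a n - b) x‖ ≤ ‖a n - b‖ :=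
    ae_all_iff.2 fun n => S.norm_funA_le hQ _
  have h2 : ∀ᵐ x ∂(volume.restrict Q), ∀ n, S.funA (a n - b) x = S.funA (a n) x - S.funA b x :=
    ae_all_iff.2 fun n => by
      rw [map_sub]
      exact AEEqFun.coeFn_sub _ _
  filter_upwards [h1, h2] with x hx1 hx2
  rw [tendsto_iff_norm_sub_tendsto_zero] at h ⊢
  refine squeeze_zero (fun _ => norm_nonneg _) (fun n => ?_) h
  rw [← hx2 n]
  exact hx1 n

/-- In `B` only local `L¹` convergence is available. Fatou's lemma on each compact set identifies
its limit with a given almost everywhere limit. -/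
theorem funB_eq_of_tendsto (hQ : IsOpen Q) {b : ℕ → B} {c : B} (h : Tendsto b atTop (𝓝 c))
    {g : SpaceTime d → ℂ}
    (hg : ∀ᵐ x ∂(volume.restrict Q), Tendsto (fun n => S.funB (b n) x) atTop (𝓝 (g x))) :
    ∀ᵐ x ∂(volume.restrict Q), S.funB c x = g x := by
  refine ae_restrict_of_forall_isCompact hQ fun K hK hKQ => ?_
  obtain ⟨C, hC, hb⟩ := S.locally_bounded K hK hKQ
  have hr := Measure.restrict_mono_set (volume : Measure (SpaceTime d)) hKQ
  have hmeas : ∀ y : B, AEStronglyMeasurable (S.funB y) (volume.restrict K) := fun y =>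
    (S.funB y).aestronglyMeasurable.mono_measure hr
  have hg' := ae_mono hr hg
  have hgm : AEStronglyMeasurable g (volume.restrict K) :=
    aestronglyMeasurable_of_tendsto_ae atTop (fun n => hmeas (b n)) hg'
  have hle : ∀ n, ∫⁻ x in K, ‖S.funB c x - S.funB (b n) x‖ₑ ≤
      ENNReal.ofReal (C * ‖c - b n‖) := by
    intro n
    refine le_trans (le_of_eq (lintegral_congr_ae (ae_mono hr ?_))) (hb (c - b n))
    rw [map_sub]
    filter_upwards [AEEqFun.coeFn_sub (S.funB c) (S.funB (b n))] with x hx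
    rw [hx, Pi.sub_apply]
  have hlim : Tendsto (fun n => ENNReal.ofReal (C * ‖c - b n‖)) atTop (𝓝 0) := by
    rw [← ENNReal.ofReal_zero]
    refine ENNReal.tendsto_ofReal ?_
    have := ((tendsto_const_nhds (x := c)).sub h).norm.const_mul C
    simpa using this
  have hzero : ∫⁻ x in K, ‖S.funB c x - g x‖ₑ = 0 := by
    refine le_antisymm ?_ zero_le
    calc ∫⁻ x in K, ‖S.funB c x - g x‖ₑ
        = ∫⁻ x in K, liminf (fun n => ‖S.funB c x - S.funB (b n) x‖ₑ) atTop := by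
          refine lintegral_congr_ae ?_
          filter_upwards [hg'] with x hx
          exact ((tendsto_const_nhds.sub hx).enorm).liminf_eq.symm
      _ ≤ liminf (fun n => ∫⁻ x in K, ‖S.funB c x - S.funB (b n) x‖ₑ) atTop :=
          lintegral_liminf_le' fun n => ((hmeas c).sub (hmeas (b n))).enorm
      _ ≤ liminf (fun n => ENNReal.ofReal (C * ‖c - b n‖)) atTop :=
          liminf_le_liminf (Eventually.of_forall hle)
      _ = 0 := hlim.liminf_eq
  filter_upwards [(lintegral_eq_zero_iff' (f := fun x => ‖S.funB c x - g x‖ₑ)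
    ((hmeas c).sub hgm).enorm).1 hzero] with x hx
  rw [Pi.zero_apply, enorm_eq_zero, sub_eq_zero] at hx
  exact hx

theorem funA_sum {ι : Type*} (s : Finset ι) (a : ι → A) :
    ∀ᵐ x ∂(volume.restrict Q), S.funA (∑ i ∈ s, a i) x = ∑ i ∈ s, S.funA (a i) x := by
  classical
  induction s using Finset.induction_on with
  | empty =>
    simp only [Finset.sum_empty, map_zero]
    exact AEEqFun.coeFn_zero
  | insert i s hi ih =>
    rw [Finset.sum_insert hi, map_add]
    filter_upwards [AEEqFun.coeFn_add (S.funA (a i)) (S.funA (∑ i ∈ s, a i)), ih] with x h1 h2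
    rw [h1, Pi.add_apply, h2, Finset.sum_insert hi]

theorem funB_sum {ι : Type*} (s : Finset ι) (b : ι → B) :
    ∀ᵐ x ∂(volume.restrict Q), S.funB (∑ i ∈ s, b i) x = ∑ i ∈ s, S.funB (b i) x := by
  classical
  induction s using Finset.induction_on with
  | empty =>
    simp only [Finset.sum_empty, map_zero]
    exact AEEqFun.coeFn_zero
  | insert i s hi ih =>
    rw [Finset.sum_insert hi, map_add]
    filter_upwards [AEEqFun.coeFn_add (S.funB (b i)) (S.funB (∑ i ∈ s, b i)), ih] with x h1 h2
    rw [h1, Pi.add_apply, h2, Finset.sum_insert hi]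

/-- The matrix of values at a point of a matrix over `A`. -/
def evalA (M : Matrix (Fin d) (Fin d) A) (x : SpaceTime d) : Matrix (Fin d) (Fin d) ℂ :=
  Matrix.of fun k l => S.funA (M k l) x

/-- The matrix of values at a point of a matrix over `B`. -/
def evalB (N : Matrix (Fin d) (Fin d) B) (x : SpaceTime d) : Matrix (Fin d) (Fin d) ℂ :=
  Matrix.of fun k l => S.funB (N k l) x

theorem evalA_mul (M M' : Matrix (Fin d) (Fin d) A) :
    ∀ᵐ x ∂(volume.restrict Q), S.evalA (M * M') x = S.evalA M x * S.evalA M' x := by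
  have h1 : ∀ᵐ x ∂(volume.restrict Q), ∀ k l,
      S.funA (∑ i, M k i * M' i l) x = ∑ i, S.funA (M k i * M' i l) x :=
    ae_all_iff.2 fun k => ae_all_iff.2 fun l => S.funA_sum _ _
  have h2 : ∀ᵐ x ∂(volume.restrict Q), ∀ k l i,
      S.funA (M k i * M' i l) x = S.funA (M k i) x * S.funA (M' i l) x :=
    ae_all_iff.2 fun k => ae_all_iff.2 fun l => ae_all_iff.2 fun i => by
      rw [S.funA_mul]; exact AEEqFun.coeFn_mul _ _
  filter_upwards [h1, h2] with x hx1 hx2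
  ext k l
  simp only [evalA, Matrix.of_apply, Matrix.mul_apply, hx1, hx2]

theorem evalA_one : ∀ᵐ x ∂(volume.restrict Q), S.evalA 1 x = 1 := by
  have h1 : ∀ᵐ x ∂(volume.restrict Q), S.funA 1 x = 1 := by
    rw [S.funA_one]; exact AEEqFun.coeFn_one
  have h2 : ∀ᵐ x ∂(volume.restrict Q), S.funA 0 x = 0 := by
    rw [map_zero]; exact AEEqFun.coeFn_zero
  filter_upwards [h1, h2] with x hx1 hx2
  ext k l
  rcases eq_or_ne k l with rfl | hkl
  · simp [evalA, hx1]
  · rw [evalA, Matrix.of_apply, Matrix.one_apply_ne hkl, Matrix.one_apply_ne hkl, hx2]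

theorem evalA_pow (M : Matrix (Fin d) (Fin d) A) (n : ℕ) :
    ∀ᵐ x ∂(volume.restrict Q), S.evalA (M ^ n) x = S.evalA M x ^ n := by
  induction n with
  | zero => simpa using S.evalA_one
  | succ n ih =>
    filter_upwards [ih, S.evalA_mul (M ^ n) M] with x h1 h2
    rw [pow_succ, pow_succ, h2, h1]

theorem evalB_mulL (M : Matrix (Fin d) (Fin d) A) (N : Matrix (Fin d) (Fin d) B) :
    ∀ᵐ x ∂(volume.restrict Q), S.evalB (mulL M N) x = mulL (S.evalA M x) (S.evalB N x) := by
  have h1 : ∀ᵐ x ∂(volume.restrict Q), ∀ k l,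
      S.funB (∑ i, M k i • N i l) x = ∑ i, S.funB (M k i • N i l) x :=
    ae_all_iff.2 fun k => ae_all_iff.2 fun l => S.funB_sum _ _
  have h2 : ∀ᵐ x ∂(volume.restrict Q), ∀ k l i,
      S.funB (M k i • N i l) x = S.funA (M k i) x * S.funB (N i l) x :=
    ae_all_iff.2 fun k => ae_all_iff.2 fun l => ae_all_iff.2 fun i => by
      rw [S.funB_smul]; exact AEEqFun.coeFn_mul _ _
  filter_upwards [h1, h2] with x hx1 hx2
  ext k l
  simp only [evalA, evalB, mulL, Matrix.of_apply, hx1, hx2, smul_eq_mul]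

theorem evalB_mulR (M : Matrix (Fin d) (Fin d) A) (N : Matrix (Fin d) (Fin d) B) :
    ∀ᵐ x ∂(volume.restrict Q), S.evalB (mulR N M) x = mulR (S.evalB N x) (S.evalA M x) := by
  have h1 : ∀ᵐ x ∂(volume.restrict Q), ∀ k l,
      S.funB (∑ i, M i l • N k i) x = ∑ i, S.funB (M i l • N k i) x :=
    ae_all_iff.2 fun k => ae_all_iff.2 fun l => S.funB_sum _ _
  have h2 : ∀ᵐ x ∂(volume.restrict Q), ∀ k l i,
      S.funB (M i l • N k i) x = S.funA (M i l) x * S.funB (N k i) x :=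
    ae_all_iff.2 fun k => ae_all_iff.2 fun l => ae_all_iff.2 fun i => by
      rw [S.funB_smul]; exact AEEqFun.coeFn_mul _ _
  filter_upwards [h1, h2] with x hx1 hx2
  ext k l
  simp only [evalA, evalB, mulR, Matrix.of_apply, hx1, hx2, smul_eq_mul]

theorem evalB_sum {ι : Type*} (s : Finset ι) (N : ι → Matrix (Fin d) (Fin d) B) :
    ∀ᵐ x ∂(volume.restrict Q), S.evalB (∑ i ∈ s, N i) x = ∑ i ∈ s, S.evalB (N i) x := by
  have h1 : ∀ᵐ x ∂(volume.restrict Q), ∀ k l,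
      S.funB (∑ i ∈ s, N i k l) x = ∑ i ∈ s, S.funB (N i k l) x :=
    ae_all_iff.2 fun k => ae_all_iff.2 fun l => S.funB_sum _ _
  filter_upwards [h1] with x hx
  ext k l
  simp only [evalB, Matrix.of_apply, Matrix.sum_apply, hx]

theorem evalB_smul (c : ℂ) (N : Matrix (Fin d) (Fin d) B) :
    ∀ᵐ x ∂(volume.restrict Q), S.evalB (c • N) x = c • S.evalB N x := by
  have h1 : ∀ᵐ x ∂(volume.restrict Q), ∀ k l,
      S.funB (c • N k l) x = c • S.funB (N k l) x :=
    ae_all_iff.2 fun k => ae_all_iff.2 fun l => by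
      rw [map_smul]; exact AEEqFun.coeFn_smul _ _
  filter_upwards [h1] with x hx
  ext k l
  simp only [evalB, Matrix.of_apply, Matrix.smul_apply, hx]

end FunctionSpaces

end Spaces

theorem norm_le_sum_entries {d : ℕ} {E : Type*} [NormedAddCommGroup E]
    (M : Matrix (Fin d) (Fin d) E) : ‖M‖ ≤ ∑ k, ∑ l, ‖M k l‖ := by
  have h : (Finset.univ.sup fun k => ∑ l, ‖M k l‖₊) ≤ ∑ k, ∑ l, ‖M k l‖₊ :=
    Finset.sup_le fun k hk => Finset.single_le_sum (f := fun k => ∑ l, ‖M k l‖₊)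
      (fun _ _ => zero_le) hk
  rw [Matrix.linfty_opNorm_def]
  refine (NNReal.coe_le_coe.2 h).trans (le_of_eq ?_)
  push_cast
  rfl

/-! ### Uniform bounds for the partial sums of `dexp` -/

section OperatorBounds

variable {d : ℕ} {A B : Type*} [NormedCommRing A] [NormedAlgebra ℂ A] [NormedAddCommGroup B]
  [NormedSpace ℂ B] [Module A B] [IsScalarTower ℂ A B] [ContinuousSMul A B]

theorem exists_norm_opL_le :
    ∃ c : ℝ, 0 ≤ c ∧ ∀ M : Matrix (Fin d) (Fin d) A, ‖opL B M‖ ≤ c * ‖M‖ :=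
  let ⟨c, h0, h⟩ := (opL B : Matrix (Fin d) (Fin d) A →L[ℂ] _).bound
  ⟨c, h0.le, h⟩

theorem exists_norm_opR_le :
    ∃ c : ℝ, 0 ≤ c ∧ ∀ M : Matrix (Fin d) (Fin d) A, ‖opR B M‖ ≤ c * ‖M‖ :=
  let ⟨c, h0, h⟩ := (opR B : Matrix (Fin d) (Fin d) A →L[ℂ] _).bound
  ⟨c, h0.le, h⟩

theorem exists_bound_sum_dexpTerm {R : Type*} [NormedRing R] [NormedAlgebra ℂ R] (α : ℝ) :
    ∃ C : ℝ, 0 ≤ C ∧ ∀ {l r : R}, ‖l‖ ≤ α → ‖r‖ ≤ α → ∀ N : ℕ,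
      ‖∑ n ∈ Finset.range N, dexpTerm l r n‖ ≤ C := by
  by_cases hα : 0 ≤ α
  · refine ⟨∑' n, _, tsum_nonneg fun n => ?_, fun {l r} hl hr N =>
      (norm_sum_le_of_le _ fun n _ => norm_dexpTerm_le hl hr n).trans
        (Summable.sum_le_tsum _ (fun n _ => ?_) ((summable_dexp_bound α).mul_left _))⟩ <;>
    positivity
  · exact ⟨0, le_rfl, fun hl => absurd ((norm_nonneg _).trans hl) hα⟩

end OperatorBounds

/-! ### Weak differentiation of the matrix exponential -/

section Spaces

variable {d : ℕ} {Q : Set (SpaceTime d)} {v : SpaceTime d}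

theorem HasWeakDeriv.sum {ι : Type*} (s : Finset ι) {f f' : ι → SpaceTime d → ℂ}
    (hf : ∀ i, HasWeakDeriv Q (f i) v (f' i)) (hQ : IsOpen Q) :
    HasWeakDeriv Q (fun x => ∑ i ∈ s, f i x) v (fun x => ∑ i ∈ s, f' i x) := by
  classical
  induction s using Finset.induction_on with
  | empty => simpa using hasWeakDeriv_const (0 : ℂ)
  | insert i s hi ih =>
    simp only [Finset.sum_insert hi]
    exact (hf i).add ih hQ

variable {A B : Type*} [NormedCommRing A] [NormedAlgebra ℂ A] [NormedAddCommGroup B]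
  [NormedSpace ℂ B] [Module A B] (S : FunctionSpaces Q A B)

namespace FunctionSpaces

/-- `F` is the entrywise weak derivative of the matrix `M` over `A` in the direction `v`. -/
def HasMatrixWeakDeriv (v : SpaceTime d) (M : Matrix (Fin d) (Fin d) A)
    (F : SpaceTime d → Matrix (Fin d) (Fin d) ℂ) : Prop :=
  ∀ k l, HasWeakDeriv Q (S.funA (M k l)) v (fun x => F x k l)

variable {S} {M M' : Matrix (Fin d) (Fin d) A} {F F' : SpaceTime d → Matrix (Fin d) (Fin d) ℂ}

theorem HasMatrixWeakDeriv.congr_ae (h : S.HasMatrixWeakDeriv v M F) (hQ : IsOpen Q)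
    (hF : ∀ᵐ x ∂(volume.restrict Q), F x = F' x) : S.HasMatrixWeakDeriv v M F' := fun k l =>
  (h k l).congr_ae EventuallyEq.rfl (by filter_upwards [hF] with x hx; rw [hx]) hQ

theorem HasMatrixWeakDeriv.one (hQ : IsOpen Q) :
    S.HasMatrixWeakDeriv v (1 : Matrix (Fin d) (Fin d) A) 0 := by
  intro k l
  refine (hasWeakDeriv_const ((1 : Matrix (Fin d) (Fin d) ℂ) k l)).congr_ae ?_ EventuallyEq.rfl hQ
  filter_upwards [S.evalA_one] with x hx
  rw [← hx]
  rfl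

theorem HasMatrixWeakDeriv.mul (h : S.HasMatrixWeakDeriv v M F) (h' : S.HasMatrixWeakDeriv v M' F')
    (hQ : IsOpen Q) :
    S.HasMatrixWeakDeriv v (M * M') (fun x => F x * S.evalA M' x + S.evalA M x * F' x) := by
  intro k l
  have h1 := HasWeakDeriv.sum Finset.univ (fun i => (h k i).mul (h' i l) hQ
    (S.norm_funA_le hQ _) (S.norm_funA_le hQ _)) hQ
  refine h1.congr_ae ?_ (Eventually.of_forall fun x => ?_) hQ
  · filter_upwards [S.evalA_mul M M'] with x hx
    have := congrFun (congrFun hx k) l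
    rw [Matrix.mul_apply] at this
    exact this.symm
  · simp only [Matrix.add_apply, Matrix.mul_apply, Finset.sum_add_distrib]
    rfl

theorem HasMatrixWeakDeriv.smul (h : S.HasMatrixWeakDeriv v M F) (hQ : IsOpen Q) (c : ℂ) :
    S.HasMatrixWeakDeriv v (c • M) (fun x => c • F x) := by
  intro k l
  refine ((h k l).const_mul c).congr_ae ?_ EventuallyEq.rfl hQ
  rw [Matrix.smul_apply, map_smul]
  filter_upwards [AEEqFun.coeFn_smul c (S.funA (M k l))] with x hx
  rw [hx, Pi.smul_apply, smul_eq_mul]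

theorem HasMatrixWeakDeriv.sum {ι : Type*} (s : Finset ι) {M : ι → Matrix (Fin d) (Fin d) A}
    {F : ι → SpaceTime d → Matrix (Fin d) (Fin d) ℂ}
    (h : ∀ i, S.HasMatrixWeakDeriv v (M i) (F i)) (hQ : IsOpen Q) :
    S.HasMatrixWeakDeriv v (∑ i ∈ s, M i) (fun x => ∑ i ∈ s, F i x) := by
  intro k l
  refine (HasWeakDeriv.sum s (fun i => h i k l) hQ).congr_ae ?_
    (Eventually.of_forall fun x => ?_) hQ
  · filter_upwards [S.funA_sum s fun i => M i k l] with x hx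
    rw [Matrix.sum_apply, hx]
  · simp only [Matrix.sum_apply]

theorem mulL_complex (a X : Matrix (Fin d) (Fin d) ℂ) : mulL a X = a * X := by
  ext k l
  simp [mulL, Matrix.mul_apply]

theorem mulR_complex (a X : Matrix (Fin d) (Fin d) ℂ) : mulR X a = X * a := by
  ext k l
  simp [mulR, Matrix.mul_apply, mul_comm]

theorem opL_pow_mul_opR_pow_apply (a X : Matrix (Fin d) (Fin d) ℂ) (i j : ℕ) :
    (opL ℂ a ^ i * opR ℂ a ^ j) X = a ^ i * X * a ^ j := by
  rw [mul_apply_eq_comp, ← opL_pow, ← opR_pow, opL_apply, opR_apply, mulL_complex, mulR_complex,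
    mul_assoc]

theorem dexpTerm_apply_complex (a X : Matrix (Fin d) (Fin d) ℂ) (n : ℕ) :
    dexpTerm (opL ℂ a) (opR ℂ a) n X =
      (n ! : ℂ)⁻¹ • ∑ i ∈ Finset.range n, a ^ i * X * a ^ (n - 1 - i) := by
  rw [dexpTerm, smul_apply, sum_apply]
  simp only [opL_pow_mul_opR_pow_apply]

/-- The noncommutative Leibniz rule: `F x` takes the place of one factor at a time. Divided by `n!`,
this is exactly the `n`-th term of `dexp` for left and right multiplication by the value of `M` at
`x`. -/
theorem HasMatrixWeakDeriv.pow (h : S.HasMatrixWeakDeriv v M F) (hQ : IsOpen Q) (n : ℕ) :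
    S.HasMatrixWeakDeriv v (M ^ n) (fun x =>
      ∑ i ∈ Finset.range n, S.evalA M x ^ i * F x * S.evalA M x ^ (n - 1 - i)) := by
  induction n with
  | zero =>
    simp only [pow_zero, Finset.range_zero, Finset.sum_empty]
    exact HasMatrixWeakDeriv.one hQ
  | succ n ih =>
    rw [pow_succ]
    refine (ih.mul h hQ).congr_ae hQ ?_
    filter_upwards [S.evalA_pow M n] with x hx
    rw [hx, Finset.sum_range_succ, Finset.sum_mul]
    congr 1
    · refine Finset.sum_congr rfl fun i hi => ?_
      rw [mul_assoc _ (_ ^ _) (S.evalA M x), ← pow_succ]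
      congr 2
      have := Finset.mem_range.1 hi
      omega
    · simp

theorem HasMatrixWeakDeriv.exp_term (h : S.HasMatrixWeakDeriv v M F) (hQ : IsOpen Q) (n : ℕ) :
    S.HasMatrixWeakDeriv v ((n ! : ℂ)⁻¹ • M ^ n) (fun x =>
      dexpTerm (opL ℂ (S.evalA M x)) (opR ℂ (S.evalA M x)) n (F x)) := by
  simp only [dexpTerm_apply_complex]
  exact (h.pow hQ n).smul hQ _

theorem exists_bound_evalA (hQ : IsOpen Q) (M : Matrix (Fin d) (Fin d) A) :
    ∃ α : ℝ, ∀ᵐ x ∂(volume.restrict Q), ‖S.evalA M x‖ ≤ α := by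
  refine ⟨∑ k, ∑ l, ‖M k l‖, ?_⟩
  have h : ∀ᵐ x ∂(volume.restrict Q), ∀ k l, ‖S.funA (M k l) x‖ ≤ ‖M k l‖ :=
    ae_all_iff.2 fun k => ae_all_iff.2 fun l => S.norm_funA_le hQ _
  filter_upwards [h] with x hx
  exact (norm_le_sum_entries _).trans
    (Finset.sum_le_sum fun k _ => Finset.sum_le_sum fun l _ => hx k l)

theorem locallyIntegrableOn_finset_sum {ι : Type*} (s : Finset ι) {f : ι → SpaceTime d → ℝ}
    (hf : ∀ i, LocallyIntegrableOn (f i) Q) :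
    LocallyIntegrableOn (fun x => ∑ i ∈ s, f i x) Q := by
  classical
  induction s using Finset.induction_on with
  | empty => simpa using (locallyIntegrable_const (0 : ℝ)).locallyIntegrableOn Q
  | insert i s hi ih =>
    simp only [Finset.sum_insert hi]
    exact (hf i).add ih

theorem locallyIntegrableOn_norm_entries (h : S.HasMatrixWeakDeriv v M F) :
    LocallyIntegrableOn (fun x => ∑ k, ∑ l, ‖F x k l‖) Q := by
  exact locallyIntegrableOn_finset_sum _ fun k => locallyIntegrableOn_finset_sum _ fun l =>
    (h k l).locallyIntegrable_deriv.norm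

theorem exists_bound_opL_opR (α : ℝ) : ∃ β : ℝ, ∀ a : Matrix (Fin d) (Fin d) ℂ, ‖a‖ ≤ α →
    ‖opL ℂ a‖ ≤ β ∧ ‖opR ℂ a‖ ≤ β := by
  obtain ⟨c, hc0, hc⟩ := exists_norm_opL_le (d := d) (A := ℂ) (B := ℂ)
  obtain ⟨c', hc0', hc'⟩ := exists_norm_opR_le (d := d) (A := ℂ) (B := ℂ)
  exact ⟨max (c * α) (c' * α), fun a ha =>
    ⟨(hc a).trans ((mul_le_mul_of_nonneg_left ha hc0).trans (le_max_left _ _)),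
      (hc' a).trans ((mul_le_mul_of_nonneg_left ha hc0').trans (le_max_right _ _))⟩⟩

theorem exists_bound_sum_dexpTerm_apply (α : ℝ) (k l : Fin d) :
    ∃ C : ℝ, ∀ a X : Matrix (Fin d) (Fin d) ℂ, ‖a‖ ≤ α → ∀ N : ℕ,
      ‖(∑ n ∈ Finset.range N, dexpTerm (opL ℂ a) (opR ℂ a) n X) k l‖ ≤
        C * ∑ k, ∑ l, ‖X k l‖ := by
  obtain ⟨β, hβ⟩ := exists_bound_opL_opR (d := d) α
  obtain ⟨C, hC0, hC⟩ := exists_bound_sum_dexpTerm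
    (R := Matrix (Fin d) (Fin d) ℂ →L[ℂ] Matrix (Fin d) (Fin d) ℂ) β
  obtain ⟨e, he0, he⟩ : ∃ e : ℝ, 0 ≤ e ∧ ∀ X : Matrix (Fin d) (Fin d) ℂ, ‖X k l‖ ≤ e * ‖X‖ :=
    let ⟨c, h0, h⟩ := (entryCLM k l : Matrix (Fin d) (Fin d) ℂ →L[ℂ] ℂ).bound
    ⟨c, h0.le, h⟩
  refine ⟨e * C, fun a X ha N => ?_⟩
  rw [← sum_apply, mul_assoc]
  exact (he _).trans (mul_le_mul_of_nonneg_left (((ContinuousLinearMap.le_opNorm _ _).trans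
    (mul_le_mul (hC (hβ a ha).1 (hβ a ha).2 N) (norm_le_sum_entries _) (norm_nonneg _) hC0))) he0)

theorem tendsto_sum_dexpTerm (a X : Matrix (Fin d) (Fin d) ℂ) (k l : Fin d) :
    Tendsto (fun N : ℕ => (∑ n ∈ Finset.range N, dexpTerm (opL ℂ a) (opR ℂ a) n X) k l) atTop
      (𝓝 (dexp (opL ℂ a) (opR ℂ a) X k l)) := by
  have h1 := ((hasSum_dexp (opL ℂ a) (opR ℂ a)).mapL
    (ContinuousLinearMap.apply ℂ (Matrix (Fin d) (Fin d) ℂ) X)).mapL (entryCLM k l)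
  refine h1.tendsto_sum_nat.congr fun N => ?_
  exact (Matrix.sum_apply k l (Finset.range N) fun n => dexpTerm (opL ℂ a) (opR ℂ a) n X).symm

section Term

variable [IsScalarTower ℂ A B] [ContinuousSMul A B]

theorem evalB_dexpTerm (M : Matrix (Fin d) (Fin d) A) (N : Matrix (Fin d) (Fin d) B) (n : ℕ) :
    ∀ᵐ x ∂(volume.restrict Q), S.evalB (dexpTerm (opL B M) (opR B M) n N) x =
      dexpTerm (opL ℂ (S.evalA M x)) (opR ℂ (S.evalA M x)) n (S.evalB N x) := by
  have h1 : ∀ᵐ x ∂(volume.restrict Q), ∀ i : ℕ,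
      S.evalB (mulL (M ^ i) (mulR N (M ^ (n - 1 - i)))) x =
        S.evalA M x ^ i * (S.evalB N x * S.evalA M x ^ (n - 1 - i)) := by
    refine ae_all_iff.2 fun i => ?_
    filter_upwards [S.evalB_mulL (M ^ i) (mulR N (M ^ (n - 1 - i))),
      S.evalB_mulR (M ^ (n - 1 - i)) N, S.evalA_pow M i, S.evalA_pow M (n - 1 - i)]
      with x e1 e2 e3 e4
    rw [e1, e2, e3, e4, mulL_complex, mulR_complex]
  have h2 : dexpTerm (opL B M) (opR B M) n N =
      (n ! : ℂ)⁻¹ • ∑ i ∈ Finset.range n, mulL (M ^ i) (mulR N (M ^ (n - 1 - i))) := by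
    rw [dexpTerm, smul_apply, sum_apply]
    simp only [mul_apply_eq_comp, ← opL_pow, ← opR_pow, opL_apply, opR_apply]
  rw [h2]
  filter_upwards [h1, S.evalB_smul (n ! : ℂ)⁻¹ (∑ i ∈ Finset.range n,
    mulL (M ^ i) (mulR N (M ^ (n - 1 - i)))), S.evalB_sum (Finset.range n) fun i =>
      mulL (M ^ i) (mulR N (M ^ (n - 1 - i)))] with x e1 e2 e3
  rw [e2, e3, dexpTerm_apply_complex]
  simp only [e1, mul_assoc]

variable [CompleteSpace B]

/-- This links the abstract operator series on matrices over `B` with the pointwise series on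
complex matrices: the terms agree almost everywhere, and the two kinds of limit are matched by
`funB_eq_of_tendsto`. -/
theorem evalB_dexp (hQ : IsOpen Q) (M : Matrix (Fin d) (Fin d) A) (N : Matrix (Fin d) (Fin d) B) :
    ∀ᵐ x ∂(volume.restrict Q), ∀ k l, S.funB (dexp (opL B M) (opR B M) N k l) x =
      dexp (opL ℂ (S.evalA M x)) (opR ℂ (S.evalA M x)) (S.evalB N x) k l := by
  refine ae_all_iff.2 fun k => ae_all_iff.2 fun l => ?_
  have hconv := (((hasSum_dexp (opL B M) (opR B M)).mapL
      (ContinuousLinearMap.apply ℂ (Matrix (Fin d) (Fin d) B) N)).mapL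
      (entryCLM k l)).tendsto_sum_nat
  refine S.funB_eq_of_tendsto hQ hconv ?_
  have h1 : ∀ᵐ x ∂(volume.restrict Q), ∀ n,
      S.evalB (dexpTerm (opL B M) (opR B M) n N) x =
        dexpTerm (opL ℂ (S.evalA M x)) (opR ℂ (S.evalA M x)) n (S.evalB N x) :=
    ae_all_iff.2 fun n => evalB_dexpTerm M N n
  have h2 : ∀ᵐ x ∂(volume.restrict Q), ∀ m, S.funB (∑ n ∈ Finset.range m,
      dexpTerm (opL B M) (opR B M) n N k l) x =
      ∑ n ∈ Finset.range m, S.funB (dexpTerm (opL B M) (opR B M) n N k l) x :=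
    ae_all_iff.2 fun m => S.funB_sum _ _
  filter_upwards [h1, h2] with x e1 e2
  have h3 := ((hasSum_dexp (opL ℂ (S.evalA M x)) (opR ℂ (S.evalA M x))).mapL
    (ContinuousLinearMap.apply ℂ (Matrix (Fin d) (Fin d) ℂ) (S.evalB N x))).mapL (entryCLM k l)
  refine h3.tendsto_sum_nat.congr fun m => ?_
  refine Eq.trans (Finset.sum_congr rfl fun n _ => ?_) (e2 m).symm
  exact (congrFun (congrFun (e1 n) k) l).symm

end Term

variable [CompleteSpace A]

/-- The limit of the differentiated partial sums. Convergence in `A` bounds the partial sums by a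
constant, and the essential bound on `M` bounds the partial sums of `dexp` uniformly, so a multiple
of the entry sum of `F` dominates the derivatives. -/
theorem HasMatrixWeakDeriv.exp (h : S.HasMatrixWeakDeriv v M F) (hQ : IsOpen Q) :
    S.HasMatrixWeakDeriv v (NormedSpace.exp M) (fun x =>
      dexp (opL ℂ (S.evalA M x)) (opR ℂ (S.evalA M x)) (F x)) := by
  intro k l
  have hpart := fun N : ℕ => HasMatrixWeakDeriv.sum (Finset.range N) (fun n => h.exp_term hQ n) hQ
  have hconv : Tendsto (fun N : ℕ => (∑ n ∈ Finset.range N, (n ! : ℂ)⁻¹ • M ^ n) k l) atTop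
      (𝓝 (NormedSpace.exp M k l)) :=
    ((entryCLM k l).continuous.tendsto _).comp (hasSum_exp M).tendsto_sum_nat
  obtain ⟨c, hc⟩ := hconv.norm.bddAbove_range
  obtain ⟨α, hα⟩ := exists_bound_evalA (S := S) hQ M
  obtain ⟨C, hC⟩ := exists_bound_sum_dexpTerm_apply α k l
  refine HasWeakDeriv.of_tendsto hQ (fun N => hpart N k l) (b := fun _ => c)
    (b' := fun x => C * ∑ k, ∑ l, ‖F x k l‖)
    ((locallyIntegrable_const c).locallyIntegrableOn Q) ?_ (fun N => ?_) (fun N => ?_)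
    (S.tendsto_funA hQ hconv) ?_
  · intro x hx
    obtain ⟨s, hs, hi⟩ := locallyIntegrableOn_norm_entries h x hx
    exact ⟨s, hs, Integrable.const_mul hi _⟩
  · filter_upwards [S.norm_funA_le hQ ((∑ n ∈ Finset.range N, (n ! : ℂ)⁻¹ • M ^ n) k l)] with x hx
    exact hx.trans (hc ⟨N, rfl⟩)
  · filter_upwards [hα] with x hx
    exact hC _ _ hx N
  · exact Eventually.of_forall fun x => tendsto_sum_dexpTerm _ _ k l

/-- Powers of a symmetric real-valued matrix are again symmetric and real-valued, the series has
real coefficients, and both properties survive the limit. -/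
theorem exp_mem_hSym (hQ : IsOpen Q) (hM : M ∈ S.HSym) : NormedSpace.exp M ∈ S.HSym := by
  obtain ⟨hsymm, hreal⟩ := hM
  have hpow : ∀ n : ℕ, ∀ᵐ x ∂(volume.restrict Q), ∀ k l, (S.funA ((M ^ n) k l) x).im = 0 := by
    have hreal' : ∀ᵐ x ∂(volume.restrict Q), ∀ k l, (S.funA (M k l) x).im = 0 :=
      ae_all_iff.2 fun k => ae_all_iff.2 fun l => hreal k l
    intro n
    induction n with
    | zero =>
      filter_upwards [S.evalA_one] with x hx k l
      have h1 : S.funA ((1 : Matrix (Fin d) (Fin d) A) k l) x =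
        (1 : Matrix (Fin d) (Fin d) ℂ) k l := congrFun (congrFun hx k) l
      rw [pow_zero, h1, Matrix.one_apply]
      split_ifs <;> simp
    | succ n ih =>
      filter_upwards [S.evalA_mul (M ^ n) M, ih, hreal'] with x hx h1 h2 k l
      have h3 : S.funA ((M ^ n * M) k l) x = (S.evalA (M ^ n) x * S.evalA M x) k l :=
        congrFun (congrFun hx k) l
      rw [pow_succ, h3, Matrix.mul_apply, Complex.im_sum]
      refine Finset.sum_eq_zero fun i _ => ?_
      rw [Complex.mul_im]
      simp only [evalA, Matrix.of_apply, h1, h2, mul_zero, zero_mul, add_zero]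
  refine ⟨?_, fun k l => ?_⟩
  · refine HasSum.unique (f := fun n : ℕ => (n ! : ℂ)⁻¹ • M ^ n) ?_ (hasSum_exp M)
    have ht : Continuous (Matrix.transpose : Matrix (Fin d) (Fin d) A → Matrix (Fin d) (Fin d) A) :=
      continuous_matrix_of_entry fun k l => continuous_entry l k
    refine ((hasSum_exp M).map (Matrix.transposeAddEquiv (Fin d) (Fin d) A) ht).congr_fun
      fun n => ?_
    simp [Matrix.transpose_pow, hsymm]
  · have hconv : Tendsto (fun N : ℕ => ∑ n ∈ Finset.range N, ((n ! : ℂ)⁻¹ • M ^ n) k l) atTop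
        (𝓝 (NormedSpace.exp M k l)) :=
      ((hasSum_exp M).mapL (entryCLM k l)).tendsto_sum_nat
    have h1 : ∀ᵐ x ∂(volume.restrict Q), ∀ N : ℕ,
        S.funA (∑ n ∈ Finset.range N, ((n ! : ℂ)⁻¹ • M ^ n) k l) x =
          ∑ n ∈ Finset.range N, S.funA (((n ! : ℂ)⁻¹ • M ^ n) k l) x :=
      ae_all_iff.2 fun N => S.funA_sum _ _
    have h2 : ∀ᵐ x ∂(volume.restrict Q), ∀ n : ℕ, S.funA (((n ! : ℂ)⁻¹ • M ^ n) k l) x =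
        (n ! : ℂ)⁻¹ * S.funA ((M ^ n) k l) x := ae_all_iff.2 fun n => by
      rw [Matrix.smul_apply, map_smul]
      exact AEEqFun.coeFn_smul _ _
    filter_upwards [S.tendsto_funA hQ hconv, h1, h2, ae_all_iff.2 hpow] with x e0 e1 e2 e3
    refine tendsto_nhds_unique ((Complex.continuous_im.tendsto _).comp e0) ?_
    refine tendsto_const_nhds.congr fun N => ?_
    rw [Function.comp_apply, e1, Complex.im_sum]
    refine (Finset.sum_eq_zero fun n _ => ?_).symm
    rw [e2, Complex.mul_im, e3]
    simp [Complex.inv_im]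

variable [CompleteSpace B] [IsScalarTower ℂ A B] [ContinuousSMul A B]

/-- At almost every point, the same linear map `dexp` sends each partial derivative of `M` to that
of its exponential. The components of `u` are scalars there, so the map passes through the material
derivative and no regularity of `u` is needed. -/
theorem HasMaterialDeriv.exp (hQ : IsOpen Q) {u : SpaceTime d → EuclideanSpace ℝ (Fin d)}
    {N : Matrix (Fin d) (Fin d) B} (h : S.HasMaterialDeriv u M N) :
    S.HasMaterialDeriv u (NormedSpace.exp M) (dexp (opL B M) (opR B M) N) := by
  choose ft fx ht hx hN using h
  have hT : S.HasMatrixWeakDeriv (timeDir d) M (fun x => Matrix.of fun k l => ft k l x) := ht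
  have hX : ∀ i, S.HasMatrixWeakDeriv (spaceDir i) M (fun x => Matrix.of fun k l => fx k l i x) :=
    fun i k l => hx k l i
  have hN' : ∀ᵐ x ∂(volume.restrict Q), ∀ k l,
      ft k l x + ∑ i, (u x i : ℂ) * fx k l i x = S.funB (N k l) x :=
    ae_all_iff.2 fun k => ae_all_iff.2 fun l => hN k l
  intro k l
  refine ⟨_, fun i => _, (hT.exp hQ) k l, fun i => ((hX i).exp hQ) k l, ?_⟩
  filter_upwards [hN', evalB_dexp (S := S) hQ M N] with x e1 e2
  rw [e2]
  have e3 : S.evalB N x = (Matrix.of fun k l => ft k l x) +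
      ∑ i, (u x i : ℂ) • (Matrix.of fun k l => fx k l i x) := by
    ext k l
    rw [evalB, Matrix.of_apply, ← e1, Matrix.add_apply, Matrix.sum_apply]
    simp
  rw [e3, map_add, map_sum, Matrix.add_apply, Matrix.sum_apply]
  simp only [map_smul, Matrix.smul_apply, smul_eq_mul]

end FunctionSpaces

end Spaces

end

end LogConformation

end

theorem theorem1 {d : ℕ} (T : ℝ) (hT : 0 < T) (D : Set (EuclideanSpace ℝ (Fin d)))
    (hD : IsOpen D)
    {A B : Type*} [NormedCommRing A] [NormedAlgebra ℂ A] [CompleteSpace A]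
    [NormedAddCommGroup B] [NormedSpace ℂ B] [CompleteSpace B]
    [Module A B] [IsScalarTower ℂ A B] [ContinuousSMul A B]
    (S : LogConformation.FunctionSpaces (LogConformation.cylinder T D) A B)
    (u : LogConformation.SpaceTime d → EuclideanSpace ℝ (Fin d))
    (G : Matrix (Fin d) (Fin d) B) (hG : S.HasGradient u G)
    (lam : ℝ) (hlam : 0 < lam)
    (Ψ : Matrix (Fin d) (Fin d) A) (hΨ : Ψ ∈ S.HSym)
    (P : ℂ → ℂ) (U : Set ℂ) (hU : IsOpen U) (hP : AnalyticOnNhd ℂ P U)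
    (γP : ℝ → ℂ)
    (hγP : LogConformation.EncirclesOnce γP (spectrum ℂ (NormedSpace.exp Ψ)) U)
    (γ : ℝ → ℂ)
    (hγ : LogConformation.EncirclesOnce γ (spectrum ℂ Ψ) LogConformation.strip)
    (hlog : S.SolvesLogConformation u G lam P γP γ Ψ) :
    NormedSpace.exp Ψ ∈ S.HSym ∧
      S.SolvesConformation u G lam P γP (NormedSpace.exp Ψ) := by
  have hQ : IsOpen (LogConformation.cylinder T D) := isOpen_Ioo.prod hD
  obtain ⟨N, hN, heq⟩ := hlog
  exact ⟨LogConformation.FunctionSpaces.exp_mem_hSym hQ hΨ, _,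
    LogConformation.FunctionSpaces.HasMaterialDeriv.exp hQ hN,
    LogConformation.conformation_equation hγ hγP hP.continuousOn S.incl S.incl_mul heq⟩
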